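/- **Setting.** Let $G$ be a locally compact second countable (Hausdorff) group and $\Gamma\subset G$ a lattice, i.e. a discrete subgroup such that $G/\Gamma$ carries a non-zero finite $G$-invariant Borel measure. Let $m_G$ be the Haar measure normalized so that a fundamental domain $F$ for the right translation action of $\Gamma$ on $G$ has $m_G(F)=1$. Let $(X,\mu)$ be a standard Borel probability space with a measurable, measure-preserving action of $\Gamma$. The induced space is $Y=(G\times X)/\Gamma$, the quotient by the right action $(g,x)\cdot\gamma=(g\gamma,\gamma^{-1}x)$, with the $G$-action $g_1\cdot(g,x)\Gamma=(g_1g,x)\Gamma$ and the probability measure $\nu$ obtained as the image of $m_G|_F\otimes\mu$. "Bounded" means relatively compact. Let $\{\mathcal O_\varepsilon\}_{0<\varepsilon<1}$ be symmetric, bounded, measurable neighbourhoods of $e$ in $G$, increasing with $\varepsilon$, of finite upper local dimension $$\varrho_0=\limsup_{\varepsilon\to0^+}\frac{\log m_G(\mathcal O_\varepsilon)}{\log\varepsilon}<\infty .$$ Let $G_t$ be an increasing family of bounded Borel subsets of $G$, with $t$ ranging over $T=(0,\infty)$ (a $1$-parameter family) or $T=\{1,2,3,\dots\}$ (a sequence).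 Let $\beta_t$ be the Haar-uniform probability measure on $G_t$, and $\lambda_t$ the uniform probability measure on $\Gamma\cap G_t$ (either one is read as $0$ when the set is null, respectively empty). For a measure $\beta$ on a group acting on $Z$ put $\pi(\beta)f(z)=\int f(h^{-1}z)\,d\beta(h)$; $\beta_t$ acts on functions on $Y$ and $\lambda_t$ on functions on $X$. **Families of sets.** * $G_t$ is *coarsely admissible* if for every bounded $B\subset G$ there is $c\in T$ with $BG_tB\subset G_{t+c}$ for all large $t\in T$, and for every $c\in T$ there is $d>0$ with $m_G(G_{t+c})\le d\,m_G(G_t)$ for all large $t\in T$. * A $1$-parameter family is *admissible* (w.r.t. $\mathcal O_\varepsilon$) if it is coarsely admissible and there are $c,t_0>0$ and $\varepsilon_0\in(0,1)$ with $\mathcal O_\varepsilon G_t\mathcal O_\varepsilon\subset G_{t+c\varepsilon}$ and $m_G(G_{t+\varepsilon})\le(1+c\varepsilon)m_G(G_t)$ for all $t\ge t_0$, $0<\varepsilon\le\varepsilon_0$. A sequence is *admissible* if $G$ is totally disconnected, the sequence is coarsely admissible, and there are a compact open subgroup $K_0$ and $t_0>0$ with $K_0G_tK_0=G_t$ for all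 $t\ge t_0$. * A $1$-parameter family is *quasi-uniform* if for every $\varepsilon>0$ there is a neighbourhood $\mathcal O$ of $e$ with $\mathcal O G_t\mathcal O\subset G_{t+\varepsilon}$ for all large $t$, and for every $\delta>0$ there is $\varepsilon>0$ with $m_G(G_{t+\varepsilon})\le(1+\delta)m_G(G_t)$ for all large $t$. **Ergodic theorems.** Let $\sigma_t$ ($t\in T$) be probability measures on a group acting on a probability space $(Z,\eta)$; $f$ is real-valued and $1\le r\le p\le\infty$. * *Strong maximal inequality in $(L^p,L^r)$* (in $L^q$ if $p=r=q$): there are $t_0\ge0$, $C>0$ with $\|\sup_{t>t_0}|\pi(\sigma_t)f|\|_{L^r(\eta)}\le C\|f\|_{L^p(\eta)}$ for all $f\in L^p(\eta)$. * *Mean ergodic theorem in $L^p$*: $\|\pi(\sigma_t)f-\int f\,d\eta\|_{L^p(\eta)}\to0$ as $t\to\infty$ for all $f\in L^p(\eta)$. * *Pointwise ergodic theorem in $L^p$*: for all $f\in L^p(\eta)$, $\pi(\sigma_t)f(z)\to\int f\,d\eta$ as $t\to\infty$ for $\eta$-a.e. $z$. * *Exponential mean ergodic theorem in $(L^p,L^r)$*: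 there are $C,\theta>0$ with $\|\pi(\sigma_t)f-\int f\,d\eta\|_{L^r(\eta)}\le Ce^{-\theta t}\|f\|_{L^p(\eta)}$ for all $f\in L^p(\eta)$ and $t\in T$. * *Exponential strong maximal inequality in $(L^p,L^r)$*: there are $t_0\ge0$, $C,\theta>0$ with $\|\sup_{t\ge t_0}e^{\theta t}|\pi(\sigma_t)f-\int f\,d\eta|\|_{L^r(\eta)}\le C\|f\|_{L^p(\eta)}$ for all $f\in L^p(\eta)$. **Theorem (Reduction Theorem).** Let $\infty\ge p\ge r\ge1$. In the above setting: 1. If $\{G_t\}$ is coarsely admissible, then the strong maximal inequality for $\beta_t$ in $(L^p(\nu),L^r(\nu))$ implies the strong maximal inequality for $\lambda_t$ in $(L^p(\mu),L^r(\mu))$. 2. If $\{G_t\}$ is admissible, then the mean ergodic theorem for $\beta_t$ in $L^p(\nu)$ implies the mean ergodic theorem for $\lambda_t$ in $L^p(\mu)$. 3. If $\{G_t\}_{t>0}$ is quasi-uniform, then the pointwise ergodic theorem for $\beta_t$ in $L^p(\nu)$ implies the pointwise ergodic theorem for $\lambda_t$ in $L^p(\mu)$. 4. If $\{G_t\}$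 is an admissible $1$-parameter family and $r>\varrho_0$, or an admissible sequence, then the exponential mean ergodic theorem for $\beta_t$ in $(L^p(\nu),L^r(\nu))$ implies the exponential mean ergodic theorem for $\lambda_t$ in $(L^p(\mu),L^r(\mu))$ (possibly with another rate). 5. If $\{G_t\}$ is an admissible $1$-parameter family and $r>\varrho_0$, or an admissible sequence, and $\beta_t$ satisfies the exponential mean ergodic theorem in $(L^p(\nu),L^r(\nu))$ and the strong maximal inequality in $L^q(\nu)$ for some $1<q\le\infty$, then for every $u\in(0,1)$ the family $\lambda_t$ satisfies the exponential strong maximal inequality in $(L^{p'}(\mu),L^{r'}(\mu))$, where $1/p'=(1-u)/q$ and $1/r'=(1-u)/q+u/r$. -/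

import Mathlib

open MeasureTheory Filter Topology Set ProbabilityTheory
open scoped ENNReal Pointwise

noncomputable section

namespace LatticeErgodic

/-! ### Averaging operators, maximal inequalities and ergodic theorems -/

section Averages

variable {H Z : Type*} [Group H] [MeasurableSpace H] [MulAction H Z]

/-- The operator `π(β)` attached to a measure `β` on the acting group:
`(π(β) f)(z) = ∫ f(h⁻¹ z) dβ(h)`. -/
def actionAverage (β : Measure H) (f : Z → ℝ) (z : Z) : ℝ :=
  ∫ h, f (h⁻¹ • z) ∂β

variable [MeasurableSpace Z]

/-- The strong maximal inequality in `(L^p(η), L^r(η))` for a family `β t`, `t ∈ T`. -/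
def StrongMaximalInequality (T : Set ℝ) (β : ℝ → Measure H) (p r : ℝ≥0∞) (η : Measure Z) :
    Prop :=
  ∃ t₀ : ℝ, 0 ≤ t₀ ∧ ∃ C : ℝ, 0 < C ∧ ∀ f : Z → ℝ, MemLp f p η →
    eLpNorm (fun z => ⨆ t ∈ T, ⨆ _ : t₀ < t, ‖actionAverage (β t) f z‖ₑ) r η
      ≤ ENNReal.ofReal C * eLpNorm f p η

/-- The mean ergodic theorem in `L^p(η)`. -/
def MeanErgodicTheorem (T : Set ℝ) (β : ℝ → Measure H) (p : ℝ≥0∞) (η : Measure Z) : Prop :=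
  ∀ f : Z → ℝ, MemLp f p η →
    Tendsto (fun t => eLpNorm (fun z => actionAverage (β t) f z - ∫ w, f w ∂η) p η)
      (atTop ⊓ 𝓟 T) (𝓝 0)

/-- The pointwise ergodic theorem in `L^p(η)`. -/
def PointwiseErgodicTheorem (T : Set ℝ) (β : ℝ → Measure H) (p : ℝ≥0∞) (η : Measure Z) :
    Prop :=
  ∀ f : Z → ℝ, MemLp f p η →
    ∀ᵐ z ∂η, Tendsto (fun t => actionAverage (β t) f z) (atTop ⊓ 𝓟 T) (𝓝 (∫ w, f w ∂η))

/-- The exponentially fast mean ergodic theorem in `(L^p(η), L^r(η))`. -/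
def ExpMeanErgodicTheorem (T : Set ℝ) (β : ℝ → Measure H) (p r : ℝ≥0∞) (η : Measure Z) :
    Prop :=
  ∃ C : ℝ, 0 < C ∧ ∃ θ : ℝ, 0 < θ ∧ ∀ f : Z → ℝ, MemLp f p η → ∀ t ∈ T,
    eLpNorm (fun z => actionAverage (β t) f z - ∫ w, f w ∂η) r η
      ≤ ENNReal.ofReal (C * Real.exp (-(t * θ))) * eLpNorm f p η

/-- The exponential strong maximal inequality in `(L^p(η), L^r(η))`. -/
def ExpStrongMaximalInequality (T : Set ℝ) (β : ℝ → Measure H) (p r : ℝ≥0∞)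
    (η : Measure Z) : Prop :=
  ∃ t₀ : ℝ, 0 ≤ t₀ ∧ ∃ C : ℝ, 0 < C ∧ ∃ θ : ℝ, 0 < θ ∧ ∀ f : Z → ℝ, MemLp f p η →
    eLpNorm (fun z => ⨆ t ∈ T, ⨆ _ : t₀ ≤ t,
        ENNReal.ofReal (Real.exp (t * θ)) * ‖actionAverage (β t) f z - ∫ w, f w ∂η‖ₑ) r η
      ≤ ENNReal.ofReal C * eLpNorm f p η

end Averages

/-! ### Families of sets in a locally compact group -/

/-- The parameter set of a one-parameter family. -/
def realTimes : Set ℝ := Ioi 0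

/-- The parameter set of a sequence: the positive integers. -/
def natTimes : Set ℝ := {t | ∃ n : ℕ, 0 < n ∧ t = n}

section Families

variable {G : Type*} [Group G] [TopologicalSpace G] [MeasurableSpace G]

/-- An increasing family of bounded (relatively compact) Borel sets, indexed by `t ∈ T`. -/
structure IsIncreasingBoundedFamily (T : Set ℝ) (A : ℝ → Set G) : Prop where
  measurableSet : ∀ t ∈ T, MeasurableSet (A t)
  bounded : ∀ t ∈ T, IsCompact (closure (A t))
  mono : MonotoneOn A T

/-- A family `O ε`, `0 < ε < 1`, of symmetric bounded neighbourhoods of the identity which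
increases with `ε`. -/
structure IsNhdFamily (O : ℝ → Set G) : Prop where
  mem_nhds : ∀ ε ∈ Ioo (0 : ℝ) 1, O ε ∈ 𝓝 (1 : G)
  measurableSet : ∀ ε ∈ Ioo (0 : ℝ) 1, MeasurableSet (O ε)
  symm : ∀ ε ∈ Ioo (0 : ℝ) 1, (O ε)⁻¹ = O ε
  bounded : ∀ ε ∈ Ioo (0 : ℝ) 1, IsCompact (closure (O ε))
  mono : MonotoneOn O (Ioo 0 1)

/-- The upper local dimension `limsup_{ε → 0+} log m(O ε) / log ε`. -/
def upperLocalDimension (m : Measure G) (O : ℝ → Set G) : EReal :=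
  limsup (fun ε : ℝ => ((Real.log (m (O ε)).toReal / Real.log ε : ℝ) : EReal)) (𝓝[>] 0)

/-- Coarse admissibility. For one-parameter families the shift `c` is a positive real, for
sequences a positive integer. -/
structure IsCoarselyAdmissible (m : Measure G) (T : Set ℝ) (A : ℝ → Set G) : Prop where
  stable : ∀ B : Set G, IsCompact (closure B) → ∃ c ∈ T, ∃ t₁ : ℝ, ∀ t ∈ T, t₁ ≤ t →
    B * A t * B ⊆ A (t + c)
  growth : ∀ c ∈ T, ∃ d : ℝ, 0 < d ∧ ∃ t₁ : ℝ, ∀ t ∈ T, t₁ ≤ t →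
    m (A (t + c)) ≤ ENNReal.ofReal d * m (A t)

/-- Admissible one-parameter families, with respect to the neighbourhoods `O ε`. -/
structure IsAdmissibleFamily (m : Measure G) (O : ℝ → Set G) (A : ℝ → Set G) : Prop where
  coarse : IsCoarselyAdmissible m realTimes A
  lipschitz : ∃ c : ℝ, 0 < c ∧ ∃ t₀ : ℝ, 0 < t₀ ∧ ∃ ε₀ ∈ Ioo (0 : ℝ) 1,
    ∀ t : ℝ, t₀ ≤ t → ∀ ε : ℝ, 0 < ε → ε ≤ ε₀ →
      O ε * A t * O ε ⊆ A (t + c * ε) ∧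
      m (A (t + ε)) ≤ ENNReal.ofReal (1 + c * ε) * m (A t)

/-- Admissible sequences, on totally disconnected groups. -/
structure IsAdmissibleSequence (m : Measure G) (A : ℝ → Set G) : Prop where
  totallyDisconnected : TotallyDisconnectedSpace G
  coarse : IsCoarselyAdmissible m natTimes A
  invariant : ∃ K₀ : Subgroup G, IsOpen (K₀ : Set G) ∧ IsCompact (K₀ : Set G) ∧
    ∃ t₀ : ℝ, 0 < t₀ ∧ ∀ t ∈ natTimes, t₀ ≤ t → (K₀ : Set G) * A t * (K₀ : Set G) = A t

/-- Quasi-uniform one-parameter families: local stability under small two-sided translations,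
and quasi-uniform continuity of the logarithm of the volume. -/
structure IsQuasiUniform (m : Measure G) (A : ℝ → Set G) : Prop where
  stable : ∀ ε : ℝ, 0 < ε → ∃ U ∈ 𝓝 (1 : G), ∃ t₁ : ℝ, ∀ t ∈ realTimes, t₁ ≤ t →
    U * A t * U ⊆ A (t + ε)
  continuity : ∀ δ : ℝ, 0 < δ → ∃ ε : ℝ, 0 < ε ∧ ∃ t₁ : ℝ, ∀ t ∈ realTimes, t₁ ≤ t →
    m (A (t + ε)) ≤ ENNReal.ofReal (1 + δ) * m (A t)

/-- A lattice: a discrete subgroup `Γ` such that `G ⧸ Γ` carries a nonzero finite `G`-invariant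
Borel measure. -/
structure IsLattice (Γ : Subgroup G) : Prop where
  discrete : DiscreteTopology Γ
  finite_covolume : ∃ η : Measure (G ⧸ Γ),
    IsFiniteMeasure η ∧ η ≠ 0 ∧ SMulInvariantMeasure G (G ⧸ Γ) η

end Families

/-- `β_t`: the Haar-uniform probability measure on the set `A t`. -/
def haarUniform {G : Type*} [MeasurableSpace G] (m : Measure G) (A : ℝ → Set G) (t : ℝ) :
    Measure G :=
  ProbabilityTheory.cond m (A t)

/-- `λ_t`: the uniform probability measure on the finite set `Γ ∩ A t`. -/
def latticeUniform {G : Type*} [Group G] [MeasurableSpace G] (Γ : Subgroup G)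
    (A : ℝ → Set G) (t : ℝ) : Measure Γ :=
  ProbabilityTheory.uniformOn {γ : Γ | (γ : G) ∈ A t}

/-! ### The induced action -/

section Induced

variable {G : Type*} [Group G] (Γ : Subgroup G) (X : Type*) [MulAction Γ X]

/-- Two points of `G × X` are equivalent when they lie in the same orbit of the right action
`(g, x) · γ = (g γ, γ⁻¹ x)` of `Γ`. -/
def inducedSetoid : Setoid (G × X) where
  r a b := ∃ γ : Γ, b = (a.1 * (γ : G), γ⁻¹ • a.2)
  iseqv :=
    { refl := fun a => ⟨1, by simp⟩
      symm := by
        rintro a b ⟨γ, rfl⟩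
        exact ⟨γ⁻¹, by simp⟩
      trans := by
        rintro a b c ⟨γ, rfl⟩ ⟨δ, rfl⟩
        exact ⟨γ * δ, by simp [mul_assoc, mul_smul]⟩ }

/-- The space `Y = (G × X) / Γ` of the induced action. -/
def InducedSpace : Type _ := Quotient (inducedSetoid Γ X)

/-- The projection `π : G × X → Y`. -/
def inducedMk (a : G × X) : InducedSpace Γ X := Quotient.mk (inducedSetoid Γ X) a

/-- `Y` carries the quotient Borel structure. -/
instance [MeasurableSpace G] [MeasurableSpace X] : MeasurableSpace (InducedSpace Γ X) :=
  MeasurableSpace.map (inducedMk Γ X) inferInstance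

/-- The action `g₁ · (g, x)Γ = (g₁ g, x)Γ` of `G` on `Y`. -/
instance : MulAction G (InducedSpace Γ X) where
  smul g := Quotient.map (fun a : G × X => (g * a.1, a.2)) (by
    rintro a b ⟨γ, rfl⟩
    exact ⟨γ, by simp [mul_assoc]⟩)
  one_smul y := Quotient.inductionOn y fun a =>
    show inducedMk Γ X (1 * a.1, a.2) = inducedMk Γ X a by simp
  mul_smul g h y := Quotient.inductionOn y fun a =>
    show inducedMk Γ X (g * h * a.1, a.2) = inducedMk Γ X (g * (h * a.1), a.2) by
      rw [mul_assoc]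

/-- The measure `ν` on `Y`: the image of `m ⊗ μ` restricted to `F × X`, where `F` is a
fundamental domain for the right translation action of `Γ` on `G`. -/
def inducedMeasure [MeasurableSpace G] [MeasurableSpace X] (m : Measure G) (F : Set G)
    (μ : Measure X) : Measure (InducedSpace Γ X) :=
  ((m.restrict F).prod μ).map (inducedMk Γ X)

end Induced

end LatticeErgodic

end

open LatticeErgodic

noncomputable section

set_option linter.unusedSectionVars false

namespace LatticeErgodic

/-! ### Unimodularity of a group containing a lattice -/

section Unimodular

variable {G : Type*} [Group G] [TopologicalSpace G] [IsTopologicalGroup G] [T2Space G]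
  [MeasurableSpace G] [BorelSpace G]

/-! Everything rests on one pointwise comparison. Fix U ⊆ G of positive measure whose right
translates by Γ are disjoint, and attach to φ ≥ 0 on X the periodization Φ of (1_U / m(U)) ⊗ φ
(`inducedFun`). At the point (h, x)Γ with h ∈ U, the integral of g ↦ Φ(g⁻¹ · (h, x)Γ) over A equals
Σ_γ w_γ φ(γ⁻¹x), where w_γ = m{g ∈ A : g⁻¹hγ ∈ U} / m(U). By unimodularity w_γ ≤ 1; it vanishes
unless γ ∈ U⁻¹AU, and it equals 1 when UγU⁻¹ ⊆ A. So if U moves A_t into A_{t+s} on both sides, the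
unnormalized lattice sum over Γ ∩ A_t lies between m(A_{t-s}) π(β_{t-s})Φ and m(A_{t+s}) π(β_{t+s})Φ
(`le_latticeCount_mul`, `latticeCount_mul_le`). The lattice sum does not depend on h ∈ U, and the
projection carries m|_U ⊗ μ to a restriction of ν, so L^r bounds pass from Y to X at the price of a
factor m(U)^(1/r) (`mul_eLpNorm_le_of_le`).

For the maximal inequality a single U with a possibly large s suffices: volumes at t and t + s are
comparable, and lattice counts are comparable to volumes
(`IsCoarselyAdmissible.exists_latticeCount_bounds`). For the mean and pointwise theorems U is chosen
so that the volume changes by a factor at most 1 + δ between t and t + s (`HasThickenings`). The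
sandwich for φ = 1 shows that the count is asymptotic to the volume up to O(δ), and dividing gives
the theorem with an error O(δ). Pointwise convergence uses Fubini to find h ∈ U good for almost
every x.

For the exponential theorem the scale is ε = e^(-ηt). Finite upper local dimension makes m(U) at
least a multiple of ε^ρ, so the negative powers of m(U) produced by the transfer cost only part of
the exponential rate (`HasFineThickenings`).

The exponential maximal inequality is then proved on X alone, from the two theorems already
transferred. Over a unit of time the finite sets Γ ∩ A_t are nested and grow by a bounded factor, so
for a bounded function about 1/δ of the averages approximate all of them up to O(δ)
(`IsDoubling.exists_finset`). Exponential decay of each average then gives decay of the supremum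
over the window, and the windows are summed. Unbounded functions are truncated, the tail being
controlled by the maximal function of a power of |f|; this replaces operator interpolation. -/

lemma IsLattice.finite_inter {Γ : Subgroup G} (hΓ : IsLattice Γ) {K : Set G}
    (hK : IsCompact (closure K)) : {γ : Γ | (γ : G) ∈ K}.Finite := by
  have := hΓ.discrete
  have h1 := Γ.tendsto_coe_cofinite_of_discrete ⟨hΓ.discrete⟩
  rw [tendsto_cofinite_cocompact_iff] at h1
  refine (h1 _ hK).subset fun γ hγ => subset_closure hγ

lemma IsLattice.countable [SecondCountableTopology G] {Γ : Subgroup G} (hΓ : IsLattice Γ) :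
    Countable Γ := by
  have := hΓ.discrete
  exact TopologicalSpace.separableSpace_iff_countable.1 inferInstance

/-- The counting measure on a left coset of `Γ`, as a measure on `G`. -/
def cosetMeasure (Γ : Subgroup G) (q : G ⧸ Γ) : Measure G :=
  Measure.sum fun γ : Γ => Measure.dirac (q.out * (γ : G))

lemma cosetMeasure_apply (Γ : Subgroup G) [Countable Γ] (g : G) {s : Set G}
    (hs : MeasurableSet s) :
    cosetMeasure Γ (g : G ⧸ Γ) s = ∑' γ : Γ, s.indicator 1 (g * (γ : G)) := by
  obtain ⟨γ₀, hγ₀⟩ := QuotientGroup.mk_out_eq_mul Γ g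
  rw [cosetMeasure, Measure.sum_apply _ hs,
    ← (Equiv.mulLeft γ₀).tsum_eq fun γ : Γ => s.indicator (1 : G → ℝ≥0∞) (g * (γ : G))]
  refine tsum_congr fun γ => ?_
  rw [Measure.dirac_apply' _ hs, hγ₀]
  simp [mul_assoc]

lemma measurable_cosetMeasure (Γ : Subgroup G) [Countable Γ] :
    Measurable (cosetMeasure Γ) := by
  refine Measure.measurable_of_measurable_coe _ fun s hs => ?_
  refine measurable_from_quotient.2 ?_
  have : ((fun q : G ⧸ Γ => cosetMeasure Γ q s) ∘ Quotient.mk'') =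
      fun g : G => ∑' γ : Γ, s.indicator (1 : G → ℝ≥0∞) (g * (γ : G)) := by
    funext g
    exact cosetMeasure_apply Γ g hs
  rw [this]
  refine Measurable.tsum fun γ => ?_
  exact (measurable_one.indicator hs).comp (continuous_mul_const _).measurable

/-- Right translation by γ permutes the points of each coset gΓ. -/
lemma bind_cosetMeasure_preimage_mul_right (Γ : Subgroup G) [Countable Γ] (η : Measure (G ⧸ Γ))
    (γ : Γ) {s : Set G} (hs : MeasurableSet s) :
    η.bind (cosetMeasure Γ) ((· * (γ : G)) ⁻¹' s) = η.bind (cosetMeasure Γ) s := by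
  have hs' : MeasurableSet ((· * (γ : G)) ⁻¹' s) := (continuous_mul_const _).measurable hs
  rw [Measure.bind_apply hs (measurable_cosetMeasure Γ).aemeasurable,
    Measure.bind_apply hs' (measurable_cosetMeasure Γ).aemeasurable]
  refine lintegral_congr fun q => ?_
  induction q using QuotientGroup.induction_on with
  | H g =>
    rw [cosetMeasure_apply Γ g hs, cosetMeasure_apply Γ g hs',
      ← (Equiv.mulRight γ).tsum_eq (fun γ' : Γ => s.indicator 1 (g * (γ' : G)))]
    refine tsum_congr fun γ' => ?_
    refine (Set.indicator_comp_right (s := s) (g := (1 : G → ℝ≥0∞)) (· * (γ : G))).trans ?_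
    simp [mul_assoc]

lemma bind_cosetMeasure_preimage_mul_left (Γ : Subgroup G) [Countable Γ] (η : Measure (G ⧸ Γ))
    [SMulInvariantMeasure G (G ⧸ Γ) η] (h : G) {s : Set G} (hs : MeasurableSet s) :
    η.bind (cosetMeasure Γ) ((h * ·) ⁻¹' s) = η.bind (cosetMeasure Γ) s := by
  have hs' : MeasurableSet ((h * ·) ⁻¹' s) := (continuous_const_mul _).measurable hs
  have hsm : Measurable fun q : G ⧸ Γ => h • q := by
    refine measurable_from_quotient.2 ?_
    exact QuotientGroup.measurable_coe.comp (measurable_const_mul h)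
  rw [Measure.bind_apply hs (measurable_cosetMeasure Γ).aemeasurable,
    Measure.bind_apply hs' (measurable_cosetMeasure Γ).aemeasurable]
  have hinv : Measure.map (fun q : G ⧸ Γ => h • q) η = η := by
    ext t ht
    rw [Measure.map_apply hsm ht]
    exact SMulInvariantMeasure.measure_preimage_smul h ht
  conv_rhs => rw [← hinv]
  rw [lintegral_map (f := fun q => cosetMeasure Γ q s)
    ((Measure.measurable_coe hs).comp (measurable_cosetMeasure Γ)) hsm]
  refine lintegral_congr fun q => ?_
  induction q using QuotientGroup.induction_on with
  | H g =>
    have : h • (g : G ⧸ Γ) = ((h * g : G) : G ⧸ Γ) := rfl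
    rw [this, cosetMeasure_apply Γ _ hs, cosetMeasure_apply Γ _ hs']
    refine tsum_congr fun γ' => ?_
    refine (Set.indicator_comp_right (s := s) (g := (1 : G → ℝ≥0∞)) (h * ·)).trans ?_
    simp [mul_assoc]

/-- If a coset meets K in a point k, its points in K have the form kγ with γ ∈ K⁻¹K, so the bound is
the same for all cosets. -/
lemma cosetMeasure_le_ncard {Γ : Subgroup G} [Countable Γ] (hΓ : IsLattice Γ) {K : Set G}
    (hK : IsCompact K) (q : G ⧸ Γ) :
    cosetMeasure Γ q K ≤ ({γ : Γ | (γ : G) ∈ K⁻¹ * K}.ncard : ℝ≥0∞) := by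
  have hKm : MeasurableSet K := hK.isClosed.measurableSet
  have hfin : {γ : Γ | (γ : G) ∈ K⁻¹ * K}.Finite :=
    hΓ.finite_inter ((hK.inv.mul hK).closure)
  induction q using QuotientGroup.induction_on with
  | H g =>
    by_cases hg : ∃ γ₀ : Γ, g * (γ₀ : G) ∈ K
    · obtain ⟨γ₀, hγ₀⟩ := hg
      have hmk : ((g * (γ₀ : G) : G) : G ⧸ Γ) = g := by
        rw [QuotientGroup.eq]; simp
      rw [← hmk, cosetMeasure_apply Γ _ hKm]
      have hsub : ∀ γ : Γ, K.indicator (1 : G → ℝ≥0∞) (g * (γ₀ : G) * (γ : G)) ≤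
          ({γ : Γ | (γ : G) ∈ K⁻¹ * K}).indicator 1 γ := by
        intro γ
        by_cases h : g * (γ₀ : G) * (γ : G) ∈ K
        · have : γ ∈ {γ : Γ | (γ : G) ∈ K⁻¹ * K} :=
            ⟨(g * (γ₀ : G))⁻¹, Set.inv_mem_inv.2 hγ₀, _, h, by simp [mul_assoc]⟩
          rw [Set.indicator_of_mem h, Set.indicator_of_mem this]
          rfl
        · simp [Set.indicator_of_notMem h]
      refine (ENNReal.tsum_le_tsum hsub).trans ?_
      rw [← tsum_subtype, Set.ncard_eq_toFinset_card _ hfin]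
      simp only [Pi.one_apply]
      rw [ENNReal.tsum_one, ENat.card_coe_set_eq, hfin.encard_eq_coe_toFinset_card]
      simp
    · push Not at hg
      rw [cosetMeasure_apply Γ _ hKm]
      simp [Set.indicator_of_notMem (hg _)]

variable [LocallyCompactSpace G] [SecondCountableTopology G]

/-- Integrating the counting measures of the cosets against η produces a nonzero left Haar measure
that is right Γ-invariant by construction. Uniqueness of Haar measure transports this invariance to
m. -/
lemma IsLattice.map_mul_right_eq {Γ : Subgroup G} (hΓ : IsLattice Γ) (m : Measure G)
    [m.IsHaarMeasure] (γ : Γ) : m.map (· * (γ : G)) = m := by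
  have := hΓ.countable
  obtain ⟨η, hfin, hne, hinv⟩ := hΓ.finite_covolume
  set m' : Measure G := η.bind (cosetMeasure Γ) with hm'
  have : m'.IsMulLeftInvariant := ⟨fun h => by
    ext s hs
    rw [Measure.map_apply (measurable_const_mul h) hs]
    exact bind_cosetMeasure_preimage_mul_left Γ η h hs⟩
  have : IsFiniteMeasureOnCompacts m' := ⟨fun K hK => by
    rw [hm', Measure.bind_apply hK.isClosed.measurableSet
      (measurable_cosetMeasure Γ).aemeasurable]
    refine (lintegral_mono (cosetMeasure_le_ncard hΓ hK)).trans_lt ?_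
    rw [lintegral_const]
    exact ENNReal.mul_lt_top (by simp) (measure_lt_top _ _)⟩
  have key := Measure.isMulLeftInvariant_eq_smul m' m
  set c := Measure.haarScalarFactor m' m
  have hc : c ≠ 0 := by
    intro h0
    rw [h0, zero_smul] at key
    have h1 : m' univ = 0 := by rw [key]; simp
    rw [hm', Measure.bind_apply MeasurableSet.univ (measurable_cosetMeasure Γ).aemeasurable,
      lintegral_eq_zero_iff (f := fun q => cosetMeasure Γ q univ) ((Measure.measurable_coe MeasurableSet.univ).comp
        (measurable_cosetMeasure Γ))] at h1
    have h2 : ∀ q : G ⧸ Γ, cosetMeasure Γ q univ ≠ 0 := by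
      intro q
      induction q using QuotientGroup.induction_on with
      | H g =>
        rw [cosetMeasure_apply Γ _ MeasurableSet.univ]
        intro h
        rw [ENNReal.tsum_eq_zero] at h
        simpa using h 1
    have h3 : ∀ᵐ q ∂η, False := h1.mono fun q hq => h2 q hq
    apply hne
    simpa using h3
  ext s hs
  have hs' : MeasurableSet ((· * (γ : G)) ⁻¹' s) := (continuous_mul_const _).measurable hs
  rw [Measure.map_apply (measurable_mul_const _) hs]
  have h4 := bind_cosetMeasure_preimage_mul_right Γ η γ hs
  rw [← hm', key] at h4
  simp only [Measure.smul_apply, ENNReal.smul_def, smul_eq_mul] at h4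
  exact (ENNReal.mul_right_inj (by simpa using hc) (by simp)).1 h4

/-- A group containing a lattice is unimodular. -/
theorem IsLattice.isMulRightInvariant {Γ : Subgroup G} (hΓ : IsLattice Γ) (m : Measure G)
    [m.IsHaarMeasure] : m.IsMulRightInvariant := by
  have := hΓ.countable
  obtain ⟨η, hfin, hne, hinv⟩ := hΓ.finite_covolume
  -- The modular function Δ is trivial on Γ, so it descends to D on G ⧸ Γ with D(hq) = Δ(h) D(q). If
  -- Δ(h) > 1, translation by h would strictly increase the bounded function D / (1 + D) everywhere,
  -- against the invariance of the finite nonzero measure η. Applying this to g⁻¹ as well gives Δ =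
  -- 1.
  set Δ : G → NNReal := fun g => Measure.modularCharacterFun g with hΔ
  have hΔmap : ∀ g, m.map (· * g) = Δ g • m :=
    fun g => Measure.map_right_mul_eq_modularCharacterFun_smul m g
  obtain ⟨K, hK, hK1⟩ := exists_compact_mem_nhds (1 : G)
  have hK0 : m K ≠ 0 := (Measure.measure_pos_of_mem_nhds m hK1).ne'
  have hKt : m K ≠ ∞ := hK.measure_lt_top.ne
  have hKm : MeasurableSet K := hK.isClosed.measurableSet
  have hΔeq : ∀ g, m ((· * g) ⁻¹' K) = Δ g * m K := fun g => by
    rw [← Measure.map_apply (measurable_mul_const g) hKm, hΔmap g]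
    rw [Measure.smul_apply, ENNReal.smul_def, smul_eq_mul]
  -- Measurability comes from Fubini applied to g ↦ m(K g⁻¹), a positive multiple of Δ.
  have hΔmeas : Measurable Δ := by
    have h1 : Measurable fun g => m ((· * g) ⁻¹' K) := by
      have : MeasurableSet {z : G × G | z.2 * z.1 ∈ K} :=
        (measurable_snd.mul measurable_fst) hKm
      exact measurable_measure_prodMk_left this
    have h2 : Δ = fun g => (m ((· * g) ⁻¹' K) / m K).toNNReal := by
      funext g
      rw [hΔeq g, ENNReal.mul_div_cancel_right hK0 hKt]
      simp
    rw [h2]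
    exact (h1.div_const _).ennreal_toNNReal
  have hΔΓ : ∀ γ : Γ, Δ (γ : G) = 1 := fun γ => by
    have h1 := hΔeq γ
    rw [← Measure.map_apply (measurable_mul_const _) hKm, hΓ.map_mul_right_eq m γ] at h1
    have h2 : (1 : ℝ≥0∞) * m K = Δ γ * m K := by rw [one_mul]; exact h1
    have := (ENNReal.mul_left_inj hK0 hKt).1 h2
    exact_mod_cast this.symm
  have hΔmul : ∀ g h, Δ (g * h) = Δ g * Δ h := Measure.modularCharacterFun_map_mul
  have hΔpos : ∀ g, 0 < Δ g := Measure.modularCharacterFun_pos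
  set D : G ⧸ Γ → ℝ := fun q => (Δ q.out : ℝ) with hD
  have hDmk : ∀ g : G, D (g : G ⧸ Γ) = Δ g := fun g => by
    obtain ⟨γ₀, hγ₀⟩ := QuotientGroup.mk_out_eq_mul Γ g
    simp only [hD]
    rw [hγ₀, hΔmul, hΔΓ, mul_one]
  have hDpos : ∀ q, 0 < D q := fun q => by exact_mod_cast hΔpos _
  have hDmeas : Measurable D := by
    refine measurable_from_quotient.2 ?_
    have : (D ∘ Quotient.mk'') = fun g : G => (Δ g : ℝ) := funext hDmk
    rw [this]
    exact hΔmeas.coe_nnreal_real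
  have hDsmul : ∀ (h : G) q, D (h • q) = Δ h * D q := by
    intro h q
    induction q using QuotientGroup.induction_on with
    | H g =>
      have : h • (g : G ⧸ Γ) = ((h * g : G) : G ⧸ Γ) := rfl
      rw [this, hDmk, hDmk, hΔmul]
      push_cast
      rfl
  have hle : ∀ h, Δ h ≤ 1 := by
    intro h
    by_contra! hh
    have hh' : (1 : ℝ) < Δ h := by exact_mod_cast hh
    have hsm : Measurable fun q : G ⧸ Γ => h • q := by
      refine measurable_from_quotient.2 ?_
      exact QuotientGroup.measurable_coe.comp (measurable_const_mul h)
    set φ : G ⧸ Γ → ℝ := fun q => D q / (1 + D q) with hφ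
    have hφmeas : Measurable φ := hDmeas.div (hDmeas.const_add 1)
    have hφint : ∀ f : G ⧸ Γ → G ⧸ Γ, Measurable f → Integrable (fun q => φ (f q)) η := by
      intro f hf
      refine Integrable.of_bound (hφmeas.comp hf).aestronglyMeasurable 1 ?_
      refine ae_of_all _ fun q => ?_
      have := hDpos (f q)
      rw [Real.norm_of_nonneg (by positivity), div_le_one (by linarith)]
      linarith
    have hmp : MeasurePreserving (fun q : G ⧸ Γ => h • q) η η := ⟨hsm, by
      ext t ht
      rw [Measure.map_apply hsm ht]
      exact SMulInvariantMeasure.measure_preimage_smul h ht⟩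
    have heq : ∫ q, φ (h • q) ∂η = ∫ q, φ q ∂η := by
      conv_rhs => rw [← hmp.map_eq]
      rw [integral_map hsm.aemeasurable (hφmeas.aestronglyMeasurable)]
    have hlt : ∀ q, 0 < φ (h • q) - φ q := by
      intro q
      simp only [hφ, hDsmul]
      have := hDpos q
      rw [sub_pos, div_lt_div_iff₀ (by linarith) (by nlinarith)]
      nlinarith
    have hzero : ∫ q, (φ (h • q) - φ q) ∂η = 0 := by
      rw [integral_sub (hφint _ hsm) (hφint (fun q => q) measurable_id)]
      exact sub_eq_zero.2 heq
    rw [integral_eq_zero_iff_of_nonneg (fun q => (hlt q).le)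
      ((hφint _ hsm).sub (hφint _ measurable_id))] at hzero
    apply hne
    have h3 : ∀ᵐ q ∂η, False := hzero.mono fun q hq => (hlt q).ne' hq
    simpa using h3
  refine ⟨fun g => ?_⟩
  have h1 : Δ g = 1 := by
    refine le_antisymm (hle g) ?_
    have h2 : Δ g * Δ g⁻¹ = 1 := by
      rw [← hΔmul, mul_inv_cancel]; exact Measure.modularCharacterFun_map_one
    calc 1 = Δ g * Δ g⁻¹ := h2.symm
      _ ≤ Δ g * 1 := by gcongr; exact hle _
      _ = Δ g := mul_one _
  rw [hΔmap g, h1, one_smul]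

end Unimodular

/-! ### Periodization and norms on the induced space -/

section InducedSpace

variable {G : Type*} [Group G] {Γ : Subgroup G} {X : Type*} [MulAction Γ X]

lemma inducedMk_surjective : Function.Surjective (inducedMk Γ X) := Quotient.mk_surjective

lemma smul_inducedMk (g h : G) (x : X) :
    g • inducedMk Γ X (h, x) = inducedMk Γ X (g * h, x) := rfl

/-- The translates of `U` by distinct elements of `Γ` on the right are disjoint. -/
def InjectsModulo (Γ : Subgroup G) (U : Set G) : Prop :=
  ∀ g ∈ U, ∀ γ : Γ, g * (γ : G) ∈ U → γ = 1

lemma InjectsModulo.mono {U V : Set G} (hV : InjectsModulo Γ V) (h : U ⊆ V) :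
    InjectsModulo Γ U := fun g hg γ hγ => hV g (h hg) γ (h hγ)

/-- Γ acts on the right, so left translation is harmless; this allows U to be cut out of any
translate of a small neighbourhood. -/
lemma InjectsModulo.const_mul {V : Set G} (hV : InjectsModulo Γ V) (k : G) :
    InjectsModulo Γ (k • V) := by
  rintro _ ⟨g, hg, rfl⟩ γ hγ
  have h : k • (g * (γ : G)) ∈ k • V := by simpa [mul_assoc] using hγ
  exact hV g hg γ (Set.smul_mem_smul_set_iff.1 h)

/-- The function on the induced space obtained by summing `1_U ⊗ v` over the orbits of `Γ`. -/
def periodize (Γ : Subgroup G) {X : Type*} [MulAction Γ X] (U : Set G) (v : X → ℝ≥0∞) :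
    InducedSpace Γ X → ℝ≥0∞ :=
  Quotient.lift (fun a : G × X => ∑' γ : Γ, U.indicator 1 (a.1 * (γ : G)) * v (γ⁻¹ • a.2)) (by
    rintro a b ⟨δ, rfl⟩
    refine ((Equiv.mulLeft δ).tsum_eq _).symm.trans (tsum_congr fun γ => ?_)
    simp [mul_assoc, mul_smul])

lemma periodize_mk (U : Set G) (v : X → ℝ≥0∞) (g : G) (x : X) :
    periodize Γ U v (inducedMk Γ X (g, x)) =
      ∑' γ : Γ, U.indicator 1 (g * (γ : G)) * v (γ⁻¹ • x) := rfl

lemma periodize_mk_of_mem {U : Set G} (hU : InjectsModulo Γ U) (v : X → ℝ≥0∞) {g : G}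
    (hg : g ∈ U) (x : X) : periodize Γ U v (inducedMk Γ X (g, x)) = v x := by
  rw [periodize_mk, tsum_eq_single 1]
  · simp [hg]
  · intro γ hγ
    rw [Set.indicator_of_notMem fun h => hγ (hU g hg γ h), zero_mul]

lemma inducedMk_mul_smul (g : G) (x : X) (γ : Γ) :
    inducedMk Γ X (g * (γ : G), γ⁻¹ • x) = inducedMk Γ X (g, x) :=
  (Quotient.sound ⟨γ, rfl⟩ : Quotient.mk (inducedSetoid Γ X) (g, x) = _).symm

/-- A periodization either vanishes or is computed by a representative in `U × X`. -/
lemma periodize_cases {U : Set G} (hU : InjectsModulo Γ U) (y : InducedSpace Γ X) :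
    (∀ v : X → ℝ≥0∞, periodize Γ U v y = 0) ∨
      ∃ g ∈ U, ∃ x : X, y = inducedMk Γ X (g, x) ∧
        ∀ v : X → ℝ≥0∞, periodize Γ U v y = v x := by
  obtain ⟨⟨g, x⟩, rfl⟩ := inducedMk_surjective y
  by_cases h : ∃ γ : Γ, g * (γ : G) ∈ U
  · obtain ⟨γ, hγ⟩ := h
    refine Or.inr ⟨_, hγ, γ⁻¹ • x, (inducedMk_mul_smul g x γ).symm, fun v => ?_⟩
    rw [← inducedMk_mul_smul g x γ, periodize_mk_of_mem hU v hγ]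
  · push Not at h
    refine Or.inl fun v => ?_
    rw [periodize_mk, ENNReal.tsum_eq_zero]
    intro γ
    rw [Set.indicator_of_notMem (h γ), zero_mul]

/-- The periodization is supported on the image of U × X and has a single nonzero term there, so a
bound at representatives in U × X suffices. -/
lemma periodize_le {U : Set G} (hU : InjectsModulo Γ U) {v : X → ℝ≥0∞}
    {W : InducedSpace Γ X → ℝ≥0∞} (h : ∀ g ∈ U, ∀ x, v x ≤ W (inducedMk Γ X (g, x))) :
    periodize Γ U v ≤ W := by
  intro y
  obtain h0 | ⟨g, hg, x, rfl, hx⟩ := periodize_cases hU y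
  · rw [h0]; exact zero_le
  · rw [hx]; exact h g hg x

variable [MeasurableSpace G] [MeasurableSpace X]

lemma measurable_inducedMk : Measurable (inducedMk Γ X) := fun _ h => h

lemma measurable_of_comp_inducedMk {Z : Type*} [MeasurableSpace Z] {f : InducedSpace Γ X → Z}
    (h : Measurable fun a : G × X => f (inducedMk Γ X a)) : Measurable f := fun _ hs => h hs

variable [MeasurableMul G] [MeasurableConstSMul Γ X] [Countable Γ]

lemma measurable_periodize {U : Set G} (hU : MeasurableSet U) {v : X → ℝ≥0∞}
    (hv : Measurable v) : Measurable (periodize Γ U v) := by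
  refine measurable_of_comp_inducedMk ?_
  refine Measurable.tsum fun γ => Measurable.mul ?_ ?_
  · exact (measurable_one.indicator hU).comp ((measurable_mul_const (γ : G)).comp measurable_fst)
  · exact hv.comp ((measurable_const_smul γ⁻¹).comp measurable_snd)

variable {m : Measure G}

/-- The real-valued function on the induced space attached to `φ ≥ 0`: the periodization of
`(1_U / m(U)) ⊗ φ`. -/
def inducedFun (Γ : Subgroup G) {X : Type*} [MulAction Γ X] (m : Measure G) (U : Set G)
    (φ : X → ℝ) (y : InducedSpace Γ X) : ℝ :=
  (m U).toReal⁻¹ * (periodize Γ U (fun x => ENNReal.ofReal (φ x)) y).toReal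

lemma inducedFun_nonneg (U : Set G) (φ : X → ℝ) (y : InducedSpace Γ X) :
    0 ≤ inducedFun Γ m U φ y := by unfold inducedFun; positivity

lemma periodize_ofReal_ne_top {U : Set G} (hU : InjectsModulo Γ U) (φ : X → ℝ)
    (y : InducedSpace Γ X) : periodize Γ U (fun x => ENNReal.ofReal (φ x)) y ≠ ∞ := by
  obtain h0 | ⟨g, hg, x, rfl, hx⟩ := periodize_cases hU y
  · simp [h0]
  · simp [hx]

lemma ofReal_inducedFun {U : Set G} (hU : InjectsModulo Γ U) (hU0 : m U ≠ 0) (hUt : m U ≠ ∞)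
    (φ : X → ℝ) (y : InducedSpace Γ X) : ENNReal.ofReal (inducedFun Γ m U φ y) =
      (m U)⁻¹ * periodize Γ U (fun x => ENNReal.ofReal (φ x)) y := by
  have : 0 < (m U).toReal := ENNReal.toReal_pos hU0 hUt
  rw [inducedFun, ENNReal.ofReal_mul (by positivity), ENNReal.ofReal_inv_of_pos this,
    ENNReal.ofReal_toReal hUt, ENNReal.ofReal_toReal (periodize_ofReal_ne_top hU φ y)]

lemma measurable_inducedFun {U : Set G} (hUm : MeasurableSet U) {φ : X → ℝ}
    (hφ : Measurable φ) : Measurable (inducedFun Γ m U φ) :=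
  ((measurable_periodize hUm hφ.ennreal_ofReal).ennreal_toReal).const_mul _

/-- The measure `m ⊗ μ` unfolds along the orbits of `Γ`. -/
lemma lintegral_prod_eq_tsum [SFinite m] [m.IsMulRightInvariant] {F : Set G}
    (hF : IsFundamentalDomain Γ.op F m) (μ : Measure X) [SFinite μ] [SMulInvariantMeasure Γ X μ]
    {k : G × X → ℝ≥0∞} (hk : Measurable k) :
    ∫⁻ a, k a ∂(m.prod μ) =
      ∫⁻ a, ∑' γ : Γ, k (a.1 * (γ : G), γ⁻¹ • a.2) ∂((m.restrict F).prod μ) := by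
  have hkγ : ∀ γ : Γ, Measurable fun a : G × X => k (a.1 * (γ : G), γ⁻¹ • a.2) := fun γ =>
    hk.comp (((measurable_mul_const (γ : G)).comp measurable_fst).prodMk
      ((measurable_const_smul γ⁻¹).comp measurable_snd))
  have : Countable Γ.op := (Subgroup.equivOp Γ).symm.injective.countable
  rw [lintegral_tsum fun γ => (hkγ γ).aemeasurable, lintegral_prod _ hk.aemeasurable,
    hF.lintegral_eq_tsum'', ← (Subgroup.equivOp Γ).tsum_eq]
  refine tsum_congr fun γ => ?_
  rw [lintegral_prod _ (hkγ γ).aemeasurable]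
  refine lintegral_congr fun g => ?_
  exact ((measurePreserving_smul γ⁻¹ μ).lintegral_comp
    (f := fun x => k (g * (γ : G), x)) (hk.comp measurable_prodMk_left)).symm

variable [SFinite m] [m.IsMulRightInvariant] {F : Set G}
  {μ : Measure X} [IsProbabilityMeasure μ] [SMulInvariantMeasure Γ X μ]

/-- The projection identifies `m|_U ⊗ μ` with the restriction of the induced measure. -/
lemma restrict_inducedMeasure (hF : IsFundamentalDomain Γ.op F m) {U : Set G}
    (hUm : MeasurableSet U) (hU : InjectsModulo Γ U) :
    (inducedMeasure Γ X m F μ).restrict {y | periodize Γ U (1 : X → ℝ≥0∞) y ≠ 0} =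
      ((m.restrict U).prod μ).map (inducedMk Γ X) := by
  have hone : Measurable (1 : X → ℝ≥0∞) := measurable_one
  have hEm : MeasurableSet {y | periodize Γ U (1 : X → ℝ≥0∞) y ≠ 0} :=
    (measurable_periodize hUm hone (measurableSet_singleton 0)).compl
  ext S hS
  rw [Measure.restrict_apply hS, inducedMeasure,
    Measure.map_apply measurable_inducedMk (hS.inter hEm),
    Measure.map_apply measurable_inducedMk hS,
    ← lintegral_indicator_one (measurable_inducedMk (hS.inter hEm)),
    ← lintegral_indicator_one (measurable_inducedMk hS)]
  have h1 : (m.restrict U).prod μ = (m.prod μ).restrict (U ×ˢ univ) := by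
    rw [← Measure.prod_restrict, Measure.restrict_univ]
  have hUu : MeasurableSet (U ×ˢ (univ : Set X)) := hUm.prod MeasurableSet.univ
  -- Unfolding over F turns the integrand into the indicator of S times the periodization of the
  -- constant 1, which takes only the values 0 and 1.
  rw [h1, ← lintegral_indicator hUu, lintegral_prod_eq_tsum hF μ
    ((measurable_one.indicator (measurable_inducedMk hS)).indicator hUu)]
  refine lintegral_congr fun a => ?_
  obtain ⟨g, x⟩ := a
  by_cases hSa : inducedMk Γ X (g, x) ∈ S
  · have h2 : ∀ γ : Γ, (U ×ˢ (univ : Set X)).indicator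
        ((inducedMk Γ X ⁻¹' S).indicator (1 : G × X → ℝ≥0∞)) (g * (γ : G), γ⁻¹ • x) =
        U.indicator 1 (g * (γ : G)) * (1 : X → ℝ≥0∞) (γ⁻¹ • x) := by
      intro γ
      by_cases hγ : g * (γ : G) ∈ U
      · have : (g * (γ : G), γ⁻¹ • x) ∈ inducedMk Γ X ⁻¹' S := by
          rw [mem_preimage, inducedMk_mul_smul]; exact hSa
        simp [hγ, Set.indicator_of_mem this]
      · simp [hγ]
    simp only [h2]
    rw [← periodize_mk]
    obtain h0 | ⟨g', hg', x', hy, hx⟩ := periodize_cases hU (inducedMk Γ X (g, x))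
    · simp [h0, Set.indicator]
    · rw [hx, Set.indicator_of_mem]
      · rfl
      · exact ⟨hSa, by simp [hx]⟩
  · have h2 : ∀ γ : Γ, (U ×ˢ (univ : Set X)).indicator
        ((inducedMk Γ X ⁻¹' S).indicator (1 : G × X → ℝ≥0∞)) (g * (γ : G), γ⁻¹ • x) = 0 := by
      intro γ
      have : (g * (γ : G), γ⁻¹ • x) ∉ inducedMk Γ X ⁻¹' S := by
        rw [mem_preimage, inducedMk_mul_smul]; exact hSa
      exact Set.indicator_apply_eq_zero.2 fun _ => Set.indicator_of_notMem this _
    simp only [h2, tsum_zero]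
    rw [Set.indicator_of_notMem fun h => hSa h.1]

lemma map_inducedMk_le (hF : IsFundamentalDomain Γ.op F m) {U : Set G}
    (hUm : MeasurableSet U) (hU : InjectsModulo Γ U) :
    ((m.restrict U).prod μ).map (inducedMk Γ X) ≤ inducedMeasure Γ X m F μ := by
  rw [← restrict_inducedMeasure hF hUm hU]
  exact Measure.restrict_le_self

/-- On the image of U × X the periodization equals v(x), and there ν is the image of m|_U ⊗ μ, whose
second marginal is m(U) μ. For p = ∞ the exponent `(1 / p).toReal` is 0. -/
lemma eLpNorm_periodize (hF : IsFundamentalDomain Γ.op F m) {U : Set G}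
    (hUm : MeasurableSet U) (hU : InjectsModulo Γ U) (hU0 : m U ≠ 0) {v : X → ℝ≥0∞}
    (hv : Measurable v) (p : ℝ≥0∞) :
    eLpNorm (periodize Γ U v) p (inducedMeasure Γ X m F μ) =
      m U ^ (1 / p).toReal * eLpNorm v p μ := by
  have hone : Measurable (1 : X → ℝ≥0∞) := measurable_one
  have hEm : MeasurableSet {y | periodize Γ U (1 : X → ℝ≥0∞) y ≠ 0} :=
    (measurable_periodize hUm hone (measurableSet_singleton 0)).compl
  have hind : periodize Γ U v =
      {y | periodize Γ U (1 : X → ℝ≥0∞) y ≠ 0}.indicator (periodize Γ U v) := by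
    funext y
    obtain h0 | ⟨g, hg, x, rfl, hx⟩ := periodize_cases hU y
    · simp [h0]
    · rw [Set.indicator_of_mem]
      simp [hx]
  have hvm := measurable_periodize hUm hv (Γ := Γ)
  rw [hind, eLpNorm_indicator_eq_eLpNorm_restrict hEm, restrict_inducedMeasure hF hUm hU,
    eLpNorm_map_measure hvm.aestronglyMeasurable measurable_inducedMk.aemeasurable]
  have h1 : eLpNorm (periodize Γ U v ∘ inducedMk Γ X) p ((m.restrict U).prod μ) =
      eLpNorm (v ∘ Prod.snd) p ((m.restrict U).prod μ) := by
    refine eLpNorm_congr_ae ?_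
    have h2 : ∀ᵐ a ∂((m.restrict U).prod μ), a.1 ∈ U := by
      have : ∀ᵐ g ∂(m.restrict U), g ∈ U := ae_restrict_mem hUm
      exact Measure.quasiMeasurePreserving_fst.ae this
    filter_upwards [h2] with a ha
    exact periodize_mk_of_mem hU v ha a.2
  rw [h1, ← eLpNorm_map_measure hv.aestronglyMeasurable measurable_snd.aemeasurable]
  have h3 : ((m.restrict U).prod μ).map Prod.snd = m U • μ := by
    simp [Measure.map_snd_prod]
  rw [h3, eLpNorm_smul_measure_of_ne_zero hU0]
  rfl

/-- Transfer of norm inequalities from the induced space. -/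
lemma mul_eLpNorm_le_of_le (hF : IsFundamentalDomain Γ.op F m) {U : Set G}
    (hUm : MeasurableSet U) (hU : InjectsModulo Γ U) (hU0 : m U ≠ 0) {v : X → ℝ≥0∞}
    (hv : Measurable v) {W : InducedSpace Γ X → ℝ≥0∞}
    (h : ∀ g ∈ U, ∀ x, v x ≤ W (inducedMk Γ X (g, x))) (p : ℝ≥0∞) :
    m U ^ (1 / p).toReal * eLpNorm v p μ ≤ eLpNorm W p (inducedMeasure Γ X m F μ) := by
  rw [← eLpNorm_periodize hF hUm hU hU0 hv p]
  -- Only monotonicity is used for W, which therefore need not be measurable; it will be a supremum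
  -- over a continuum of times.
  exact eLpNorm_mono_enorm fun y => periodize_le hU h y

lemma lintegral_periodize (hF : IsFundamentalDomain Γ.op F m) {U : Set G}
    (hUm : MeasurableSet U) (hU : InjectsModulo Γ U) (hU0 : m U ≠ 0) {v : X → ℝ≥0∞}
    (hv : Measurable v) :
    ∫⁻ y, periodize Γ U v y ∂(inducedMeasure Γ X m F μ) = m U * ∫⁻ x, v x ∂μ := by
  have := eLpNorm_periodize (μ := μ) hF hUm hU hU0 hv 1
  simpa [eLpNorm_one_eq_lintegral_enorm] using this

lemma eLpNorm_inducedFun (hF : IsFundamentalDomain Γ.op F m) {U : Set G}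
    (hUm : MeasurableSet U) (hU : InjectsModulo Γ U) (hU0 : m U ≠ 0) (hUt : m U ≠ ∞)
    {φ : X → ℝ} (hφ : Measurable φ) (hφ0 : 0 ≤ φ) (p : ℝ≥0∞) :
    eLpNorm (inducedFun Γ m U φ) p (inducedMeasure Γ X m F μ) =
      (m U)⁻¹ * (m U ^ (1 / p).toReal * eLpNorm φ p μ) := by
  have h1 : eLpNorm φ p μ = eLpNorm (fun x => ENNReal.ofReal (φ x)) p μ := by
    refine eLpNorm_congr_enorm_ae (ae_of_all _ fun x => ?_)
    rw [Real.enorm_of_nonneg (hφ0 x)]; rfl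
  rw [h1, ← eLpNorm_periodize hF hUm hU hU0 hφ.ennreal_ofReal p]
  have h2 : inducedFun Γ m U φ = (m U).toReal⁻¹ •
      fun y => (periodize Γ U (fun x => ENNReal.ofReal (φ x)) y).toReal := rfl
  have hpos : 0 < (m U).toReal := ENNReal.toReal_pos hU0 hUt
  rw [h2, eLpNorm_const_smul, Real.enorm_of_nonneg (by positivity),
    ENNReal.ofReal_inv_of_pos hpos, ENNReal.ofReal_toReal hUt]
  congr 1
  refine eLpNorm_congr_enorm_ae (ae_of_all _ fun y => ?_)
  rw [Real.enorm_of_nonneg ENNReal.toReal_nonneg,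
    ENNReal.ofReal_toReal (periodize_ofReal_ne_top hU φ y)]
  rfl

lemma memLp_inducedFun (hF : IsFundamentalDomain Γ.op F m) {U : Set G}
    (hUm : MeasurableSet U) (hU : InjectsModulo Γ U) (hU0 : m U ≠ 0) (hUt : m U ≠ ∞)
    {φ : X → ℝ} (hφ : Measurable φ) (hφ0 : 0 ≤ φ) {p : ℝ≥0∞} (hφp : MemLp φ p μ) :
    MemLp (inducedFun Γ m U φ) p (inducedMeasure Γ X m F μ) := by
  refine ⟨(measurable_inducedFun hUm hφ).aestronglyMeasurable, ?_⟩
  rw [eLpNorm_inducedFun hF hUm hU hU0 hUt hφ hφ0]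
  refine ENNReal.mul_lt_top (by simpa using hU0.bot_lt) (ENNReal.mul_lt_top ?_ hφp.2)
  exact ENNReal.rpow_lt_top_of_nonneg ENNReal.toReal_nonneg hUt

lemma integral_inducedFun (hF : IsFundamentalDomain Γ.op F m) {U : Set G}
    (hUm : MeasurableSet U) (hU : InjectsModulo Γ U) (hU0 : m U ≠ 0) (hUt : m U ≠ ∞)
    {φ : X → ℝ} (hφ : Measurable φ) (hφ0 : 0 ≤ φ) :
    ∫ y, inducedFun Γ m U φ y ∂(inducedMeasure Γ X m F μ) = ∫ x, φ x ∂μ := by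
  rw [integral_eq_lintegral_of_nonneg_ae (ae_of_all _ (inducedFun_nonneg U φ))
      (measurable_inducedFun hUm hφ).aestronglyMeasurable,
    integral_eq_lintegral_of_nonneg_ae (ae_of_all _ hφ0) hφ.aestronglyMeasurable]
  simp only [ofReal_inducedFun hU hU0 hUt]
  rw [lintegral_const_mul _ (measurable_periodize hUm hφ.ennreal_ofReal),
    lintegral_periodize hF hUm hU hU0 hφ.ennreal_ofReal, ← mul_assoc,
    ENNReal.inv_mul_cancel hU0 hUt, one_mul]

end InducedSpace

/-! ### Averages over finite sets -/

section FiniteAverages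

variable {Λ Z : Type*} [Group Λ] [MeasurableSpace Λ] [MeasurableSingletonClass Λ]
  [MulAction Λ Z]

lemma actionAverage_uniformOn {S : Set Λ} (hS : S.Finite) (f : Z → ℝ) (z : Z) :
    actionAverage (uniformOn S) f z = (S.ncard : ℝ)⁻¹ * ∑ γ ∈ hS.toFinset, f (γ⁻¹ • z) := by
  have hint : IntegrableOn (fun γ : Λ => f (γ⁻¹ • z)) hS.toFinset Measure.count := by
    rw [← Set.biUnion_of_singleton (hS.toFinset : Set Λ)]
    rw [show (⋃ x ∈ (hS.toFinset : Set Λ), {x}) = ⋃ x ∈ hS.toFinset, ({x} : Set Λ) by simp,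
      integrableOn_finset_iUnion]
    simp
  rw [actionAverage, uniformOn, ProbabilityTheory.cond, integral_smul_measure]
  conv_lhs => rw [← hS.coe_toFinset]
  rw [setIntegral_finset _ hint]
  simp [Measure.count_apply_finite _ hS, Set.ncard_eq_toFinset_card _ hS]

/-- Multiplied by the cardinality, the formula survives for the empty set, where the average is 0
and the sum is empty. -/
lemma ncard_mul_actionAverage_uniformOn {S : Set Λ} (hS : S.Finite) (f : Z → ℝ) (z : Z) :
    (S.ncard : ℝ) * actionAverage (uniformOn S) f z = ∑ γ ∈ hS.toFinset, f (γ⁻¹ • z) := by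
  rw [actionAverage_uniformOn hS]
  by_cases h : (S.ncard : ℝ) = 0
  · have h1 : S = ∅ := (Set.ncard_eq_zero hS).1 (by exact_mod_cast h)
    subst h1
    simp
  · rw [mul_inv_cancel_left₀ h]

end FiniteAverages

/-! ### Invariance of Haar measure under inversion -/

section Inversion

variable {G : Type*} [Group G] [TopologicalSpace G] [IsTopologicalGroup G] [T2Space G]
  [LocallyCompactSpace G] [SecondCountableTopology G] [MeasurableSpace G] [BorelSpace G]

/-- A bi-invariant Haar measure is invariant under inversion. -/
lemma isInvInvariant_of_isMulRightInvariant (m : Measure G) [m.IsHaarMeasure]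
    [m.IsMulRightInvariant] : m.IsInvInvariant := by
  obtain ⟨K₀, hK₀, hK₁⟩ := exists_compact_mem_nhds (1 : G)
  -- The inverse of m is left invariant, hence a multiple of m; a symmetric compact set of positive
  -- measure shows that the factor is 1.
  set K := K₀ ∪ K₀⁻¹ with hKdef
  have hK : IsCompact K := hK₀.union hK₀.inv
  have hKinv : K⁻¹ = K := by rw [hKdef, Set.union_inv, inv_inv, Set.union_comm]
  have hK0 : m K ≠ 0 :=
    (Measure.measure_pos_of_mem_nhds m (mem_of_superset hK₁ subset_union_left)).ne'
  have : IsFiniteMeasureOnCompacts m.inv := ⟨fun C hC => by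
    rw [Measure.inv_apply]; exact hC.inv.measure_lt_top⟩
  have key := Measure.isMulLeftInvariant_eq_smul m.inv m
  set c := Measure.haarScalarFactor m.inv m
  have h1 : (c : ℝ≥0∞) * m K = 1 * m K := by
    have h2 : m.inv K = m K := by rw [Measure.inv_apply, hKinv]
    rw [key, Measure.smul_apply, ENNReal.smul_def, smul_eq_mul] at h2
    rw [h2, one_mul]
  have hc : c = 1 := by
    have := (ENNReal.mul_left_inj hK0 hK.measure_lt_top.ne).1 h1
    exact_mod_cast this
  refine ⟨?_⟩
  rw [key, hc, one_smul]

end Inversion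

/-! ### Lattice sums between Haar averages of the induced function -/

section Sandwich

variable {G : Type*} [Group G] [TopologicalSpace G] [IsTopologicalGroup G] [T2Space G]
  [LocallyCompactSpace G] [SecondCountableTopology G] [MeasurableSpace G] [BorelSpace G]
  {Γ : Subgroup G} {X : Type*} [MulAction Γ X] [MeasurableSpace X] [MeasurableConstSMul Γ X]
  {m : Measure G} [m.IsHaarMeasure]

lemma measure_setOf_inv_mul_mem [m.IsInvInvariant] {U : Set G} (k : G) :
    m {g | g⁻¹ * k ∈ U} = m U := by
  have h1 : {g | g⁻¹ * k ∈ U} = (k⁻¹ * ·) ⁻¹' U⁻¹ := by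
    ext g; simp [Set.mem_inv]
  rw [h1, measure_preimage_mul, Measure.measure_inv]

/-- The periodization at g⁻¹ · (h, x)Γ is a sum over Γ; integrating it termwise over g ∈ A gives γ
its weight. Multiplying by m(A) keeps the identity valid for null A. -/
lemma toReal_mul_actionAverage_cond [Countable Γ] {A U : Set G}
    (hAt : m A ≠ ∞) (hUm : MeasurableSet U) (hU : InjectsModulo Γ U)
    (hU0 : m U ≠ 0) (hUt : m U ≠ ∞) {φ : X → ℝ} (hφ : Measurable φ) (h : G) (x : X) :
    (m A).toReal * actionAverage (ProbabilityTheory.cond m A) (inducedFun Γ m U φ)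
        (inducedMk Γ X (h, x)) =
      ((m U)⁻¹ * ∑' γ : Γ, m.restrict A {g | g⁻¹ * (h * (γ : G)) ∈ U} *
        ENNReal.ofReal (φ (γ⁻¹ • x))).toReal := by
  have hmeas : Measurable fun g : G => inducedFun Γ m U φ (g⁻¹ • inducedMk Γ X (h, x)) := by
    simp only [smul_inducedMk]
    exact (measurable_inducedFun hUm hφ).comp (measurable_inducedMk.comp
      ((measurable_inv.mul_const h).prodMk measurable_const))
  have hset : ∀ γ : Γ, MeasurableSet {g : G | g⁻¹ * (h * (γ : G)) ∈ U} := fun γ =>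
    (measurable_inv.mul_const _) hUm
  have h1 : ∫ g in A, inducedFun Γ m U φ (g⁻¹ • inducedMk Γ X (h, x)) ∂m =
      ((m U)⁻¹ * ∑' γ : Γ, m.restrict A {g | g⁻¹ * (h * (γ : G)) ∈ U} *
        ENNReal.ofReal (φ (γ⁻¹ • x))).toReal := by
    rw [integral_eq_lintegral_of_nonneg_ae (ae_of_all _ fun g => inducedFun_nonneg U φ _)
      hmeas.aestronglyMeasurable]
    simp only [ofReal_inducedFun hU hU0 hUt, smul_inducedMk, periodize_mk]
    have hind : ∀ γ : Γ, Measurable fun g : G => U.indicator (1 : G → ℝ≥0∞)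
        (g⁻¹ * h * (γ : G)) := fun γ =>
      (measurable_one.indicator hUm).comp ((measurable_inv.mul_const h).mul_const (γ : G))
    have hterm : ∀ γ : Γ, Measurable fun g : G => U.indicator (1 : G → ℝ≥0∞)
        (g⁻¹ * h * (γ : G)) * ENNReal.ofReal (φ (γ⁻¹ • x)) := fun γ => (hind γ).mul_const _
    rw [lintegral_const_mul _ (Measurable.tsum hterm),
      lintegral_tsum fun γ => (hterm γ).aemeasurable]
    congr 3
    funext γ
    rw [lintegral_mul_const _ (hind γ)]
    congr 1
    rw [← lintegral_indicator_one (hset γ)]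
    refine lintegral_congr fun g => ?_
    by_cases hg : g⁻¹ * (h * (γ : G)) ∈ U
    · rw [mul_assoc, Set.indicator_of_mem hg,
        Set.indicator_of_mem (show g ∈ {g | g⁻¹ * (h * (γ : G)) ∈ U} from hg)]
      rfl
    · rw [mul_assoc, Set.indicator_of_notMem hg,
        Set.indicator_of_notMem (show g ∉ {g | g⁻¹ * (h * (γ : G)) ∈ U} from hg)]
  rw [actionAverage, ProbabilityTheory.cond, integral_smul_measure, h1, ENNReal.toReal_inv,
    smul_eq_mul]
  by_cases hA0 : (m A).toReal = 0
  · have hA0' : m A = 0 := by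
      rcases (ENNReal.toReal_eq_zero_iff _).1 hA0 with h | h
      · exact h
      · exact absurd h hAt
    rw [← h1, Measure.restrict_eq_zero.2 hA0']
    simp
  · rw [mul_inv_cancel_left₀ hA0]

/-- Each weight is at most 1, because {g | g⁻¹hγ ∈ U} has measure m(U). It vanishes unless γ = h⁻¹ ·
g · (g⁻¹hγ) for some g ∈ A with g⁻¹hγ ∈ U, and such γ lie in U⁻¹AU. -/
lemma tsum_measure_mul_le [m.IsInvInvariant] {A A' U : Set G}
    (hsub : U⁻¹ * A * U ⊆ A') (hfin : {γ : Γ | (γ : G) ∈ A'}.Finite)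
    (hU0 : m U ≠ 0) (hUt : m U ≠ ∞) {φ : X → ℝ} {h : G} (hh : h ∈ U) (x : X)
    (hφ0 : 0 ≤ φ) (hA : MeasurableSet A) :
    (m U)⁻¹ * ∑' γ : Γ, m.restrict A {g | g⁻¹ * (h * (γ : G)) ∈ U} *
        ENNReal.ofReal (φ (γ⁻¹ • x)) ≤
      ENNReal.ofReal (∑ γ ∈ hfin.toFinset, φ (γ⁻¹ • x)) := by
  rw [ENNReal.ofReal_sum_of_nonneg fun γ _ => hφ0 _, ENNReal.inv_mul_le_iff hU0 hUt,
    Finset.mul_sum, tsum_eq_sum (s := hfin.toFinset)]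
  · refine Finset.sum_le_sum fun γ _ => ?_
    gcongr ?_ * _
    exact (Measure.restrict_apply_le _ _).trans (measure_setOf_inv_mul_mem (m := m) _).le
  · intro γ hγ
    have : {g | g⁻¹ * (h * (γ : G)) ∈ U} ∩ A = ∅ := by
      rw [Set.eq_empty_iff_forall_notMem]
      rintro g ⟨hg, hgA⟩
      apply hγ
      rw [hfin.mem_toFinset]
      refine hsub ⟨h⁻¹ * g, ⟨h⁻¹, Set.inv_mem_inv.2 hh, g, hgA, rfl⟩, _, hg, ?_⟩
      simp [mul_assoc]
    rw [Measure.restrict_apply' hA, this, measure_empty, zero_mul]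

/-- For γ ∈ A', every g with g⁻¹hγ ∈ U lies in hγU⁻¹ ⊆ A, so the weight is exactly 1. -/
lemma le_tsum_measure_mul [m.IsInvInvariant] {A A' U : Set G}
    (hsub : U * A' * U⁻¹ ⊆ A) (hfin : {γ : Γ | (γ : G) ∈ A'}.Finite)
    (hU0 : m U ≠ 0) (hUt : m U ≠ ∞) {φ : X → ℝ} {h : G} (hh : h ∈ U) (x : X)
    (hφ0 : 0 ≤ φ) (hA : MeasurableSet A) :
    ENNReal.ofReal (∑ γ ∈ hfin.toFinset, φ (γ⁻¹ • x)) ≤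
      (m U)⁻¹ * ∑' γ : Γ, m.restrict A {g | g⁻¹ * (h * (γ : G)) ∈ U} *
        ENNReal.ofReal (φ (γ⁻¹ • x)) := by
  rw [ENNReal.ofReal_sum_of_nonneg fun γ _ => hφ0 _, ← ENNReal.tsum_mul_left]
  refine le_trans (Finset.sum_le_sum fun γ hγ => ?_) (ENNReal.sum_le_tsum hfin.toFinset)
  have : {g | g⁻¹ * (h * (γ : G)) ∈ U} ∩ A = {g | g⁻¹ * (h * (γ : G)) ∈ U} := by
    refine Set.inter_eq_left.2 fun g hg => hsub ?_
    refine ⟨h * γ, ⟨h, hh, _, (hfin.mem_toFinset.1 hγ), rfl⟩, (g⁻¹ * (h * (γ : G)))⁻¹,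
      Set.inv_mem_inv.2 hg, ?_⟩
    simp [mul_assoc]
  rw [Measure.restrict_apply' hA, this, measure_setOf_inv_mul_mem, ← mul_assoc,
    ENNReal.inv_mul_cancel hU0 hUt, one_mul]

/-- The number of points of `Γ` in a bounded set. -/
def latticeCount (Γ : Subgroup G) (A : Set G) : ℝ := ({γ : Γ | (γ : G) ∈ A}.ncard : ℝ)

lemma latticeCount_nonneg (Γ : Subgroup G) (A : Set G) : 0 ≤ latticeCount Γ A := Nat.cast_nonneg _

/-- The lattice average is dominated by the average over a thickened set. -/
lemma latticeCount_mul_le (hΓ : IsLattice Γ) [m.IsInvInvariant] {A A' U : Set G}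
    (hsub : U * A' * U⁻¹ ⊆ A) (hA : MeasurableSet A) (hAb : IsCompact (closure A))
    (hA'b : IsCompact (closure A')) (hUm : MeasurableSet U) (hUb : IsCompact (closure U))
    (hU : InjectsModulo Γ U) (hU0 : m U ≠ 0) {φ : X → ℝ} (hφ : Measurable φ) (hφ0 : 0 ≤ φ)
    {h : G} (hh : h ∈ U) (x : X) :
    latticeCount Γ A' * actionAverage (uniformOn {γ : Γ | (γ : G) ∈ A'}) φ x ≤
      (m A).toReal * actionAverage (ProbabilityTheory.cond m A) (inducedFun Γ m U φ)
        (inducedMk Γ X (h, x)) := by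
  have := hΓ.countable
  have hUt : m U ≠ ∞ := ((measure_mono subset_closure).trans_lt hUb.measure_lt_top).ne
  have hAt : m A ≠ ∞ := ((measure_mono subset_closure).trans_lt hAb.measure_lt_top).ne
  have hfin := hΓ.finite_inter hA'b
  -- Only points of Γ in the bounded set U⁻¹AU carry weight, so the sum is finite and can be read as
  -- a real number.
  have hbig : IsCompact (closure (U⁻¹ * A * U)) := by
    refine ((hUb.inv.mul hAb).mul hUb).closure_of_subset ?_
    exact Set.mul_subset_mul (Set.mul_subset_mul (Set.inv_subset_inv.2 subset_closure)
      subset_closure) subset_closure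
  rw [toReal_mul_actionAverage_cond hAt hUm hU hU0 hUt hφ, latticeCount,
    ncard_mul_actionAverage_uniformOn hfin]
  refine (ENNReal.ofReal_le_iff_le_toReal ?_).1
    (le_tsum_measure_mul hsub hfin hU0 hUt hh x hφ0 hA)
  exact ((tsum_measure_mul_le subset_rfl (hΓ.finite_inter hbig) hU0 hUt hh x hφ0 hA).trans_lt
    ENNReal.ofReal_lt_top).ne

/-- The lattice average dominates the average over a shrunken set. -/
lemma le_latticeCount_mul (hΓ : IsLattice Γ) [m.IsInvInvariant] {A A' U : Set G}
    (hsub : U⁻¹ * A * U ⊆ A') (hA : MeasurableSet A) (hAb : IsCompact (closure A))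
    (hA'b : IsCompact (closure A')) (hUm : MeasurableSet U) (hUb : IsCompact (closure U))
    (hU : InjectsModulo Γ U) (hU0 : m U ≠ 0) {φ : X → ℝ} (hφ : Measurable φ) (hφ0 : 0 ≤ φ)
    {h : G} (hh : h ∈ U) (x : X) :
    (m A).toReal * actionAverage (ProbabilityTheory.cond m A) (inducedFun Γ m U φ)
        (inducedMk Γ X (h, x)) ≤
      latticeCount Γ A' * actionAverage (uniformOn {γ : Γ | (γ : G) ∈ A'}) φ x := by
  have := hΓ.countable
  have hUt : m U ≠ ∞ := ((measure_mono subset_closure).trans_lt hUb.measure_lt_top).ne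
  have hAt : m A ≠ ∞ := ((measure_mono subset_closure).trans_lt hAb.measure_lt_top).ne
  have hfin := hΓ.finite_inter hA'b
  rw [toReal_mul_actionAverage_cond hAt hUm hU hU0 hUt hφ, latticeCount,
    ncard_mul_actionAverage_uniformOn hfin]
  exact ENNReal.toReal_le_of_le_ofReal (Finset.sum_nonneg fun γ _ => hφ0 _)
    (tsum_measure_mul_le hsub hfin hU0 hUt hh x hφ0 hA)

end Sandwich

/-! ### Lower bound for lattice counts by volume -/

section Counting

variable {G : Type*} [Group G] [TopologicalSpace G] [IsTopologicalGroup G] [T2Space G]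
  [LocallyCompactSpace G] [SecondCountableTopology G] [MeasurableSpace G] [BorelSpace G]
  {Γ : Subgroup G} {m : Measure G} [m.IsHaarMeasure] {F : Set G}

/-- The translates of F are disjoint up to null sets, so almost every h has at most one translate hγ
in F. -/
lemma ae_tsum_indicator_le_one [Countable Γ] (hF : IsFundamentalDomain Γ.op F m) {B : Set G}
    (hB : B ⊆ F) : ∀ᵐ h ∂m, ∑' γ : Γ, B.indicator (1 : G → ℝ≥0∞) (h * (γ : G)) ≤ 1 := by
  have : Countable Γ.op := (Subgroup.equivOp Γ).symm.injective.countable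
  have h1 : ∀ᵐ h ∂m, ∀ γ γ' : Γ.op, γ ≠ γ' → ¬ (h ∈ γ • F ∧ h ∈ γ' • F) := by
    rw [ae_all_iff]; intro γ
    rw [ae_all_iff]; intro γ'
    by_cases hne : γ = γ'
    · simp [hne]
    · have h2 : m (γ • F ∩ γ' • F) = 0 := hF.aedisjoint hne
      filter_upwards [measure_eq_zero_iff_ae_notMem.1 h2] with h hh _ using hh
  filter_upwards [h1] with h hh
  by_cases hex : ∃ γ₀ : Γ, h * (γ₀ : G) ∈ B
  · obtain ⟨γ₀, hγ₀⟩ := hex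
    have hmem : ∀ γ : Γ, h * (γ : G) ∈ B → h ∈ (Subgroup.equivOp Γ γ)⁻¹ • F := by
      intro γ hγ
      rw [Set.mem_smul_set_iff_inv_smul_mem, inv_inv]
      exact hB hγ
    rw [tsum_eq_single γ₀, Set.indicator_of_mem hγ₀]
    · rfl
    · intro γ hγ
      refine Set.indicator_of_notMem (fun hγB => ?_) _
      refine hh _ _ ?_ ⟨hmem γ hγB, hmem γ₀ hγ₀⟩
      intro heq
      exact hγ ((Subgroup.equivOp Γ).injective (inv_injective heq))
  · push Not at hex
    simp [Set.indicator_of_notMem (hex _)]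

lemma setLIntegral_tsum_indicator_mul [Countable Γ] [m.IsMulRightInvariant]
    (hF : IsFundamentalDomain Γ.op F m) {B : Set G} (hB : MeasurableSet B) (g : G) :
    ∫⁻ k in F, ∑' γ : Γ, B.indicator (1 : G → ℝ≥0∞) (g * k * (γ : G)) ∂m = m B := by
  have : Countable Γ.op := (Subgroup.equivOp Γ).symm.injective.countable
  have hind : Measurable (B.indicator (1 : G → ℝ≥0∞)) := measurable_one.indicator hB
  have h1 : ∫⁻ k, B.indicator (1 : G → ℝ≥0∞) (g * k) ∂m = m B := by
    rw [lintegral_mul_left_eq_self, lintegral_indicator_one hB]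
  have hterm : ∀ γ : Γ, Measurable fun k : G => B.indicator (1 : G → ℝ≥0∞) (g * k * (γ : G)) :=
    fun γ => hind.comp ((measurable_const_mul g).mul_const (γ : G))
  rw [lintegral_tsum fun γ => (hterm γ).aemeasurable, ← h1,
    hF.lintegral_eq_tsum'', ← (Subgroup.equivOp Γ).tsum_eq]
  refine tsum_congr fun γ => lintegral_congr fun k => ?_
  rw [mul_assoc]
  rfl

lemma measure_inter_setOf_le [m.IsMulRightInvariant] (A B : Set G) (k : G) :
    m (A ∩ {g | g * k ∈ B}) ≤ m B := by
  refine (measure_mono inter_subset_right).trans ?_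
  exact (measure_preimage_mul_right m k B).le

/-- The number of lattice points in a slightly thickened set is bounded below by the volume. -/
theorem exists_mul_measure_le_latticeCount (hΓ : IsLattice Γ) [m.IsMulRightInvariant]
    (hF : IsFundamentalDomain Γ.op F m) (hmF : m F = 1) :
    ∃ B : Set G, IsCompact B ∧ ∃ c : ℝ, 0 < c ∧ ∀ A A' : Set G, MeasurableSet A →
      m A ≠ ∞ → IsCompact (closure A') → B⁻¹ * A * B ⊆ A' →
      c * (m A).toReal ≤ latticeCount Γ A' := by
  have := hΓ.countable
  obtain ⟨F₀, hF₀F, hF₀m, hF₀⟩ := hF.nullMeasurableSet.exists_measurable_subset_ae_eq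
  have hmF₀ : m F₀ = 1 := by rw [measure_congr hF₀, hmF]
  -- F may be unbounded, so it is replaced by a compact B ⊆ F with m(B) > 1/2. With M(h) the number
  -- of γ such that hγ ∈ B, the integral of M(gk) over k ∈ F is m(B), and F ∖ B accounts for at most
  -- 1 − m(B). Hence the integral over k ∈ B is at least 2m(B) − 1 > 0, for every g.
  obtain ⟨B, hBF₀, hBc, hBm⟩ := hF₀m.exists_lt_isCompact_of_ne_top (μ := m) (r := 2⁻¹)
    (by rw [hmF₀]; simp) (by rw [hmF₀]; exact ENNReal.one_half_lt_one)
  have hBF : B ⊆ F := hBF₀.trans hF₀F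
  have hBmeas : MeasurableSet B := hBc.isClosed.measurableSet
  have hB1 : m B ≤ 1 := hmF ▸ measure_mono hBF
  have hind : Measurable (B.indicator (1 : G → ℝ≥0∞)) := measurable_one.indicator hBmeas
  have hBt : m B ≠ ∞ := (hB1.trans_lt ENNReal.one_lt_top).ne
  have hBr : (1 : ℝ) / 2 < (m B).toReal := by
    have := (ENNReal.toReal_lt_toReal (by simp) hBt).2 hBm
    simpa using this
  refine ⟨B, hBc, 2 * (m B).toReal - 1, by linarith, fun A A' hA hAt hA' hsub => ?_⟩
  set M : G → ℝ≥0∞ := fun h => ∑' γ : Γ, B.indicator (1 : G → ℝ≥0∞) (h * (γ : G)) with hM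
  have hMm : Measurable M := Measurable.tsum fun γ => hind.comp (measurable_mul_const (γ : G))
  have hlow : ∀ g : G, ENNReal.ofReal (2 * (m B).toReal - 1) ≤ ∫⁻ k in B, M (g * k) ∂m := by
    intro g
    have h1 : ∫⁻ k in F, M (g * k) ∂m = m B := setLIntegral_tsum_indicator_mul hF hBmeas g
    have h2 : ∫⁻ k in F \ B, M (g * k) ∂m ≤ m (F \ B) := by
      have h3 : ∀ᵐ k ∂m, M (g * k) ≤ 1 :=
        (quasiMeasurePreserving_mul_left m g).ae (ae_tsum_indicator_le_one hF hBF)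
      calc ∫⁻ k in F \ B, M (g * k) ∂m ≤ ∫⁻ k in F \ B, 1 ∂m :=
            lintegral_mono_ae (ae_restrict_of_ae h3)
        _ = m (F \ B) := by simp
    have h4 : m (F \ B) = 1 - m B := by
      rw [measure_sdiff hBF hBmeas.nullMeasurableSet hBt, hmF]
    have h5 : m B ≤ ∫⁻ k in B, M (g * k) ∂m + (1 - m B) := by
      calc m B = ∫⁻ k in F, M (g * k) ∂m := h1.symm
        _ = ∫⁻ k in B ∪ F \ B, M (g * k) ∂m := by rw [Set.union_sdiff_cancel hBF]
        _ ≤ ∫⁻ k in B, M (g * k) ∂m + ∫⁻ k in F \ B, M (g * k) ∂m := lintegral_union_le _ _ _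
        _ ≤ _ := by gcongr; exact h2.trans h4.le
    have h6 : ENNReal.ofReal (2 * (m B).toReal - 1) + (1 - m B) = m B := by
      rw [← ENNReal.toReal_eq_toReal_iff' (by simp) hBt, ENNReal.toReal_add (by simp) (by simp),
        ENNReal.toReal_sub_of_le hB1 (by simp), ENNReal.toReal_ofReal (by linarith)]
      simp; ring
    have h7 : (1 - m B) ≠ ∞ := (tsub_le_self.trans_lt ENNReal.one_lt_top).ne
    exact (ENNReal.add_le_add_iff_right h7).1 (h6.le.trans h5)
  have hfin := hΓ.finite_inter hA'
  -- If gkγ ∈ B with g ∈ A, then γ⁻¹ ∈ B⁻¹AB ⊆ A', and each such γ contributes at most m(B) ≤ 1. The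
  -- theorem follows by integrating M(gk) over A × B in both orders.
  have hup : ∀ k ∈ B, ∫⁻ g in A, M (g * k) ∂m ≤ (hfin.toFinset.card : ℝ≥0∞) := by
    intro k hk
    have h1 : ∫⁻ g in A, M (g * k) ∂m = ∑' γ : Γ, m (A ∩ {g | g * (k * (γ : G)) ∈ B}) := by
      simp only [hM]
      have hterm : ∀ γ : Γ, Measurable fun g : G =>
          B.indicator (1 : G → ℝ≥0∞) (g * k * (γ : G)) :=
        fun γ => hind.comp ((measurable_mul_const k).mul_const (γ : G))
      rw [lintegral_tsum fun γ => (hterm γ).aemeasurable]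
      refine tsum_congr fun γ => ?_
      have hs : MeasurableSet {g : G | g * (k * (γ : G)) ∈ B} := (measurable_mul_const _) hBmeas
      rw [Set.inter_comm, ← Measure.restrict_apply hs, ← lintegral_indicator_one hs]
      refine lintegral_congr fun g => ?_
      rw [mul_assoc]
      exact (Set.indicator_comp_right (s := B) (g := (1 : G → ℝ≥0∞)) (· * (k * (γ : G)))).symm
    rw [h1, ← (Equiv.inv Γ).tsum_eq, tsum_eq_sum (s := hfin.toFinset)]
    · calc ∑ γ ∈ hfin.toFinset, m (A ∩ {g | g * (k * ((Equiv.inv Γ γ : Γ) : G)) ∈ B})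
          ≤ ∑ γ ∈ hfin.toFinset, 1 :=
            Finset.sum_le_sum fun γ _ => (measure_inter_setOf_le A B _).trans hB1
        _ = _ := by simp
    · intro γ hγ
      have : A ∩ {g | g * (k * ((Equiv.inv Γ γ : Γ) : G)) ∈ B} = ∅ := by
        rw [Set.eq_empty_iff_forall_notMem]
        rintro g ⟨hgA, hg⟩
        apply hγ
        rw [hfin.mem_toFinset]
        refine hsub ⟨_, ⟨_, Set.inv_mem_inv.2 hg, g, hgA, rfl⟩, k, hk, ?_⟩
        simp [mul_assoc]
      rw [this, measure_empty]
  have hfinal : ENNReal.ofReal (2 * (m B).toReal - 1) * m A ≤ (hfin.toFinset.card : ℝ≥0∞) := by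
    calc ENNReal.ofReal (2 * (m B).toReal - 1) * m A
        = ∫⁻ g in A, ENNReal.ofReal (2 * (m B).toReal - 1) ∂m := by simp
      _ ≤ ∫⁻ g in A, ∫⁻ k in B, M (g * k) ∂m ∂m := lintegral_mono fun g => hlow g
      _ = ∫⁻ k in B, ∫⁻ g in A, M (g * k) ∂m ∂m := by
        rw [lintegral_lintegral_swap]
        exact (hMm.comp measurable_mul).aemeasurable
      _ ≤ ∫⁻ k in B, (hfin.toFinset.card : ℝ≥0∞) ∂m := setLIntegral_mono' hBmeas hup
      _ = hfin.toFinset.card * m B := by simp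
      _ ≤ hfin.toFinset.card * 1 := by gcongr
      _ = _ := mul_one _
  have h7 := ENNReal.toReal_mono (by simp) hfinal
  rw [ENNReal.toReal_mul, ENNReal.toReal_ofReal (by linarith)] at h7
  simpa [latticeCount, Set.ncard_eq_toFinset_card _ hfin] using h7

end Counting

/-! ### Arithmetic of the parameter sets -/

section Times

variable {T : Set ℝ}

lemma times_pos (hT : T = realTimes ∨ T = natTimes) {t : ℝ} (ht : t ∈ T) : 0 < t := by
  rcases hT with rfl | rfl
  · exact ht
  · obtain ⟨n, hn, rfl⟩ := ht; exact_mod_cast hn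

lemma times_add_mem (hT : T = realTimes ∨ T = natTimes) {s t : ℝ} (hs : s ∈ T) (ht : t ∈ T) :
    s + t ∈ T := by
  rcases hT with rfl | rfl
  · exact add_pos (mem_Ioi.1 hs) (mem_Ioi.1 ht)
  · obtain ⟨n, hn, rfl⟩ := hs
    obtain ⟨k, hk, rfl⟩ := ht
    exact ⟨n + k, by omega, by push_cast; rfl⟩

lemma times_sub_mem (hT : T = realTimes ∨ T = natTimes) {s t : ℝ} (hs : s ∈ T) (ht : t ∈ T)
    (hst : s < t) : t - s ∈ T := by
  rcases hT with rfl | rfl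
  · exact sub_pos.2 hst
  · obtain ⟨n, hn, rfl⟩ := hs
    obtain ⟨k, hk, rfl⟩ := ht
    have : n < k := by exact_mod_cast hst
    exact ⟨k - n, by omega, by push_cast [this.le]; rfl⟩

lemma one_mem_times (hT : T = realTimes ∨ T = natTimes) : (1 : ℝ) ∈ T := by
  rcases hT with rfl | rfl
  · exact mem_Ioi.2 one_pos
  · exact ⟨1, one_pos, by simp⟩

end Times

/-! ### Existence of thickening sets -/

section Thickenings

variable {G : Type*} [Group G] [TopologicalSpace G] [IsTopologicalGroup G] [T2Space G]
  [LocallyCompactSpace G] [SecondCountableTopology G] [MeasurableSpace G] [BorelSpace G]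

/-- The set `U` has positive finite measure, injects modulo `Γ`, and moves the sets `A t`,
`t ≥ t₁`, on both sides into `A (t + s)`. -/
structure Thickens (Γ : Subgroup G) (m : Measure G) (T : Set ℝ) (A : ℝ → Set G) (U : Set G)
    (s t₁ : ℝ) : Prop where
  measurableSet : MeasurableSet U
  bounded : IsCompact (closure U)
  injects : InjectsModulo Γ U
  measure_ne_zero : m U ≠ 0
  nonneg : 0 ≤ s
  add_mem : ∀ t ∈ T, t + s ∈ T
  sub_mem : ∀ t ∈ T, s < t → t - s ∈ T
  mul_subset : ∀ t ∈ T, t₁ ≤ t → U * A t * U⁻¹ ⊆ A (t + s)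
  inv_mul_subset : ∀ t ∈ T, t₁ ≤ t → U⁻¹ * A t * U ⊆ A (t + s)

variable {Γ : Subgroup G} {m : Measure G} {T : Set ℝ} {A : ℝ → Set G}

lemma Thickens.of_subset {U P : Set G} {s t₁ : ℝ} (hUm : MeasurableSet U)
    (hUb : IsCompact (closure U)) (hU : InjectsModulo Γ U) (hU0 : m U ≠ 0) (hs : 0 ≤ s)
    (hadd : ∀ t ∈ T, t + s ∈ T) (hsub : ∀ t ∈ T, s < t → t - s ∈ T) (hUP : U ⊆ P)
    (hUP' : U⁻¹ ⊆ P) (hP : ∀ t ∈ T, t₁ ≤ t → P * A t * P ⊆ A (t + s)) :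
    Thickens Γ m T A U s t₁ :=
  ⟨hUm, hUb, hU, hU0, hs, hadd, hsub,
    fun t ht h => (Set.mul_subset_mul (Set.mul_subset_mul_right hUP) hUP').trans (hP t ht h),
    fun t ht h => (Set.mul_subset_mul (Set.mul_subset_mul_right hUP') hUP).trans (hP t ht h)⟩

/-- Discreteness gives an open W meeting Γ only in 1, and V is chosen with V⁻¹V ⊆ W. -/
lemma IsLattice.exists_isOpen_injectsModulo (hΓ : IsLattice Γ) :
    ∃ V : Set G, IsOpen V ∧ (1 : G) ∈ V ∧ IsCompact (closure V) ∧ InjectsModulo Γ V := by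
  have := hΓ.discrete
  obtain ⟨W, hWo, hW⟩ : ∃ W : Set G, IsOpen W ∧ (Subtype.val : Γ → G) ⁻¹' W = {1} :=
    isOpen_induced_iff.1 (isOpen_discrete ({1} : Set Γ))
  have hW1 : (1 : G) ∈ W := by
    have : (1 : Γ) ∈ (Subtype.val : Γ → G) ⁻¹' W := by rw [hW]; rfl
    exact this
  have hcont : Tendsto (fun z : G × G => z.1⁻¹ * z.2) (𝓝 1 ×ˢ 𝓝 1) (𝓝 1) := by
    have : Continuous fun z : G × G => z.1⁻¹ * z.2 := by fun_prop
    have h := this.tendsto (1, 1)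
    rw [nhds_prod_eq] at h
    simpa using h
  obtain ⟨V₁, hV₁, V₂, hV₂, hV⟩ := Filter.mem_prod_iff.1 (hcont (hWo.mem_nhds hW1))
  obtain ⟨K, hK, hK1⟩ := exists_compact_mem_nhds (1 : G)
  refine ⟨interior (V₁ ∩ V₂ ∩ K), isOpen_interior,
    mem_interior_iff_mem_nhds.2 (inter_mem (inter_mem hV₁ hV₂) hK1),
    hK.closure_of_subset (interior_subset.trans inter_subset_right), ?_⟩
  intro g hg γ hγ
  have h1 := interior_subset hg
  have h2 := interior_subset hγ
  have h3 : g⁻¹ * (g * (γ : G)) ∈ W := hV (mk_mem_prod h1.1.1 h2.1.2)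
  have h4 : γ ∈ (Subtype.val : Γ → G) ⁻¹' W := by
    rw [mem_preimage]; simpa using h3
  rw [hW] at h4
  exact h4

variable [m.IsHaarMeasure]

lemma IsCoarselyAdmissible.exists_thickens (hΓ : IsLattice Γ) (hT : T = realTimes ∨ T = natTimes)
    (h : IsCoarselyAdmissible m T A) :
    ∃ U : Set G, ∃ s ∈ T, ∃ t₁ : ℝ, Thickens Γ m T A U s t₁ := by
  obtain ⟨V, hVo, hV1, hVb, hV⟩ := hΓ.exists_isOpen_injectsModulo
  have hB : IsCompact (closure (V ∪ V⁻¹)) := by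
    refine (hVb.union hVb.inv).closure_of_subset ?_
    exact Set.union_subset_union subset_closure (Set.inv_subset_inv.2 subset_closure)
  obtain ⟨c, hc, t₁, ht₁⟩ := h.stable _ hB
  exact ⟨V, c, hc, t₁, Thickens.of_subset hVo.measurableSet hVb hV
    (hVo.measure_pos m ⟨1, hV1⟩).ne' (times_pos hT hc).le (fun t ht => times_add_mem hT ht hc)
    (fun t ht htc => times_sub_mem hT hc ht htc) subset_union_left subset_union_right ht₁⟩

/-- Arbitrarily fine thickenings that change the volume arbitrarily little. -/
def HasThickenings (Γ : Subgroup G) (m : Measure G) (T : Set ℝ) (A : ℝ → Set G) : Prop :=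
  ∀ δ : ℝ, 0 < δ → ∃ U : Set G, ∃ s t₁ : ℝ, Thickens Γ m T A U s t₁ ∧
    ∀ t ∈ T, t₁ ≤ t → (m (A (t + s))).toReal ≤ (1 + δ) * (m (A t)).toReal

/-- Thickenings at every scale `ε`, with control of the volume growth and a polynomial lower
bound for the measure of the thickening set. -/
def HasFineThickenings (Γ : Subgroup G) (m : Measure G) (T : Set ℝ) (A : ℝ → Set G) : Prop :=
  ∃ c ρ κ t₁ : ℝ, 0 < c ∧ 0 < ρ ∧ 0 < κ ∧ ∀ ε ∈ Ioc (0 : ℝ) 1,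
    ∃ U : Set G, ∃ s : ℝ, s ≤ 1 ∧ Thickens Γ m T A U s t₁ ∧ κ * ε ^ ρ ≤ (m U).toReal ∧
      ∀ t ∈ T, t₁ ≤ t → (m (A (t + s))).toReal ≤ (1 + c * ε) * (m (A t)).toReal

lemma HasFineThickenings.hasThickenings (h : HasFineThickenings Γ m T A) :
    HasThickenings Γ m T A := by
  obtain ⟨c, ρ, κ, t₁, hc, hρ, hκ, h⟩ := h
  intro δ hδ
  have hε : min 1 (δ / c) ∈ Ioc (0 : ℝ) 1 := ⟨lt_min one_pos (by positivity), min_le_left _ _⟩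
  obtain ⟨U, s, -, hU, -, hs⟩ := h _ hε
  refine ⟨U, s, t₁, hU, fun t ht htt => (hs t ht htt).trans ?_⟩
  gcongr
  calc c * min 1 (δ / c) ≤ c * (δ / c) := by gcongr; exact min_le_right _ _
    _ = δ := by field_simp

lemma IsIncreasingBoundedFamily.measure_ne_top (hA : IsIncreasingBoundedFamily T A) {t : ℝ}
    (ht : t ∈ T) : m (A t) ≠ ∞ :=
  ((measure_mono subset_closure).trans_lt (hA.bounded t ht).measure_lt_top).ne

lemma toReal_le_mul_of_le_ofReal_mul {a b : ℝ≥0∞} {d : ℝ} (hd : 0 ≤ d) (hb : b ≠ ∞)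
    (h : a ≤ ENNReal.ofReal d * b) : a.toReal ≤ d * b.toReal := by
  have := ENNReal.toReal_mono (ENNReal.mul_ne_top ENNReal.ofReal_ne_top hb) h
  rwa [ENNReal.toReal_mul, ENNReal.toReal_ofReal hd] at this

/-- The volume condition fixes s first; stability for this s then supplies the neighbourhood, which
is symmetrized and intersected with V. -/
lemma IsQuasiUniform.hasThickenings (hΓ : IsLattice Γ)
    (hA : IsIncreasingBoundedFamily realTimes A) (h : IsQuasiUniform m A) :
    HasThickenings Γ m realTimes A := by
  intro δ hδ
  obtain ⟨V, hVo, hV1, hVb, hV⟩ := hΓ.exists_isOpen_injectsModulo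
  obtain ⟨s, hs, t₁, ht₁⟩ := h.continuity δ hδ
  obtain ⟨P, hP, t₂, ht₂⟩ := h.stable s hs
  have hP' : P⁻¹ ∈ 𝓝 (1 : G) := inv_mem_nhds_one G hP
  have hUo : IsOpen (V ∩ interior (P ∩ P⁻¹)) := hVo.inter isOpen_interior
  have hU1 : (1 : G) ∈ V ∩ interior (P ∩ P⁻¹) :=
    ⟨hV1, mem_interior_iff_mem_nhds.2 (inter_mem hP hP')⟩
  refine ⟨V ∩ interior (P ∩ P⁻¹), s, max t₁ t₂, Thickens.of_subset (P := P) hUo.measurableSet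
    (hVb.closure_of_subset (inter_subset_left.trans subset_closure)) (hV.mono inter_subset_left)
    (hUo.measure_pos m ⟨1, hU1⟩).ne' hs.le
    (fun t ht => times_add_mem (Or.inl rfl) ht (mem_Ioi.2 hs))
    (fun t ht hst => times_sub_mem (Or.inl rfl) (mem_Ioi.2 hs) ht hst)
    (inter_subset_right.trans (interior_subset.trans inter_subset_left)) ?_
    (fun t ht htt => ht₂ t ht ((le_max_right _ _).trans htt)), fun t ht htt => ?_⟩
  · rw [← Set.inv_subset_inv, inv_inv]
    exact inter_subset_right.trans (interior_subset.trans inter_subset_right)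
  · exact toReal_le_mul_of_le_ofReal_mul (by positivity) (hA.measure_ne_top ht)
      (ht₁ t ht ((le_max_left _ _).trans htt))

/-- Invariance under K₀ allows s = 0 and one fixed set V ∩ K₀ at all scales; the polynomial lower
bound is then trivial because ε ≤ 1. -/
lemma IsAdmissibleSequence.hasFineThickenings (hΓ : IsLattice Γ)
    (h : IsAdmissibleSequence m A) : HasFineThickenings Γ m natTimes A := by
  obtain ⟨V, hVo, hV1, hVb, hV⟩ := hΓ.exists_isOpen_injectsModulo
  obtain ⟨K₀, hK₀o, -, t₀, -, ht₀⟩ := h.invariant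
  have hUo : IsOpen (V ∩ (K₀ : Set G)) := hVo.inter hK₀o
  have hUb : IsCompact (closure (V ∩ (K₀ : Set G))) :=
    hVb.closure_of_subset (inter_subset_left.trans subset_closure)
  have hU0 : m (V ∩ (K₀ : Set G)) ≠ 0 := (hUo.measure_pos m ⟨1, hV1, K₀.one_mem⟩).ne'
  have hUt : m (V ∩ (K₀ : Set G)) ≠ ∞ :=
    ((measure_mono subset_closure).trans_lt hUb.measure_lt_top).ne
  refine ⟨1, 1, (m (V ∩ (K₀ : Set G))).toReal, t₀, one_pos, one_pos,
    ENNReal.toReal_pos hU0 hUt, fun ε hε => ⟨V ∩ (K₀ : Set G), 0, zero_le_one,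
      Thickens.of_subset (P := K₀) hUo.measurableSet hUb (hV.mono inter_subset_left) hU0 le_rfl
      (by simp) (fun t ht _ => by simpa using ht) inter_subset_right ?_ fun t ht htt => ?_, ?_, fun t ht htt => ?_⟩⟩
  · rw [← Set.inv_subset_inv, inv_inv, inv_coe_set]
    exact inter_subset_right
  · rw [ht₀ t ht htt, add_zero]
  · rw [Real.rpow_one]
    exact mul_le_of_le_one_right ENNReal.toReal_nonneg hε.2
  · rw [add_zero]
    have := hε.1
    nlinarith [ENNReal.toReal_nonneg (a := m (A t))]

/-- Since log ε < 0, the bound log m(O_ε) / log ε < ρ reads m(O_ε) > ε^ρ. Passing to max ρ 1 weakens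
this, as ε < 1, and makes the exponent positive. -/
lemma exists_rpow_le_of_upperLocalDimension_lt_top {O : ℝ → Set G} (hO : IsNhdFamily O)
    (hdim : upperLocalDimension m O < ⊤) :
    ∃ ρ ε₀ : ℝ, 0 < ρ ∧ 0 < ε₀ ∧ ε₀ < 1 ∧ ∀ ε, 0 < ε → ε < ε₀ →
      ε ^ ρ ≤ (m (O ε)).toReal := by
  obtain ⟨ρ, hρ, -⟩ := EReal.lt_iff_exists_real_btwn.1 hdim
  have h1 := eventually_lt_of_limsup_lt hρ
  obtain ⟨ε₁, hε₁, h2⟩ := mem_nhdsGT_iff_exists_Ioo_subset.1 h1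
  refine ⟨max ρ 1, min ε₁ (1 / 2), by positivity, lt_min hε₁ (by norm_num),
    (min_le_right _ _).trans_lt (by norm_num), fun ε hε hlt => ?_⟩
  have hε1 : ε < 1 := hlt.trans_le ((min_le_right _ _).trans (by norm_num))
  have h3 : Real.log (m (O ε)).toReal / Real.log ε < ρ := by
    have := h2 ⟨hε, hlt.trans_le (min_le_left _ _)⟩
    exact EReal.coe_lt_coe_iff.1 this
  have hOε : ε ∈ Ioo (0 : ℝ) 1 := ⟨hε, hε1⟩
  have hpos : 0 < (m (O ε)).toReal := by
    refine ENNReal.toReal_pos (Measure.measure_pos_of_mem_nhds m (hO.mem_nhds ε hOε)).ne' ?_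
    exact ((measure_mono subset_closure).trans_lt (hO.bounded ε hOε).measure_lt_top).ne
  have hlog : Real.log ε < 0 := Real.log_neg hε hε1
  rw [← Real.log_le_log_iff (Real.rpow_pos_of_pos hε _) hpos, Real.log_rpow hε]
  rw [div_lt_iff_of_neg hlog] at h3
  nlinarith [le_max_left ρ 1]

/-- Pigeonhole over a finite cover of P by translates of V: some translate captures a fixed fraction
of O, uniformly in O ⊆ P. Taking k one larger than the size of the cover keeps it positive and makes
the final comparison strict. -/
lemma exists_measure_le_card_mul {P V : Set G} (hVo : IsOpen V) (hV1 : (1 : G) ∈ V)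
    (hP : IsCompact P) : ∃ k : ℕ, 0 < k ∧ ∀ O : Set G, O ⊆ P →
      ∃ g : G, m O ≤ k * m (O ∩ g • V) := by
  obtain ⟨S, hS⟩ := hP.elim_finite_subcover (fun g : G => g • V) (fun g => hVo.smul g)
    (fun g _ => mem_iUnion.2 ⟨g, 1, hV1, by simp⟩)
  refine ⟨S.card + 1, by omega, fun O hOP => ?_⟩
  by_contra! hcon
  have h1 : m O ≤ ∑ g ∈ S, m (O ∩ g • V) := by
    refine (measure_mono (fun x hx => ?_)).trans (measure_biUnion_finset_le S _)
    obtain ⟨g, hgS, hxg⟩ := mem_iUnion₂.1 (hS (hOP hx))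
    exact mem_iUnion₂.2 ⟨g, hgS, hx, hxg⟩
  have h2 : ∀ g, m (O ∩ g • V) ≤ m O / (S.card + 1 : ℕ) := fun g => by
    rw [ENNReal.le_div_iff_mul_le (by simp) (by simp), mul_comm]
    exact (hcon g).le
  have h3 : m O ≤ S.card * (m O / (S.card + 1 : ℕ)) := by
    refine h1.trans ((Finset.sum_le_card_nsmul S _ _ fun g _ => h2 g).trans ?_)
    rw [nsmul_eq_mul]
  have h4 := (hcon 1)
  have hOt : m O ≠ ∞ := ((measure_mono hOP).trans_lt hP.measure_lt_top).ne
  have hO0 : m O ≠ 0 := fun h0 => by simp [h0] at h4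
  have h5 := ENNReal.toReal_mono (ENNReal.mul_ne_top (by simp)
    (ENNReal.div_ne_top hOt (by simp))) h3
  rw [ENNReal.toReal_mul, ENNReal.toReal_div] at h5
  simp only [ENNReal.toReal_natCast] at h5
  have hpos : 0 < (m O).toReal := ENNReal.toReal_pos hO0 hOt
  push_cast at h5
  have h6 : (S.card : ℝ) * ((m O).toReal / (S.card + 1)) < (m O).toReal := by
    rw [mul_div_assoc', div_lt_iff₀ (by positivity)]
    nlinarith
  linarith

/-- The sets O_ε are not assumed to shrink to the identity, so they may fail to inject modulo Γ.
Cutting O_ε down to its part in a suitable translate gV restores injectivity, keeps a fixed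
proportion of the measure and preserves the inclusions. The resulting set need not contain the
identity. -/
lemma IsAdmissibleFamily.hasFineThickenings (hΓ : IsLattice Γ)
    (hA : IsIncreasingBoundedFamily realTimes A) {O : ℝ → Set G} (hO : IsNhdFamily O)
    (hdim : upperLocalDimension m O < ⊤) (h : IsAdmissibleFamily m O A) :
    HasFineThickenings Γ m realTimes A := by
  obtain ⟨V, hVo, hV1, hVb, hV⟩ := hΓ.exists_isOpen_injectsModulo
  obtain ⟨ρ, ε₂, hρ, hε₂, hε₂1, hdimO⟩ := exists_rpow_le_of_upperLocalDimension_lt_top hO hdim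
  obtain ⟨c, hc, t₀, ht₀, ε₀, hε₀, hlip⟩ := h.lipschitz
  have hhalf : (1 / 2 : ℝ) ∈ Ioo (0 : ℝ) 1 := ⟨by norm_num, by norm_num⟩
  obtain ⟨k, hk, hcov⟩ := exists_measure_le_card_mul (m := m) hVo hV1
    (hO.bounded _ hhalf)
  have hε₀pos : 0 < ε₀ := hε₀.1
  -- Working at scale ηε makes every smallness condition hold for all ε ∈ (0, 1]: the Lipschitz
  -- estimates at ηε and at s = cηε, the dimension bound, the inclusion of O_{ηε} in the bounded set
  -- O_{1/2}, and s ≤ 1.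
  set η : ℝ := min (min ε₀ (ε₂ / 2)) (min (1 / 2) (min (ε₀ / c) (1 / c))) with hη
  have hηpos : 0 < η := by
    refine lt_min (lt_min hε₀.1 (by linarith)) (lt_min (by norm_num) (lt_min ?_ ?_)) <;> positivity
  have hη1 : η ≤ ε₀ := (min_le_left _ _).trans (min_le_left _ _)
  have hη2 : η ≤ ε₂ / 2 := (min_le_left _ _).trans (min_le_right _ _)
  have hη3 : η ≤ 1 / 2 := (min_le_right _ _).trans (min_le_left _ _)
  have hη4 : c * η ≤ ε₀ := by
    have : η ≤ ε₀ / c := (min_le_right _ _).trans ((min_le_right _ _).trans (min_le_left _ _))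
    rwa [le_div_iff₀ hc, mul_comm] at this
  have hη5 : c * η ≤ 1 := by
    have : η ≤ 1 / c := (min_le_right _ _).trans ((min_le_right _ _).trans (min_le_right _ _))
    rwa [le_div_iff₀ hc, mul_comm] at this
  refine ⟨c * (c * η), ρ, η ^ ρ / k, t₀, by positivity, hρ, by positivity, fun ε hε => ?_⟩
  have hε0 : 0 < ε := hε.1
  have hηε : 0 < η * ε := by positivity
  have hle : η * ε ≤ η := mul_le_of_le_one_right hηpos.le hε.2
  have hmem : η * ε ∈ Ioo (0 : ℝ) 1 := ⟨hηε, by linarith⟩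
  have hs : 0 < c * (η * ε) := by positivity
  have hsle : c * (η * ε) ≤ c * η := by gcongr
  obtain ⟨g, hg⟩ := hcov (O (η * ε))
    ((hO.mono hmem hhalf (by linarith)).trans subset_closure)
  have hOt : m (O (η * ε)) ≠ ∞ :=
    ((measure_mono subset_closure).trans_lt (hO.bounded _ hmem).measure_lt_top).ne
  have hO0 : m (O (η * ε)) ≠ 0 := (Measure.measure_pos_of_mem_nhds m (hO.mem_nhds _ hmem)).ne'
  have hU0 : m (O (η * ε) ∩ g • V) ≠ 0 := fun h0 => by
    rw [h0, mul_zero] at hg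
    exact hO0 (le_antisymm hg zero_le)
  have hUt : m (O (η * ε) ∩ g • V) ≠ ∞ := ((measure_mono inter_subset_left).trans_lt
    hOt.lt_top).ne
  refine ⟨O (η * ε) ∩ g • V, c * (η * ε), hsle.trans hη5, Thickens.of_subset (P := O (η * ε))
    ((hO.measurableSet _ hmem).inter (hVo.smul g).measurableSet)
    ((hO.bounded _ hmem).closure_of_subset (inter_subset_left.trans subset_closure))
    ((hV.const_mul g).mono inter_subset_right) hU0 hs.le
    (fun t ht => times_add_mem (Or.inl rfl) ht (mem_Ioi.2 hs))
    (fun t ht hst => times_sub_mem (Or.inl rfl) (mem_Ioi.2 hs) ht hst)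
    inter_subset_left ?_ (fun t ht htt => (hlip t htt _ hηε (hle.trans hη1)).1), ?_,
    fun t ht htt => ?_⟩
  · rw [← Set.inv_subset_inv, inv_inv, hO.symm _ hmem]
    exact inter_subset_left
  · have h1 := ENNReal.toReal_mono (ENNReal.mul_ne_top (by simp) hUt) hg
    rw [ENNReal.toReal_mul, ENNReal.toReal_natCast] at h1
    have h2 := (hdimO (η * ε) hηε (by linarith)).trans h1
    rw [Real.mul_rpow hηpos.le hε0.le] at h2
    have hk' : (0 : ℝ) < k := by exact_mod_cast hk
    rw [div_mul_eq_mul_div, div_le_iff₀ hk']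
    linarith
  · have h1 := (hlip t htt _ hs (hsle.trans hη4)).2
    have h2 := toReal_le_mul_of_le_ofReal_mul (by positivity) (hA.measure_ne_top ht) h1
    calc _ ≤ _ := h2
      _ = _ := by ring

end Thickenings

/-! ### Comparability of lattice counts and volumes -/

section CountBounds

variable {G : Type*} [Group G] [TopologicalSpace G] [IsTopologicalGroup G] [T2Space G]
  [LocallyCompactSpace G] [SecondCountableTopology G] [MeasurableSpace G] [BorelSpace G]
  {Γ : Subgroup G} {m : Measure G} [m.IsHaarMeasure] {T : Set ℝ} {A : ℝ → Set G}

lemma Thickens.measure_ne_top {U : Set G} {s t₁ : ℝ} (hU : Thickens Γ m T A U s t₁) :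
    m U ≠ ∞ :=
  ((measure_mono subset_closure).trans_lt hU.bounded.measure_lt_top).ne

lemma Thickens.toReal_pos {U : Set G} {s t₁ : ℝ} (hU : Thickens Γ m T A U s t₁) :
    0 < (m U).toReal := ENNReal.toReal_pos hU.measure_ne_zero hU.measure_ne_top

lemma Thickens.nonempty {U : Set G} {s t₁ : ℝ} (hU : Thickens Γ m T A U s t₁) :
    U.Nonempty := nonempty_of_measure_ne_zero hU.measure_ne_zero

/-- The sets hγU⁻¹ with γ ∈ Γ ∩ A_t are pairwise disjoint, have measure m(U), and all lie in U A_t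
U⁻¹ ⊆ A_{t+s}. -/
lemma Thickens.latticeCount_le [m.IsInvInvariant] (hΓ : IsLattice Γ)
    (hA : IsIncreasingBoundedFamily T A) {U : Set G} {s t₁ : ℝ} (hU : Thickens Γ m T A U s t₁)
    {t : ℝ} (ht : t ∈ T) (htt : t₁ ≤ t) :
    (m U).toReal * latticeCount Γ (A t) ≤ (m (A (t + s))).toReal := by
  obtain ⟨h, hh⟩ := hU.nonempty
  have hfin := hΓ.finite_inter (hA.bounded t ht)
  have hdisj : (hfin.toFinset : Set Γ).PairwiseDisjoint
      fun γ => {g : G | g⁻¹ * (h * (γ : G)) ∈ U} := by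
    intro γ _ γ' _ hne
    refine Set.disjoint_left.2 fun g hg hg' => hne ?_
    have h1 := hU.injects _ hg (γ⁻¹ * γ') (by
      have : g⁻¹ * (h * (γ : G)) * ((γ⁻¹ * γ' : Γ) : G) = g⁻¹ * (h * (γ' : G)) := by
        simp [mul_assoc]
      rw [this]; exact hg')
    exact inv_mul_eq_one.1 h1
  have hmeas : ∀ γ : Γ, MeasurableSet {g : G | g⁻¹ * (h * (γ : G)) ∈ U} := fun γ =>
    (measurable_inv.mul_const _) hU.measurableSet
  have h1 : (hfin.toFinset.card : ℝ≥0∞) * m U ≤ m (A (t + s)) := by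
    calc (hfin.toFinset.card : ℝ≥0∞) * m U
        = ∑ γ ∈ hfin.toFinset, m {g : G | g⁻¹ * (h * (γ : G)) ∈ U} := by
          simp [measure_setOf_inv_mul_mem]
      _ = m (⋃ γ ∈ hfin.toFinset, {g : G | g⁻¹ * (h * (γ : G)) ∈ U}) :=
          (measure_biUnion_finset hdisj fun γ _ => hmeas γ).symm
      _ ≤ m (A (t + s)) := by
          refine measure_mono fun g hg => ?_
          obtain ⟨γ, hγ, hg⟩ := mem_iUnion₂.1 hg
          refine hU.mul_subset t ht htt ⟨h * γ, ⟨h, hh, _, hfin.mem_toFinset.1 hγ, rfl⟩,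
            (g⁻¹ * (h * (γ : G)))⁻¹, Set.inv_mem_inv.2 hg, ?_⟩
          simp [mul_assoc]
  have h2 := ENNReal.toReal_mono (hA.measure_ne_top (hU.add_mem t ht)) h1
  rw [ENNReal.toReal_mul, ENNReal.toReal_natCast] at h2
  rw [latticeCount, Set.ncard_eq_toFinset_card _ hfin, mul_comm]
  exact h2

lemma IsCoarselyAdmissible.exists_growth
    (hA : IsIncreasingBoundedFamily T A) (h : IsCoarselyAdmissible m T A) {c : ℝ} (hc : c ∈ T) :
    ∃ d : ℝ, 0 < d ∧ ∃ t₁ : ℝ, ∀ t ∈ T, t₁ ≤ t →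
      (m (A (t + c))).toReal ≤ d * (m (A t)).toReal := by
  obtain ⟨d, hd, t₁, ht₁⟩ := h.growth c hc
  exact ⟨d, hd, t₁, fun t ht htt =>
    toReal_le_mul_of_le_ofReal_mul hd.le (hA.measure_ne_top ht) (ht₁ t ht htt)⟩

/-- Under coarse admissibility the lattice point count is comparable to the volume. -/
lemma IsCoarselyAdmissible.exists_latticeCount_bounds [m.IsMulRightInvariant] [m.IsInvInvariant]
    (hΓ : IsLattice Γ) {F : Set G} (hF : IsFundamentalDomain Γ.op F m) (hmF : m F = 1)
    (hT : T = realTimes ∨ T = natTimes) (hA : IsIncreasingBoundedFamily T A)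
    (h : IsCoarselyAdmissible m T A) :
    ∃ K : ℝ, 0 < K ∧ ∃ t₂ : ℝ, ∀ t ∈ T, t₂ ≤ t →
      (m (A t)).toReal ≤ K * latticeCount Γ (A t) ∧
      latticeCount Γ (A t) ≤ K * (m (A t)).toReal := by
  obtain ⟨B, hB, c₀, hc₀, hcount⟩ := exists_mul_measure_le_latticeCount (m := m) hΓ hF hmF
  obtain ⟨c, hc, t₁, hstab⟩ := h.stable (B ∪ B⁻¹) ((hB.union hB.inv).closure)
  obtain ⟨d, hd, t₂, hgrow⟩ := h.exists_growth hA hc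
  obtain ⟨U, s, hs, t₃, hU⟩ := h.exists_thickens hΓ hT
  obtain ⟨d', hd', t₄, hgrow'⟩ := h.exists_growth hA hs
  have hUpos := hU.toReal_pos
  have hcpos := times_pos hT hc
  refine ⟨max (d / c₀) (d' / (m U).toReal), by positivity,
    max (max t₁ t₂ + c + 1) (max (max t₃ t₄) (c + 1)), fun t ht htt => ⟨?_, ?_⟩⟩
  -- The counting bound is applied to A_{t-c}, whose thickening by B lies in A_t; the growth
  -- condition then compares the volumes at t − c and t.
  · have h1 : max t₁ t₂ + c + 1 ≤ t := (le_max_left _ _).trans htt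
    have h2 : c + 1 ≤ t := (le_max_right _ _).trans ((le_max_right _ _).trans htt)
    have htc : t - c ∈ T := times_sub_mem hT hc ht (by linarith)
    have h3 := hgrow (t - c) htc (by linarith [le_max_right t₁ t₂])
    have h4 := hstab (t - c) htc (by linarith [le_max_left t₁ t₂])
    rw [sub_add_cancel] at h3 h4
    have h5 := hcount (A (t - c)) (A t) (hA.measurableSet _ htc) (hA.measure_ne_top htc)
      (hA.bounded t ht) ((Set.mul_subset_mul (Set.mul_subset_mul_right subset_union_right)
        subset_union_left).trans h4)
    calc (m (A t)).toReal ≤ d * (m (A (t - c))).toReal := h3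
      _ = d / c₀ * (c₀ * (m (A (t - c))).toReal) := by field_simp
      _ ≤ d / c₀ * latticeCount Γ (A t) := by gcongr
      _ ≤ _ := by
        gcongr
        · exact latticeCount_nonneg _ _
        · exact le_max_left _ _
  · have h1 : max t₃ t₄ ≤ t := (le_max_left _ _).trans ((le_max_right _ _).trans htt)
    have h2 := hU.latticeCount_le hΓ hA ht ((le_max_left _ _).trans h1)
    have h3 := hgrow' t ht ((le_max_right _ _).trans h1)
    calc latticeCount Γ (A t) ≤ (m (A (t + s))).toReal / (m U).toReal := by
          rw [le_div_iff₀ hUpos, mul_comm]; exact h2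
      _ ≤ d' * (m (A t)).toReal / (m U).toReal := by gcongr
      _ = d' / (m U).toReal * (m (A t)).toReal := by ring
      _ ≤ _ := by gcongr; exact le_max_right _ _

end CountBounds

/-! ### Almost everywhere modifications and measurability -/

section Averages

variable {Λ Z : Type*} [Group Λ] [MeasurableSpace Λ] [MulAction Λ Z]

lemma actionAverage_congr {β : Measure Λ} {f g : Z → ℝ} {z : Z}
    (h : ∀ γ : Λ, f (γ⁻¹ • z) = g (γ⁻¹ • z)) : actionAverage β f z = actionAverage β g z := by
  simp only [actionAverage, h]

lemma abs_actionAverage_le (β : Measure Λ) (f : Z → ℝ) (z : Z) :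
    |actionAverage β f z| ≤ actionAverage β (fun w => |f w|) z :=
  norm_integral_le_integral_norm (μ := β) fun h => f (h⁻¹ • z)

lemma actionAverage_nonneg (β : Measure Λ) {f : Z → ℝ} (hf : 0 ≤ f) (z : Z) :
    0 ≤ actionAverage β f z := integral_nonneg fun _ => hf _

variable [MeasurableSpace Z] [MeasurableConstSMul Λ Z] {μ : Measure Z}
  [SMulInvariantMeasure Λ Z μ] [Countable Λ]

/-- Λ is countable and preserves μ, so a change on a null set leaves the whole orbit of almost every
point untouched. -/
lemma ae_forall_smul_eq {E : Type*} {f g : Z → E} (h : f =ᵐ[μ] g) :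
    ∀ᵐ z ∂μ, ∀ γ : Λ, f (γ⁻¹ • z) = g (γ⁻¹ • z) := by
  rw [ae_all_iff]
  exact fun γ => (measurePreserving_smul γ⁻¹ μ).quasiMeasurePreserving.ae h

variable [MeasurableSingletonClass Λ]

lemma measurable_actionAverage_uniformOn {S : Set Λ} (hS : S.Finite) {f : Z → ℝ}
    (hf : Measurable f) : Measurable (actionAverage (uniformOn S) f) := by
  have : actionAverage (uniformOn S) f =
      fun z => (S.ncard : ℝ)⁻¹ * ∑ γ ∈ hS.toFinset, f (γ⁻¹ • z) :=
    funext (actionAverage_uniformOn hS f)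
  rw [this]
  exact (Finset.measurable_fun_sum _ fun γ _ => hf.comp (measurable_const_smul γ⁻¹)).const_mul _

/-- A supremum over times of a function of the finite sets `S t` is a countable supremum. -/
lemma measurable_iSup_finite {S : ℝ → Set Λ} {T : Set ℝ} (hS : ∀ t ∈ T, (S t).Finite)
    {g : Set Λ → Z → ℝ≥0∞} (hg : ∀ R : Set Λ, R.Finite → Measurable (g R)) :
    Measurable fun z => ⨆ t ∈ T, g (S t) z := by
  have : (fun z => ⨆ t ∈ T, g (S t) z) =
      fun z => ⨆ R : Finset Λ, ⨆ _ : ∃ t ∈ T, S t = R, g R z := by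
    funext z
    refine le_antisymm (iSup₂_le fun t ht => ?_) (iSup₂_le ?_)
    · refine le_iSup₂_of_le (hS t ht).toFinset ⟨t, ht, by simp⟩ ?_
      simp
    · rintro R ⟨t, ht, hR⟩
      rw [← hR]
      exact le_iSup₂ (f := fun t (_ : t ∈ T) => g (S t) z) t ht
  rw [this]
  exact Measurable.iSup fun R => Measurable.iSup fun _ => hg _ R.finite_toSet

end Averages

/-! ### The strong maximal inequality -/

section MaximalInequality

variable {G : Type*} [Group G] [TopologicalSpace G] [IsTopologicalGroup G] [T2Space G]
  [LocallyCompactSpace G] [SecondCountableTopology G] [MeasurableSpace G] [BorelSpace G]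
  {Γ : Subgroup G} {m : Measure G} [m.IsHaarMeasure] {T : Set ℝ} {A : ℝ → Set G}
  {X : Type*} [MulAction Γ X] [MeasurableSpace X] [MeasurableConstSMul Γ X]
  {μ : Measure X} [IsProbabilityMeasure μ] [SMulInvariantMeasure Γ X μ]

lemma enorm_actionAverage_mono {Λ Z : Type*} [Group Λ] [MeasurableSpace Λ] [MulAction Λ Z]
    (β : Measure Λ) {f g : Z → ℝ} {z : Z} (h : ∀ γ : Λ, |f (γ⁻¹ • z)| = g (γ⁻¹ • z)) :
    ‖actionAverage β f z‖ₑ ≤ ‖actionAverage β g z‖ₑ := by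
  rw [Real.enorm_eq_ofReal_abs, Real.enorm_eq_ofReal_abs]
  refine ENNReal.ofReal_le_ofReal ((abs_actionAverage_le β f z).trans ?_)
  rw [actionAverage_congr (g := g) h]
  exact le_abs_self _

/-- Averages of f are dominated by averages of |f|, and a measurable version of |f| has the same
averages at almost every point. -/
lemma strongMaximalInequality_of_nonneg {Λ Z : Type*} [Group Λ] [MeasurableSpace Λ]
    [Countable Λ] [MulAction Λ Z] [MeasurableSpace Z] [MeasurableConstSMul Λ Z] {η : Measure Z}
    [SMulInvariantMeasure Λ Z η] {β : ℝ → Measure Λ} {p r : ℝ≥0∞} {t₀ C : ℝ} (ht₀ : 0 ≤ t₀)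
    (hC : 0 < C) (h : ∀ φ : Z → ℝ, Measurable φ → 0 ≤ φ → MemLp φ p η →
      eLpNorm (fun z => ⨆ t ∈ T, ⨆ _ : t₀ < t, ‖actionAverage (β t) φ z‖ₑ) r η
        ≤ ENNReal.ofReal C * eLpNorm φ p η) : StrongMaximalInequality T β p r η := by
  refine ⟨t₀, ht₀, C, hC, fun f hf => ?_⟩
  set φ : Z → ℝ := fun z => |hf.1.mk f z| with hφ
  have hφm : Measurable φ := hf.1.stronglyMeasurable_mk.measurable.abs
  have hae : (fun z => |f z|) =ᵐ[η] φ := hf.1.ae_eq_mk.mono fun z hz => by simp only [hφ, ← hz]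
  have hnorm : eLpNorm φ p η = eLpNorm f p η := by
    rw [← eLpNorm_congr_ae hae]
    exact eLpNorm_congr_norm_ae (ae_of_all _ fun z => by simp)
  have hφp : MemLp φ p η := ⟨hφm.aestronglyMeasurable, hnorm ▸ hf.2⟩
  rw [← hnorm]
  refine le_trans (eLpNorm_mono_enorm_ae ?_) (h φ hφm (fun z => abs_nonneg _) hφp)
  filter_upwards [ae_forall_smul_eq (Λ := Λ) hae] with z hz
  simp only [enorm_eq_self]
  gcongr with t ht htt
  exact enorm_actionAverage_mono (β t) hz

theorem strongMaximalInequality_latticeUniform [m.IsMulRightInvariant] [m.IsInvInvariant]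
    (hΓ : IsLattice Γ) {F : Set G} (hF : IsFundamentalDomain Γ.op F m) (hmF : m F = 1)
    (hT : T = realTimes ∨ T = natTimes) (hA : IsIncreasingBoundedFamily T A)
    (h : IsCoarselyAdmissible m T A) {p r : ℝ≥0∞}
    (hβ : StrongMaximalInequality T (haarUniform m A) p r (inducedMeasure Γ X m F μ)) :
    StrongMaximalInequality T (latticeUniform Γ A) p r μ := by
  have := hΓ.countable
  obtain ⟨t₀, ht₀, C, hC, hβ⟩ := hβ
  obtain ⟨K, hK, t₂, hcount⟩ := h.exists_latticeCount_bounds hΓ hF hmF hT hA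
  obtain ⟨U, s, hs, t₃, hU⟩ := h.exists_thickens hΓ hT
  obtain ⟨d, hd, t₄, hgrow⟩ := h.exists_growth hA hs
  have hU0 := hU.measure_ne_zero
  have hUt := hU.measure_ne_top
  have hspos := times_pos hT hs
  set D : ℝ≥0∞ := (m U ^ (1 / r).toReal)⁻¹ * (ENNReal.ofReal (d * K) * (ENNReal.ofReal C *
    ((m U)⁻¹ * m U ^ (1 / p).toReal))) with hD
  have hne0 : ∀ q : ℝ≥0∞, m U ^ (1 / q).toReal ≠ 0 := fun q => by
    simp [ENNReal.rpow_eq_zero_iff, hU0, hUt]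
  have hnet : ∀ q : ℝ≥0∞, m U ^ (1 / q).toReal ≠ ∞ := fun q =>
    ENNReal.rpow_ne_top_of_nonneg ENNReal.toReal_nonneg hUt
  have hDt : D ≠ ∞ := by
    refine ENNReal.mul_ne_top (ENNReal.inv_ne_top.2 (hne0 r)) (ENNReal.mul_ne_top
      ENNReal.ofReal_ne_top (ENNReal.mul_ne_top ENNReal.ofReal_ne_top (ENNReal.mul_ne_top
        (ENNReal.inv_ne_top.2 hU0) (hnet p))))
  refine strongMaximalInequality_of_nonneg (t₀ := max t₀ (max t₂ (max t₃ t₄)))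
    (C := D.toReal + 1) (ht₀.trans (le_max_left _ _)) (by positivity) fun φ hφm hφ0 hφp => ?_
  set W : InducedSpace Γ X → ℝ≥0∞ := fun y => ⨆ t ∈ T, ⨆ _ : t₀ < t,
    ‖actionAverage (haarUniform m A t) (inducedFun Γ m U φ) y‖ₑ with hW
  set v : X → ℝ≥0∞ := fun x => ⨆ t ∈ T, ⨆ _ : max t₀ (max t₂ (max t₃ t₄)) < t,
    ‖actionAverage (latticeUniform Γ A t) φ x‖ₑ with hv
  have hvm : Measurable v := by
    have h1 : v = fun x => ⨆ t ∈ T ∩ Ioi (max t₀ (max t₂ (max t₃ t₄))),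
        ‖actionAverage (uniformOn {γ : Γ | (γ : G) ∈ A t}) φ x‖ₑ := by
      funext x
      simp only [hv, mem_inter_iff, iSup_and, mem_Ioi]
      rfl
    rw [h1]
    exact measurable_iSup_finite (S := fun t => {γ : Γ | (γ : G) ∈ A t})
      (g := fun R x => ‖actionAverage (uniformOn R) φ x‖ₑ)
      (fun t ht => hΓ.finite_inter (hA.bounded t ht.1))
      fun R hR => (measurable_actionAverage_uniformOn hR hφm).enorm
  -- With N the lattice count at time t, the sandwich bounds N times the lattice average by
  -- m(A_{t+s}) times a Haar average, and m(A_{t+s}) ≤ d m(A_t) ≤ dK N. Dividing by N leaves dK; if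
  -- N = 0 the lattice average is 0.
  have hvW : ∀ g ∈ U, ∀ x, v x ≤ ENNReal.ofReal (d * K) * W (inducedMk Γ X (g, x)) := by
    intro g hg x
    refine iSup₂_le fun t ht => iSup_le fun htt => ?_
    have h0 : t₀ < t := (le_max_left _ _).trans_lt htt
    have h2 : t₂ < t := ((le_max_left _ _).trans (le_max_right _ _)).trans_lt htt
    have h34 : max t₃ t₄ < t := ((le_max_right _ _).trans (le_max_right _ _)).trans_lt htt
    have h3 : t₃ ≤ t := ((le_max_left _ _).trans_lt h34).le
    have h4 : t₄ ≤ t := ((le_max_right _ _).trans_lt h34).le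
    have hts := hU.add_mem t ht
    have hsand := latticeCount_mul_le hΓ (hU.mul_subset t ht h3) (hA.measurableSet _ hts)
      (hA.bounded _ hts) (hA.bounded t ht) hU.measurableSet hU.bounded hU.injects hU0 hφm hφ0
      hg x
    have hle : ‖actionAverage (haarUniform m A (t + s)) (inducedFun Γ m U φ)
        (inducedMk Γ X (g, x))‖ₑ ≤ W (inducedMk Γ X (g, x)) :=
      le_iSup₂_of_le (t + s) hts (le_iSup_of_le (by linarith) le_rfl)
    refine le_trans ?_ (mul_le_mul_right hle _)
    rw [Real.enorm_of_nonneg (actionAverage_nonneg _ hφ0 x), Real.enorm_of_nonneg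
      (actionAverage_nonneg _ (inducedFun_nonneg U φ) _), ← ENNReal.ofReal_mul (by positivity)]
    refine ENNReal.ofReal_le_ofReal ?_
    set b := actionAverage (haarUniform m A (t + s)) (inducedFun Γ m U φ)
        (inducedMk Γ X (g, x))
    have hb : 0 ≤ b := actionAverage_nonneg _ (inducedFun_nonneg U φ) _
    rcases (latticeCount_nonneg Γ (A t)).eq_or_lt with hN | hN
    · have hN' : ({γ : Γ | (γ : G) ∈ A t}.ncard : ℝ) = 0 := hN.symm
      have : actionAverage (latticeUniform Γ A t) φ x = 0 := by
        rw [latticeUniform, actionAverage_uniformOn (hΓ.finite_inter (hA.bounded t ht)), hN']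
        simp
      rw [this]
      positivity
    · have h5 := hgrow t ht h4
      have h6 := (hcount t ht h2.le).1
      have h7 : (m (A (t + s))).toReal ≤ d * K * latticeCount Γ (A t) := by
        calc _ ≤ _ := h5
          _ ≤ d * (K * latticeCount Γ (A t)) := by gcongr
          _ = _ := by ring
      refine le_of_mul_le_mul_left (hsand.trans ?_) hN
      calc (m (A (t + s))).toReal * b ≤ d * K * latticeCount Γ (A t) * b := by gcongr
        _ = _ := by ring
  have hmem := memLp_inducedFun hF hU.measurableSet hU.injects hU0 hUt hφm hφ0 hφp (m := m)
  have h1 := mul_eLpNorm_le_of_le (μ := μ) hF hU.measurableSet hU.injects hU0 hvm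
    (W := fun y => ENNReal.ofReal (d * K) * W y) hvW r
  have h2 : eLpNorm (fun y => ENNReal.ofReal (d * K) * W y) r (inducedMeasure Γ X m F μ) ≤
      ENNReal.ofReal (d * K) * eLpNorm W r (inducedMeasure Γ X m F μ) :=
    eLpNorm_le_mul_eLpNorm_of_ae_le_mul' (c := (d * K).toNNReal) (ae_of_all _ fun y => le_rfl) r
  have h3 := hβ _ hmem
  rw [eLpNorm_inducedFun hF hU.measurableSet hU.injects hU0 hUt hφm hφ0] at h3
  have h4 : m U ^ (1 / r).toReal * eLpNorm v r μ ≤ ENNReal.ofReal (d * K) * (ENNReal.ofReal C *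
      ((m U)⁻¹ * (m U ^ (1 / p).toReal * eLpNorm φ p μ))) :=
    h1.trans (h2.trans (mul_le_mul_right h3 _))
  calc eLpNorm v r μ = (m U ^ (1 / r).toReal)⁻¹ * (m U ^ (1 / r).toReal * eLpNorm v r μ) := by
        rw [← mul_assoc, ENNReal.inv_mul_cancel (hne0 r) (hnet r), one_mul]
    _ ≤ (m U ^ (1 / r).toReal)⁻¹ * (ENNReal.ofReal (d * K) * (ENNReal.ofReal C *
      ((m U)⁻¹ * (m U ^ (1 / p).toReal * eLpNorm φ p μ)))) := by gcongr
    _ = D * eLpNorm φ p μ := by rw [hD]; ring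
    _ ≤ ENNReal.ofReal (D.toReal + 1) * eLpNorm φ p μ := by
        gcongr
        rw [← ENNReal.ofReal_toReal hDt]
        exact ENNReal.ofReal_le_ofReal (by rw [ENNReal.toReal_ofReal ENNReal.toReal_nonneg]; linarith)

end MaximalInequality

/-- The `L^r` deviation of the ergodic averages of the induced function from the mean. -/
def inducedError {G : Type*} [Group G] [MeasurableSpace G] (Γ : Subgroup G) (m : Measure G)
    (F : Set G) (A : ℝ → Set G) (U : Set G) {X : Type*} [MulAction Γ X] [MeasurableSpace X]
    (μ : Measure X) (r : ℝ≥0∞) (φ : X → ℝ) (t : ℝ) : ℝ≥0∞ :=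
  eLpNorm (fun y => actionAverage (haarUniform m A t) (inducedFun Γ m U φ) y - ∫ x, φ x ∂μ) r
    (inducedMeasure Γ X m F μ)

/-! ### Transfer of norm deviations -/

section Transfer

variable {G : Type*} [Group G] [TopologicalSpace G] [IsTopologicalGroup G] [T2Space G]
  [LocallyCompactSpace G] [SecondCountableTopology G] [MeasurableSpace G] [BorelSpace G]
  {Γ : Subgroup G} {m : Measure G} [m.IsHaarMeasure] {T : Set ℝ} {A : ℝ → Set G}
  {X : Type*} [MulAction Γ X] [MeasurableSpace X] [MeasurableConstSMul Γ X]
  {μ : Measure X} [IsProbabilityMeasure μ] [SMulInvariantMeasure Γ X μ] {F : Set G}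

lemma rpow_measure_ne_zero {U : Set G} (hU0 : m U ≠ 0) (hUt : m U ≠ ∞) (a : ℝ) : m U ^ a ≠ 0 := by
  simp [ENNReal.rpow_eq_zero_iff, hU0, hUt]

lemma rpow_measure_ne_top {U : Set G} (hU0 : m U ≠ 0) (hUt : m U ≠ ∞) (a : ℝ) : m U ^ a ≠ ∞ := by
  simp [ENNReal.rpow_eq_top_iff, hU0, hUt]

variable [m.IsMulRightInvariant]

/-- Transfer of norm bounds with a multiplicative constant. -/
lemma Thickens.eLpNorm_le_mul (hΓ : IsLattice Γ) (hF : IsFundamentalDomain Γ.op F m) {U : Set G}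
    {s t₁ : ℝ} (hU : Thickens Γ m T A U s t₁) {v : X → ℝ≥0∞} (hv : Measurable v)
    {W : InducedSpace Γ X → ℝ} {a : ℝ} {r E : ℝ≥0∞}
    (h : ∀ g ∈ U, ∀ x, v x ≤ ENNReal.ofReal a * ‖W (inducedMk Γ X (g, x))‖ₑ)
    (hE : eLpNorm W r (inducedMeasure Γ X m F μ) ≤ m U ^ (1 / r).toReal * E) :
    eLpNorm v r μ ≤ ENNReal.ofReal a * E := by
  have := hΓ.countable
  have h1 := mul_eLpNorm_le_of_le (μ := μ) hF hU.measurableSet hU.injects hU.measure_ne_zero hv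
    (W := fun y => ENNReal.ofReal a * ‖W y‖ₑ) h r
  have h2 : eLpNorm (fun y => ENNReal.ofReal a * ‖W y‖ₑ) r (inducedMeasure Γ X m F μ) ≤
      ENNReal.ofReal a * eLpNorm W r (inducedMeasure Γ X m F μ) :=
    eLpNorm_le_mul_eLpNorm_of_ae_le_mul' (c := a.toNNReal) (ae_of_all _ fun y => le_rfl) r
  have h3 : m U ^ (1 / r).toReal * eLpNorm v r μ ≤
      m U ^ (1 / r).toReal * (ENNReal.ofReal a * E) := by
    calc _ ≤ _ := h1.trans h2
      _ ≤ ENNReal.ofReal a * (m U ^ (1 / r).toReal * E) := by gcongr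
      _ = _ := by ring
  exact (ENNReal.mul_le_mul_iff_right (rpow_measure_ne_zero hU.measure_ne_zero
    hU.measure_ne_top _) (rpow_measure_ne_top hU.measure_ne_zero hU.measure_ne_top _)).1 h3

variable [m.IsInvInvariant]

lemma measurable_actionAverage_latticeUniform (hΓ : IsLattice Γ)
    (hA : IsIncreasingBoundedFamily T A) {t : ℝ} (ht : t ∈ T) {φ : X → ℝ} (hφ : Measurable φ) :
    Measurable (actionAverage (latticeUniform Γ A t) φ) :=
  have := hΓ.countable
  measurable_actionAverage_uniformOn (hΓ.finite_inter (hA.bounded t ht)) hφ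

/-- `ENNReal.ofReal` takes the positive part: this half of the sandwich controls overshooting only,
and `Thickens.eLpNorm_lower` controls undershooting. The count stays unnormalized because its size
relative to the volume is not yet known. -/
lemma Thickens.eLpNorm_upper (hΓ : IsLattice Γ) (hF : IsFundamentalDomain Γ.op F m)
    (hA : IsIncreasingBoundedFamily T A) {U : Set G}
    {s t₁ : ℝ} (hU : Thickens Γ m T A U s t₁) {t : ℝ} (ht : t ∈ T) (htt : t₁ ≤ t)
    {φ : X → ℝ} (hφ : Measurable φ) (hφ0 : 0 ≤ φ) {r E : ℝ≥0∞}
    (hE : inducedError Γ m F A U μ r φ (t + s) ≤ m U ^ (1 / r).toReal * E) :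
    eLpNorm (fun x => ENNReal.ofReal (latticeCount Γ (A t) *
      actionAverage (latticeUniform Γ A t) φ x - (m (A (t + s))).toReal * ∫ x, φ x ∂μ)) r μ ≤
      ENNReal.ofReal (m (A (t + s))).toReal * E := by
  have hts := hU.add_mem t ht
  refine hU.eLpNorm_le_mul hΓ hF ?_ (fun g hg x => ?_) hE
  · exact (((measurable_actionAverage_latticeUniform hΓ hA ht hφ).const_mul _).sub_const
      _).ennreal_ofReal
  · have := latticeCount_mul_le hΓ (hU.mul_subset t ht htt) (hA.measurableSet _ hts)
      (hA.bounded _ hts) (hA.bounded t ht) hU.measurableSet hU.bounded hU.injects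
      hU.measure_ne_zero hφ hφ0 hg x
    rw [Real.enorm_eq_ofReal_abs, ← ENNReal.ofReal_mul ENNReal.toReal_nonneg]
    refine ENNReal.ofReal_le_ofReal ?_
    calc _ ≤ (m (A (t + s))).toReal * actionAverage (haarUniform m A (t + s))
            (inducedFun Γ m U φ) (inducedMk Γ X (g, x)) - (m (A (t + s))).toReal * ∫ x, φ x ∂μ :=
          sub_le_sub_right this _
      _ = (m (A (t + s))).toReal * (actionAverage (haarUniform m A (t + s))
            (inducedFun Γ m U φ) (inducedMk Γ X (g, x)) - ∫ x, φ x ∂μ) := by ring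
      _ ≤ _ := mul_le_mul_of_nonneg_left (le_abs_self _) ENNReal.toReal_nonneg

lemma Thickens.eLpNorm_lower (hΓ : IsLattice Γ) (hF : IsFundamentalDomain Γ.op F m)
    (hA : IsIncreasingBoundedFamily T A) {U : Set G}
    {s t₁ : ℝ} (hU : Thickens Γ m T A U s t₁) {t : ℝ} (ht : t ∈ T) (hst : s < t)
    (htt : t₁ ≤ t - s) {φ : X → ℝ} (hφ : Measurable φ) (hφ0 : 0 ≤ φ) {r E : ℝ≥0∞}
    (hE : inducedError Γ m F A U μ r φ (t - s) ≤ m U ^ (1 / r).toReal * E) :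
    eLpNorm (fun x => ENNReal.ofReal ((m (A (t - s))).toReal * ∫ x, φ x ∂μ -
      latticeCount Γ (A t) * actionAverage (latticeUniform Γ A t) φ x)) r μ ≤
      ENNReal.ofReal (m (A (t - s))).toReal * E := by
  have hts := hU.sub_mem t ht hst
  refine hU.eLpNorm_le_mul hΓ hF ?_ (fun g hg x => ?_) hE
  · exact (((measurable_actionAverage_latticeUniform hΓ hA ht hφ).const_mul _).const_sub
      _).ennreal_ofReal
  · have hsub := hU.inv_mul_subset (t - s) hts htt
    rw [sub_add_cancel] at hsub
    have := le_latticeCount_mul hΓ hsub (hA.measurableSet _ hts)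
      (hA.bounded _ hts) (hA.bounded t ht) hU.measurableSet hU.bounded hU.injects
      hU.measure_ne_zero hφ hφ0 hg x
    rw [Real.enorm_eq_ofReal_abs, ← ENNReal.ofReal_mul ENNReal.toReal_nonneg]
    refine ENNReal.ofReal_le_ofReal ?_
    calc _ ≤ (m (A (t - s))).toReal * ∫ x, φ x ∂μ - (m (A (t - s))).toReal *
          actionAverage (haarUniform m A (t - s)) (inducedFun Γ m U φ) (inducedMk Γ X (g, x)) :=
          sub_le_sub_left this _
      _ = (m (A (t - s))).toReal * -(actionAverage (haarUniform m A (t - s))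
            (inducedFun Γ m U φ) (inducedMk Γ X (g, x)) - ∫ x, φ x ∂μ) := by ring
      _ ≤ _ := mul_le_mul_of_nonneg_left (neg_le_abs _) ENNReal.toReal_nonneg

lemma latticeCount_mul_actionAverage_one (hΓ : IsLattice Γ) (hA : IsIncreasingBoundedFamily T A)
    {t : ℝ} (ht : t ∈ T) (x : X) :
    latticeCount Γ (A t) * actionAverage (latticeUniform Γ A t) (fun _ : X => (1 : ℝ)) x =
      latticeCount Γ (A t) := by
  have := hΓ.countable
  have hfin := hΓ.finite_inter (hA.bounded t ht)
  have h := ncard_mul_actionAverage_uniformOn hfin (fun _ : X => (1 : ℝ)) x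
  rw [latticeCount, latticeUniform, h, Set.ncard_eq_toFinset_card _ hfin]
  simp

lemma haarUniform_eq_zero {t : ℝ} (h : m (A t) = 0) : haarUniform m A t = 0 := by
  simp [haarUniform, ProbabilityTheory.cond, Measure.restrict_eq_zero.2 h]

/-- Lattice point counts from the mean ergodic theorem on the induced space. -/
lemma Thickens.latticeCount_bounds (hΓ : IsLattice Γ) (hF : IsFundamentalDomain Γ.op F m)
    (hA : IsIncreasingBoundedFamily T A) {U : Set G}
    {s t₁ : ℝ} (hU : Thickens Γ m T A U s t₁) {t : ℝ} (ht : t ∈ T) (hst : s < t)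
    (htt : t₁ ≤ t - s) {r : ℝ≥0∞} (hr : 1 ≤ r) {ζ : ℝ} (hζ0 : 0 ≤ ζ) (hζ1 : ζ < 1)
    (hE : inducedError Γ m F A U μ r (fun _ => 1) (t + s) ≤
      m U ^ (1 / r).toReal * ENNReal.ofReal ζ)
    (hE' : inducedError Γ m F A U μ r (fun _ => 1) (t - s) ≤
      m U ^ (1 / r).toReal * ENNReal.ofReal ζ) :
    latticeCount Γ (A t) ≤ (1 + ζ) * (m (A (t + s))).toReal ∧
      (1 - ζ) * (m (A (t - s))).toReal ≤ latticeCount Γ (A t) ∧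
      0 < (m (A (t - s))).toReal := by
  have hr0 : r ≠ 0 := (zero_lt_one.trans_le hr).ne'
  have hs := hU.nonneg
  -- For φ = 1 the functions under the norms are constant, so the norm bounds become numerical
  -- inequalities for the count.
  have h1 := hU.eLpNorm_upper hΓ hF hA ht (by linarith) (φ := fun _ : X => (1 : ℝ))
    measurable_const (fun _ => zero_le_one) hE
  have h2 := hU.eLpNorm_lower hΓ hF hA ht hst htt (φ := fun _ : X => (1 : ℝ))
    measurable_const (fun _ => zero_le_one) hE'
  simp only [latticeCount_mul_actionAverage_one hΓ hA ht, integral_const, probReal_univ,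
    smul_eq_mul, mul_one] at h1 h2
  rw [eLpNorm_const _ hr0 (IsProbabilityMeasure.ne_zero μ), measure_univ, ENNReal.one_rpow,
    mul_one, enorm_eq_self, ← ENNReal.ofReal_mul ENNReal.toReal_nonneg,
    ENNReal.ofReal_le_ofReal_iff (by positivity)] at h1 h2
  refine ⟨by linarith, by linarith, ?_⟩
  refine ENNReal.toReal_nonneg.lt_of_ne fun h0 => ?_
  -- If A_{t-s} were null, the averaging measure would be 0 and the constant 1 would deviate from
  -- its mean by 1 > ζ.
  have h0' : m (A (t - s)) = 0 := by
    rcases (ENNReal.toReal_eq_zero_iff _).1 h0.symm with h | h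
    · exact h
    · exact absurd h (hA.measure_ne_top (hU.sub_mem t ht hst))
  have h3 := hU.eLpNorm_le_mul hΓ hF (μ := μ) (v := fun _ => 1) (a := 1) (r := r)
    measurable_const (W := fun y => actionAverage (haarUniform m A (t - s))
      (inducedFun Γ m U (fun _ : X => (1 : ℝ))) y - ∫ x, (1 : ℝ) ∂μ) (fun g hg x => ?_) hE'
  · rw [eLpNorm_const _ hr0 (IsProbabilityMeasure.ne_zero μ), measure_univ, ENNReal.one_rpow,
      mul_one, enorm_eq_self, ENNReal.ofReal_one, one_mul, ← ENNReal.ofReal_one,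
      ENNReal.ofReal_le_ofReal_iff hζ0] at h3
    linarith
  · simp [actionAverage, haarUniform_eq_zero h0']

/-- The deviation of the lattice averages is controlled by the deviations on the induced space
and by the lattice point count. -/
lemma Thickens.eLpNorm_sub_le (hΓ : IsLattice Γ) (hF : IsFundamentalDomain Γ.op F m)
    (hA : IsIncreasingBoundedFamily T A) {U : Set G}
    {s t₁ : ℝ} (hU : Thickens Γ m T A U s t₁) {t : ℝ} (ht : t ∈ T) (hst : s < t)
    (htt : t₁ ≤ t - s) {φ : X → ℝ} (hφ : Measurable φ) (hφ0 : 0 ≤ φ) {r E : ℝ≥0∞} (hr : 1 ≤ r)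
    {κ : ℝ} (hκ : 0 ≤ κ) (hN : 0 < latticeCount Γ (A t))
    (hup : (m (A (t + s))).toReal ≤ (1 + κ) * latticeCount Γ (A t))
    (hlow : (1 - κ) * latticeCount Γ (A t) ≤ (m (A (t - s))).toReal)
    (hE : inducedError Γ m F A U μ r φ (t + s) ≤ m U ^ (1 / r).toReal * E)
    (hE' : inducedError Γ m F A U μ r φ (t - s) ≤ m U ^ (1 / r).toReal * E) :
    eLpNorm (fun x => actionAverage (latticeUniform Γ A t) φ x - ∫ x, φ x ∂μ) r μ ≤
      ENNReal.ofReal (1 + κ) * (E + E) + ENNReal.ofReal (κ * ∫ x, φ x ∂μ) := by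
  have hr0 : r ≠ 0 := (zero_lt_one.trans_le hr).ne'
  have hs := hU.nonneg
  have h1 := hU.eLpNorm_upper hΓ hF hA ht (by linarith) hφ hφ0 hE
  have h2 := hU.eLpNorm_lower hΓ hF hA ht hst htt hφ hφ0 hE'
  set N := latticeCount Γ (A t) with hNdef
  set J := ∫ x, φ x ∂μ with hJ
  have hJ0 : 0 ≤ J := integral_nonneg hφ0
  have hmono : (m (A (t - s))).toReal ≤ (m (A (t + s))).toReal :=
    ENNReal.toReal_mono (hA.measure_ne_top (hU.add_mem t ht))
      (measure_mono (hA.mono (hU.sub_mem t ht hst) (hU.add_mem t ht) (by linarith)))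
  set b : X → ℝ := actionAverage (latticeUniform Γ A t) φ with hb
  have hbm : Measurable b := measurable_actionAverage_latticeUniform hΓ hA ht hφ
  set v₁ : X → ℝ≥0∞ := fun x => ENNReal.ofReal (N * b x - (m (A (t + s))).toReal * J) with hv₁
  set v₂ : X → ℝ≥0∞ := fun x => ENNReal.ofReal ((m (A (t - s))).toReal * J - N * b x) with hv₂
  have hv₁m : Measurable v₁ := ((hbm.const_mul _).sub_const _).ennreal_ofReal
  have hv₂m : Measurable v₂ := ((hbm.const_mul _).const_sub _).ennreal_ofReal
  -- With a' and a'' the volumes at t + s and t − s, one has N|b − J| ≤ (Nb − a'J)⁺ + (a''J − Nb)⁺ +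
  -- κNJ, because a' ≤ (1 + κ)N and a'' ≥ (1 − κ)N.
  have hpt : ∀ x, ‖(N • fun x => b x - J) x‖ₑ ≤
      ‖(v₁ + v₂ + (fun _ => ENNReal.ofReal (κ * N * J) : X → ℝ≥0∞)) x‖ₑ := by
    intro x
    simp only [Pi.smul_apply, Pi.add_apply, enorm_eq_self, smul_eq_mul,
      Real.enorm_eq_ofReal_abs, hv₁, hv₂]
    refine (ENNReal.ofReal_le_ofReal (q := max (N * b x - (m (A (t + s))).toReal * J) 0 +
      max ((m (A (t - s))).toReal * J - N * b x) 0 + κ * N * J) ?_).trans ?_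
    · have e1 := le_max_left (N * b x - (m (A (t + s))).toReal * J) 0
      have e2 := le_max_right (N * b x - (m (A (t + s))).toReal * J) 0
      have e3 := le_max_left ((m (A (t - s))).toReal * J - N * b x) 0
      have e4 := le_max_right ((m (A (t - s))).toReal * J - N * b x) 0
      have e5 := mul_le_mul_of_nonneg_right hup hJ0
      have e6 := mul_le_mul_of_nonneg_right hlow hJ0
      rw [abs_le]
      constructor <;> nlinarith
    · rw [ENNReal.ofReal_add (by positivity) (by positivity),
        ENNReal.ofReal_add (by positivity) (by positivity)]
      simp [ENNReal.ofReal_max]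
  have h3 : ENNReal.ofReal N * eLpNorm (fun x => b x - J) r μ ≤
      ENNReal.ofReal N * (ENNReal.ofReal (1 + κ) * (E + E) + ENNReal.ofReal (κ * J)) := by
    calc ENNReal.ofReal N * eLpNorm (fun x => b x - J) r μ
        = eLpNorm (N • fun x => b x - J) r μ := by
          rw [eLpNorm_const_smul, Real.enorm_of_nonneg hN.le]
      _ ≤ eLpNorm (v₁ + v₂ + (fun _ => ENNReal.ofReal (κ * N * J) : X → ℝ≥0∞)) r μ := eLpNorm_mono_enorm hpt
      _ ≤ eLpNorm v₁ r μ + eLpNorm v₂ r μ +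
          eLpNorm (fun _ : X => ENNReal.ofReal (κ * N * J)) r μ := by
        refine (eLpNorm_add_le (hv₁m.add hv₂m).aestronglyMeasurable
          aestronglyMeasurable_const hr).trans ?_
        gcongr
        exact eLpNorm_add_le hv₁m.aestronglyMeasurable hv₂m.aestronglyMeasurable hr
      _ ≤ ENNReal.ofReal ((1 + κ) * N) * E + ENNReal.ofReal ((1 + κ) * N) * E +
          ENNReal.ofReal (κ * N * J) := by
        gcongr
        · exact h1.trans (by gcongr)
        · exact h2.trans (by gcongr; exact hmono.trans hup)
        · rw [eLpNorm_const _ hr0 (IsProbabilityMeasure.ne_zero μ), measure_univ,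
            ENNReal.one_rpow, mul_one, enorm_eq_self]
      _ = _ := by
        rw [ENNReal.ofReal_mul (by positivity), show κ * N * J = N * (κ * J) by ring,
          ENNReal.ofReal_mul hN.le]
        ring
  exact (ENNReal.mul_le_mul_iff_right (by simpa using hN) ENNReal.ofReal_ne_top).1 h3

/-- Here a' and a'' stand for the volumes at t + s and t − s, δ for the growth over one step and ζ
for the error in the count. All ratios are 1 + O(δ + ζ); the constant 4 absorbs the quadratic terms
because δ, ζ ≤ 1/8. -/
lemma ratio_bounds {N a' a'' δ ζ : ℝ} (hδ0 : 0 ≤ δ) (hδ : δ ≤ 1 / 8) (hζ0 : 0 ≤ ζ)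
    (hζ : ζ ≤ 1 / 8) (h1 : N ≤ (1 + ζ) * a') (h2 : (1 - ζ) * a'' ≤ N) (h3 : 0 < a'')
    (h4 : a' ≤ (1 + δ) * ((1 + δ) * a'')) :
    0 < N ∧ a' ≤ (1 + 4 * (δ + ζ)) * N ∧ (1 - 4 * (δ + ζ)) * N ≤ a'' := by
  have hpos : 0 < N := by nlinarith
  have hδδ : (1 + δ) * (1 + δ) ≤ 1 + 3 * δ := by nlinarith
  refine ⟨hpos, ?_, ?_⟩
  · have e1 : (1 + δ) * ((1 + δ) * a'') ≤ (1 + 3 * δ) * a'' := by nlinarith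
    have e2 : (1 + 3 * δ) ≤ (1 + 4 * (δ + ζ)) * (1 - ζ) := by nlinarith
    calc a' ≤ (1 + 3 * δ) * a'' := h4.trans e1
      _ ≤ (1 + 4 * (δ + ζ)) * (1 - ζ) * a'' := by gcongr
      _ = (1 + 4 * (δ + ζ)) * ((1 - ζ) * a'') := by ring
      _ ≤ _ := by gcongr
  · have e1 : (1 + δ) * ((1 + δ) * a'') ≤ (1 + 3 * δ) * a'' := by nlinarith
    have e3 : N ≤ (1 + ζ) * ((1 + 3 * δ) * a'') := h1.trans (by gcongr; exact h4.trans e1)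
    have e4 : (1 + ζ) * (1 + 3 * δ) ≤ 1 + 4 * (δ + ζ) := by nlinarith
    have e5 : N ≤ (1 + 4 * (δ + ζ)) * a'' := by
      calc N ≤ (1 + ζ) * (1 + 3 * δ) * a'' := by rw [mul_assoc]; exact e3
        _ ≤ _ := by gcongr
    have e6 : (1 - 4 * (δ + ζ)) * (1 + 4 * (δ + ζ)) ≤ 1 := by nlinarith [sq_nonneg (δ + ζ)]
    rcases le_or_gt (1 - 4 * (δ + ζ)) 0 with h | h
    · nlinarith
    · calc (1 - 4 * (δ + ζ)) * N ≤ (1 - 4 * (δ + ζ)) * ((1 + 4 * (δ + ζ)) * a'') := by gcongr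
        _ = (1 - 4 * (δ + ζ)) * (1 + 4 * (δ + ζ)) * a'' := by ring
        _ ≤ 1 * a'' := by gcongr
        _ = a'' := one_mul _

/-- The combined estimate: counting and deviation. -/
lemma Thickens.eLpNorm_sub_le_of_inducedError (hΓ : IsLattice Γ)
    (hF : IsFundamentalDomain Γ.op F m) (hA : IsIncreasingBoundedFamily T A) {U : Set G}
    {s t₁ : ℝ} (hU : Thickens Γ m T A U s t₁) {δ : ℝ} (hδ0 : 0 ≤ δ) (hδ : δ ≤ 1 / 8)
    (hgrow : ∀ t ∈ T, t₁ ≤ t → (m (A (t + s))).toReal ≤ (1 + δ) * (m (A t)).toReal)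
    {t : ℝ} (ht : t ∈ T) (hst : s < t) (htt : t₁ ≤ t - s) {r E : ℝ≥0∞} (hr : 1 ≤ r) {ζ : ℝ}
    (hζ0 : 0 ≤ ζ) (hζ : ζ ≤ 1 / 8)
    (hE₁ : inducedError Γ m F A U μ r (fun _ => 1) (t + s) ≤
      m U ^ (1 / r).toReal * ENNReal.ofReal ζ)
    (hE₁' : inducedError Γ m F A U μ r (fun _ => 1) (t - s) ≤
      m U ^ (1 / r).toReal * ENNReal.ofReal ζ) {φ : X → ℝ} (hφ : Measurable φ) (hφ0 : 0 ≤ φ)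
    (hE : inducedError Γ m F A U μ r φ (t + s) ≤ m U ^ (1 / r).toReal * E)
    (hE' : inducedError Γ m F A U μ r φ (t - s) ≤ m U ^ (1 / r).toReal * E) :
    eLpNorm (fun x => actionAverage (latticeUniform Γ A t) φ x - ∫ x, φ x ∂μ) r μ ≤
      4 * E + ENNReal.ofReal (4 * (δ + ζ) * ∫ x, φ x ∂μ) := by
  have hs := hU.nonneg
  obtain ⟨h1, h2, h3⟩ := hU.latticeCount_bounds hΓ hF hA ht hst htt hr hζ0 (by linarith) hE₁ hE₁'
  have h4 : (m (A (t + s))).toReal ≤ (1 + δ) * ((1 + δ) * (m (A (t - s))).toReal) := by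
    refine (hgrow t ht (by linarith)).trans ?_
    gcongr
    have := hgrow (t - s) (hU.sub_mem t ht hst) htt
    rwa [sub_add_cancel] at this
  obtain ⟨h5, h6, h7⟩ := ratio_bounds hδ0 hδ hζ0 hζ h1 h2 h3 h4
  refine (hU.eLpNorm_sub_le hΓ hF hA ht hst htt hφ hφ0 hr (κ := 4 * (δ + ζ)) (by positivity) h5
    h6 h7 hE hE').trans ?_
  refine add_le_add ?_ le_rfl
  calc ENNReal.ofReal (1 + 4 * (δ + ζ)) * (E + E) ≤ ENNReal.ofReal 2 * (E + E) := by
        gcongr; linarith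
    _ = 4 * E := by
        rw [← two_mul, ← mul_assoc]; norm_num

end Transfer

/-! ### Reduction to nonnegative functions -/

section Decomposition

variable {Λ Z : Type*} [Group Λ] [MeasurableSpace Λ] [MeasurableSingletonClass Λ] [Countable Λ]
  [MulAction Λ Z] [MeasurableSpace Z] [MeasurableConstSMul Λ Z] {η : Measure Z}
  [IsProbabilityMeasure η] [SMulInvariantMeasure Λ Z η]

/-- The two functions are the positive and negative parts of a measurable version of f. One
exceptional null set serves all finite S, hence all times at once. -/
lemma exists_nonneg_decomposition {p : ℝ≥0∞} (hp : 1 ≤ p) {f : Z → ℝ} (hf : MemLp f p η) :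
    ∃ φ ψ : Z → ℝ, Measurable φ ∧ Measurable ψ ∧ 0 ≤ φ ∧ 0 ≤ ψ ∧ MemLp φ p η ∧ MemLp ψ p η ∧
      eLpNorm φ p η ≤ eLpNorm f p η ∧ eLpNorm ψ p η ≤ eLpNorm f p η ∧
      ∫ z, f z ∂η = ∫ z, φ z ∂η - ∫ z, ψ z ∂η ∧
      ∀ᵐ z ∂η, ∀ S : Set Λ, S.Finite → actionAverage (uniformOn S) f z =
        actionAverage (uniformOn S) φ z - actionAverage (uniformOn S) ψ z := by
  set g := hf.1.mk f with hg
  have hgm : Measurable g := hf.1.stronglyMeasurable_mk.measurable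
  have hfg : f =ᵐ[η] g := hf.1.ae_eq_mk
  have hgp : MemLp g p η := hf.ae_eq hfg
  have hdec : ∀ z, g z = max (g z) 0 - max (-g z) 0 := fun z => (max_zero_sub_max_neg_zero_eq_self _).symm
  have hle : ∀ h : Z → ℝ, (∀ z, |h z| ≤ |g z|) → eLpNorm h p η ≤ eLpNorm f p η := fun h hh => by
    rw [eLpNorm_congr_ae hfg]
    exact eLpNorm_mono hh
  have h1 : ∀ z, |max (g z) 0| ≤ |g z| := fun z => by
    rw [abs_of_nonneg (le_max_right _ _)]
    exact max_le (le_abs_self _) (abs_nonneg _)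
  have h2 : ∀ z, |max (-g z) 0| ≤ |g z| := fun z => by
    rw [abs_of_nonneg (le_max_right _ _)]
    exact max_le (neg_le_abs _) (abs_nonneg _)
  have hφm : Measurable fun z => max (g z) 0 := hgm.max measurable_const
  have hψm : Measurable fun z => max (-g z) 0 := hgm.neg.max measurable_const
  have hφp : MemLp (fun z => max (g z) 0) p η :=
    ⟨hφm.aestronglyMeasurable, (hle _ h1).trans_lt hf.2⟩
  have hψp : MemLp (fun z => max (-g z) 0) p η :=
    ⟨hψm.aestronglyMeasurable, (hle _ h2).trans_lt hf.2⟩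
  refine ⟨fun z => max (g z) 0, fun z => max (-g z) 0, hφm, hψm, fun z => le_max_right _ _,
    fun z => le_max_right _ _, hφp, hψp, hle _ h1, hle _ h2, ?_, ?_⟩
  · rw [integral_congr_ae hfg, ← integral_sub (hφp.integrable hp) (hψp.integrable hp)]
    exact integral_congr_ae (ae_of_all _ hdec)
  · filter_upwards [ae_forall_smul_eq (Λ := Λ) hfg] with z hz S hS
    rw [actionAverage_uniformOn hS, actionAverage_uniformOn hS, actionAverage_uniformOn hS,
      ← mul_sub, ← Finset.sum_sub_distrib]
    congr 1
    exact Finset.sum_congr rfl fun γ _ => (hz γ).trans (hdec _)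

lemma eLpNorm_actionAverage_le {S : Set Λ} (hS : S.Finite) {r : ℝ≥0∞} (hr : 1 ≤ r) {f : Z → ℝ}
    (hf : AEStronglyMeasurable f η) :
    eLpNorm (actionAverage (uniformOn S) f) r η ≤ eLpNorm f r η := by
  have h1 : actionAverage (uniformOn S) f =
      (S.ncard : ℝ)⁻¹ • ∑ γ ∈ hS.toFinset, f ∘ (γ⁻¹ • ·) := by
    funext z
    simp [actionAverage_uniformOn hS]
  have h2 : eLpNorm (∑ γ ∈ hS.toFinset, f ∘ ((γ⁻¹ • ·) : Z → Z)) r η ≤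
      S.ncard * eLpNorm f r η := by
    refine (eLpNorm_sum_le (fun γ _ => hf.comp_measurePreserving
      (measurePreserving_smul γ⁻¹ η)) hr).trans ?_
    rw [Finset.sum_congr rfl fun γ _ => eLpNorm_comp_measurePreserving hf
      (measurePreserving_smul γ⁻¹ η), Finset.sum_const, nsmul_eq_mul,
      Set.ncard_eq_toFinset_card _ hS]
  rw [h1, eLpNorm_const_smul]
  rcases Nat.eq_zero_or_pos S.ncard with h0 | h0
  · simp [h0]
  · calc _ ≤ ‖(S.ncard : ℝ)⁻¹‖ₑ * (S.ncard * eLpNorm f r η) := by gcongr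
      _ = eLpNorm f r η := by
        have hpos : (0 : ℝ) < S.ncard := by exact_mod_cast h0
        rw [Real.enorm_of_nonneg (by positivity), ENNReal.ofReal_inv_of_pos hpos,
          ENNReal.ofReal_natCast, ← mul_assoc, ENNReal.inv_mul_cancel (by simp; omega) (by simp),
          one_mul]

end Decomposition

/-! ### The mean and pointwise ergodic theorems -/

section Ergodic

variable {G : Type*} [Group G] [TopologicalSpace G] [IsTopologicalGroup G] [T2Space G]
  [LocallyCompactSpace G] [SecondCountableTopology G] [MeasurableSpace G] [BorelSpace G]
  {Γ : Subgroup G} {m : Measure G} [m.IsHaarMeasure] {T : Set ℝ} {A : ℝ → Set G}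
  {X : Type*} [MulAction Γ X] [MeasurableSpace X] [MeasurableConstSMul Γ X]
  {μ : Measure X} [IsProbabilityMeasure μ] [SMulInvariantMeasure Γ X μ] {F : Set G}

/-- Deviations of a function are bounded by those of the two parts of a decomposition. -/
lemma eLpNorm_actionAverage_sub_le (hΓ : IsLattice Γ) (hA : IsIncreasingBoundedFamily T A)
    {t : ℝ} (ht : t ∈ T) {f φ ψ : X → ℝ} (hφ : Measurable φ) (hψ : Measurable ψ)
    (hint : ∫ x, f x ∂μ = ∫ x, φ x ∂μ - ∫ x, ψ x ∂μ)
    (hdec : ∀ᵐ z ∂μ, ∀ S : Set Γ, S.Finite → actionAverage (uniformOn S) f z =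
        actionAverage (uniformOn S) φ z - actionAverage (uniformOn S) ψ z)
    {r : ℝ≥0∞} (hr : 1 ≤ r) :
    eLpNorm (fun x => actionAverage (latticeUniform Γ A t) f x - ∫ x, f x ∂μ) r μ ≤
      eLpNorm (fun x => actionAverage (latticeUniform Γ A t) φ x - ∫ x, φ x ∂μ) r μ +
      eLpNorm (fun x => actionAverage (latticeUniform Γ A t) ψ x - ∫ x, ψ x ∂μ) r μ := by
  have := hΓ.countable
  have hfin := hΓ.finite_inter (hA.bounded t ht)
  have hm : ∀ h : X → ℝ, Measurable h → AEStronglyMeasurable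
      (fun x => actionAverage (latticeUniform Γ A t) h x - ∫ x, h x ∂μ) μ := fun h hh =>
    ((measurable_actionAverage_uniformOn hfin hh).sub_const _).aestronglyMeasurable
  refine le_trans (le_of_eq ?_) (eLpNorm_sub_le (hm φ hφ) (hm ψ hψ) hr)
  refine eLpNorm_congr_ae ?_
  filter_upwards [hdec] with z hz
  simp only [latticeUniform, Pi.sub_apply, hz _ hfin, hint]
  ring

variable [m.IsMulRightInvariant] [m.IsInvInvariant]

lemma Thickens.eventually_inducedError_le (hΓ : IsLattice Γ)
    (hF : IsFundamentalDomain Γ.op F m) {U : Set G} {s t₁ : ℝ}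
    (hU : Thickens Γ m T A U s t₁) {p : ℝ≥0∞}
    (hβ : MeanErgodicTheorem T (haarUniform m A) p (inducedMeasure Γ X m F μ))
    {φ : X → ℝ} (hφ : Measurable φ) (hφ0 : 0 ≤ φ) (hφp : MemLp φ p μ) {c : ℝ} (hc : 0 < c) :
    ∃ a : ℝ, ∀ t ∈ T, a ≤ t →
      inducedError Γ m F A U μ p φ t ≤ m U ^ (1 / p).toReal * ENNReal.ofReal c := by
  have := hΓ.countable
  have hpos : 0 < m U ^ (1 / p).toReal * ENNReal.ofReal c :=
    ENNReal.mul_pos (rpow_measure_ne_zero hU.measure_ne_zero hU.measure_ne_top _)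
      (by simpa using hc)
  have h1 := hβ _ (memLp_inducedFun hF hU.measurableSet hU.injects hU.measure_ne_zero
    hU.measure_ne_top hφ hφ0 hφp)
  rw [integral_inducedFun hF hU.measurableSet hU.injects hU.measure_ne_zero
    hU.measure_ne_top hφ hφ0] at h1
  have h2 := ENNReal.tendsto_nhds_zero.1 h1 _ hpos
  rw [eventually_inf_principal, eventually_atTop] at h2
  obtain ⟨a, ha⟩ := h2
  exact ⟨a, fun t ht hat => ha t hat ht⟩

/-- The mean ergodic theorem for the lattice averages. -/
theorem HasThickenings.meanErgodicTheorem (h : HasThickenings Γ m T A) (hΓ : IsLattice Γ)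
    (hF : IsFundamentalDomain Γ.op F m) (hA : IsIncreasingBoundedFamily T A)
    {p : ℝ≥0∞} (hp : 1 ≤ p)
    (hβ : MeanErgodicTheorem T (haarUniform m A) p (inducedMeasure Γ X m F μ)) :
    MeanErgodicTheorem T (latticeUniform Γ A) p μ := by
  have := hΓ.countable
  have key : ∀ φ : X → ℝ, Measurable φ → 0 ≤ φ → MemLp φ p μ → Tendsto (fun t => eLpNorm
      (fun x => actionAverage (latticeUniform Γ A t) φ x - ∫ w, φ w ∂μ) p μ)
      (atTop ⊓ 𝓟 T) (𝓝 0) := by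
    intro φ hφ hφ0 hφp
    refine ENNReal.tendsto_nhds_zero.2 fun ε hε => ?_
    set J := ∫ x, φ x ∂μ with hJ
    have hJ0 : 0 ≤ J := integral_nonneg hφ0
    have hε1 : min ε 1 ≠ ∞ := ((min_le_right _ _).trans_lt ENNReal.one_lt_top).ne
    have hepos : 0 < (min ε 1).toReal :=
      ENNReal.toReal_pos (lt_min hε zero_lt_one).ne' hε1
    set e := (min ε 1).toReal with he
    have hee : ENNReal.ofReal e ≤ ε := by
      rw [he, ENNReal.ofReal_toReal hε1]; exact min_le_left _ _
    -- z plays the role of both δ and ζ: then 4(δ + ζ)J = 8zJ ≤ e/2, and the deviation E = e/8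
    -- contributes the other e/2.
    set z : ℝ := min (1 / 8) (e / (16 * (J + 1))) with hz
    have hz0 : 0 < z := lt_min (by norm_num) (by positivity)
    have hz1 : z ≤ 1 / 8 := min_le_left _ _
    have hzJ : 8 * z * J ≤ e / 2 := by
      have : z ≤ e / (16 * (J + 1)) := min_le_right _ _
      rw [le_div_iff₀ (by positivity)] at this
      nlinarith
    obtain ⟨U, s, t₁, hU, hgrow⟩ := h z hz0
    obtain ⟨a, ha⟩ := hU.eventually_inducedError_le hΓ hF hβ hφ hφ0 hφp
      (show 0 < e / 8 by positivity)
    obtain ⟨a', ha'⟩ := hU.eventually_inducedError_le hΓ hF hβ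
      (φ := fun _ : X => (1 : ℝ)) measurable_const (fun _ => zero_le_one)
      (memLp_const _) hz0
    rw [eventually_inf_principal]
    filter_upwards [eventually_ge_atTop (max (max a a') t₁ + s), eventually_gt_atTop s]
      with t ht1 ht2 ht
    have hs := hU.nonneg
    have e1 := (le_max_left _ _).trans (le_max_left (max a a') t₁)
    have e2 := (le_max_right _ _).trans (le_max_left (max a a') t₁)
    have e3 := le_max_right (max a a') t₁
    refine (hU.eLpNorm_sub_le_of_inducedError hΓ hF hA hz0.le hz1 hgrow ht ht2 (by linarith) hp
      hz0.le hz1 (ha' _ (hU.add_mem t ht) (by linarith))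
      (ha' _ (hU.sub_mem t ht ht2) (by linarith)) hφ hφ0 (ha _ (hU.add_mem t ht) (by linarith))
      (ha _ (hU.sub_mem t ht ht2) (by linarith))).trans (le_trans ?_ hee)
    rw [show (4 : ℝ≥0∞) = ENNReal.ofReal 4 by norm_num, ← ENNReal.ofReal_mul (by norm_num),
      ← ENNReal.ofReal_add (by positivity) (by positivity)]
    refine ENNReal.ofReal_le_ofReal ?_
    linarith
  intro f hf
  obtain ⟨φ, ψ, hφ, hψ, hφ0, hψ0, hφp, hψp, -, -, hint, hdec⟩ :=
    exists_nonneg_decomposition (Λ := Γ) hp hf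
  have h2 := (key φ hφ hφ0 hφp).add (key ψ hψ hψ0 hψp)
  rw [add_zero] at h2
  refine tendsto_of_tendsto_of_tendsto_of_le_of_le' tendsto_const_nhds h2
    (Eventually.of_forall fun _ => zero_le) ?_
  rw [eventually_inf_principal]
  exact Eventually.of_forall fun t ht =>
    eLpNorm_actionAverage_sub_le hΓ hA ht hφ hψ hint hdec hp

/-- The exceptional set in Y is null for the image of m|_U ⊗ μ, so by Fubini some g ∈ U is good for
almost every x. -/
lemma Thickens.exists_tendsto (hΓ : IsLattice Γ)
    (hF : IsFundamentalDomain Γ.op F m) {U : Set G} {s t₁ : ℝ}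
    (hU : Thickens Γ m T A U s t₁) {p : ℝ≥0∞}
    (hβ : PointwiseErgodicTheorem T (haarUniform m A) p (inducedMeasure Γ X m F μ))
    {φ : X → ℝ} (hφ : Measurable φ) (hφ0 : 0 ≤ φ) (hφp : MemLp φ p μ) :
    ∀ᵐ x ∂μ, ∃ g ∈ U, Tendsto (fun t => actionAverage (haarUniform m A t)
      (inducedFun Γ m U φ) (inducedMk Γ X (g, x))) (atTop ⊓ 𝓟 T) (𝓝 (∫ x, φ x ∂μ)) := by
  have := hΓ.countable
  have h1 := hβ _ (memLp_inducedFun hF hU.measurableSet hU.injects hU.measure_ne_zero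
    hU.measure_ne_top hφ hφ0 hφp)
  rw [integral_inducedFun hF hU.measurableSet hU.injects hU.measure_ne_zero
    hU.measure_ne_top hφ hφ0] at h1
  have h2 := ae_of_ae_map measurable_inducedMk.aemeasurable
    (h1.filter_mono (ae_mono (map_inducedMk_le hF hU.measurableSet hU.injects)))
  have h3 := (Measure.ae_ae_of_ae_prod h2).and (ae_restrict_mem hU.measurableSet)
  have : NeBot (ae (m.restrict U)) := by
    rw [ae_neBot]
    simpa using hU.measure_ne_zero
  obtain ⟨g, hg, hgU⟩ := h3.exists
  exact hg.mono fun x hx => ⟨g, hgU, hx⟩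

/-- Convergence on the induced space controls the oscillation of the lattice averages. -/
lemma Thickens.eventually_abs_sub_le (hΓ : IsLattice Γ)
    (hA : IsIncreasingBoundedFamily T A) {U : Set G}
    {s t₁ : ℝ} (hU : Thickens Γ m T A U s t₁) {δ : ℝ} (hδ0 : 0 < δ) (hδ : δ ≤ 1 / 8)
    (hgrow : ∀ t ∈ T, t₁ ≤ t → (m (A (t + s))).toReal ≤ (1 + δ) * (m (A t)).toReal)
    {φ : X → ℝ} (hφ : Measurable φ) (hφ0 : 0 ≤ φ) {J : ℝ} (hJ0 : 0 ≤ J) {x : X}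
    {g g' : G} (hg : g ∈ U) (hg' : g' ∈ U)
    (hlim : Tendsto (fun t => actionAverage (haarUniform m A t)
      (inducedFun Γ m U φ) (inducedMk Γ X (g, x))) (atTop ⊓ 𝓟 T) (𝓝 J))
    (hlim' : Tendsto (fun t => actionAverage (haarUniform m A t)
      (inducedFun Γ m U fun _ => 1) (inducedMk Γ X (g', x))) (atTop ⊓ 𝓟 T) (𝓝 1)) :
    ∀ᶠ t in atTop ⊓ 𝓟 T,
      |actionAverage (latticeUniform Γ A t) φ x - J| ≤ δ * (8 * J + 2) := by
  have hev := (Metric.tendsto_nhds.1 hlim δ hδ0).and (Metric.tendsto_nhds.1 hlim' δ hδ0)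
  rw [eventually_inf_principal, eventually_atTop] at hev
  obtain ⟨a, ha⟩ := hev
  rw [eventually_inf_principal]
  filter_upwards [eventually_ge_atTop (max a t₁ + s), eventually_gt_atTop s] with t ht1 ht2 ht
  have hs := hU.nonneg
  have e1 := le_max_left a t₁
  have e2 := le_max_right a t₁
  have hadd := hU.add_mem t ht
  have hsub := hU.sub_mem t ht ht2
  obtain ⟨u1, u2⟩ := ha (t + s) (by linarith) hadd
  obtain ⟨l1, l2⟩ := ha (t - s) (by linarith) hsub
  have hsubset := hU.inv_mul_subset (t - s) hsub (by linarith)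
  rw [sub_add_cancel] at hsubset
  have up : ∀ {ξ : X → ℝ}, Measurable ξ → 0 ≤ ξ → ∀ {h : G}, h ∈ U → _ := fun {ξ} hξ hξ0 {h} hh =>
    latticeCount_mul_le hΓ (hU.mul_subset t ht (by linarith)) (hA.measurableSet _ hadd)
      (hA.bounded _ hadd) (hA.bounded t ht) hU.measurableSet hU.bounded hU.injects
      hU.measure_ne_zero hξ hξ0 hh x
  have low : ∀ {ξ : X → ℝ}, Measurable ξ → 0 ≤ ξ → ∀ {h : G}, h ∈ U → _ :=
    fun {ξ} hξ hξ0 {h} hh => le_latticeCount_mul hΓ hsubset (hA.measurableSet _ hsub)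
      (hA.bounded _ hsub) (hA.bounded t ht) hU.measurableSet hU.bounded hU.injects
      hU.measure_ne_zero hξ hξ0 hh x
  have v1 := up hφ hφ0 hg
  -- The constant 1 turns the sandwich into bounds for the lattice count, which does not depend on
  -- the base point; hence g' may differ from g.
  have v2 := up (ξ := fun _ => 1) measurable_const (fun _ => zero_le_one) hg'
  have w1 := low hφ hφ0 hg
  have w2 := low (ξ := fun _ => 1) measurable_const (fun _ => zero_le_one) hg'
  have hone := latticeCount_mul_actionAverage_one hΓ hA ht x
  rw [latticeUniform] at hone
  rw [hone] at v2 w2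
  rw [Real.dist_eq, abs_lt] at u1 u2 l1 l2
  unfold haarUniform at u1 u2 l1 l2
  set a' := (m (A (t + s))).toReal with ha'
  set a'' := (m (A (t - s))).toReal with ha''
  set N := latticeCount Γ (A t) with hN
  have ha'0 : 0 ≤ a' := ENNReal.toReal_nonneg
  have ha''0 : 0 < a'' := by
    refine ENNReal.toReal_nonneg.lt_of_ne fun h0 => ?_
    have h0' : m (A (t - s)) = 0 := by
      rcases (ENNReal.toReal_eq_zero_iff _).1 h0.symm with h | h
      · exact h
      · exact absurd h (hA.measure_ne_top hsub)
    have h1 := haarUniform_eq_zero (A := A) h0'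
    rw [haarUniform] at h1
    rw [h1] at l2
    simp only [actionAverage, integral_zero_measure] at l2
    linarith [l2.1]
  have hgr : a' ≤ (1 + δ) * ((1 + δ) * a'') := by
    refine (hgrow t ht (by linarith)).trans ?_
    gcongr
    have := hgrow (t - s) hsub (by linarith)
    rwa [sub_add_cancel] at this
  obtain ⟨r1, r2, r3⟩ := ratio_bounds hδ0.le hδ hδ0.le hδ (N := N) (a' := a') (a'' := a'')
    (v2.trans (by rw [mul_comm]; gcongr; linarith [u2.2]))
    (le_trans (by rw [mul_comm]; gcongr; linarith [l2.1]) w2) ha''0 hgr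
  have hb0 : 0 ≤ actionAverage (latticeUniform Γ A t) φ x := actionAverage_nonneg _ hφ0 x
  rw [latticeUniform] at hb0 ⊢
  set b := actionAverage (uniformOn {γ : Γ | (γ : G) ∈ A t}) φ x with hb
  -- With ζ = δ the ratios are 1 ± 8δ, and since 8δ ≤ 1 the product is at most J + δ(8J + 2).
  have h1 : b ≤ (1 + 8 * δ) * (J + δ) := by
    have : N * b ≤ N * ((1 + 8 * δ) * (J + δ)) := by
      calc N * b ≤ a' * (J + δ) := v1.trans (by gcongr; linarith [u1.2])
        _ ≤ (1 + 4 * (δ + δ)) * N * (J + δ) := by gcongr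
        _ = _ := by ring
    exact le_of_mul_le_mul_left this r1
  have h2 : J - δ * (8 * J + 2) ≤ b := by
    rcases le_or_gt (J - δ) 0 with h | h
    · nlinarith
    · have : N * ((1 - 8 * δ) * (J - δ)) ≤ N * b := by
        calc N * ((1 - 8 * δ) * (J - δ)) = (1 - 4 * (δ + δ)) * N * (J - δ) := by ring
          _ ≤ a'' * (J - δ) := by gcongr
          _ ≤ N * b := le_trans (by gcongr; linarith [l1.1]) w1
      have := le_of_mul_le_mul_left this r1
      nlinarith
  rw [abs_le]
  constructor <;> nlinarith

/-- The pointwise ergodic theorem for the lattice averages. -/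
theorem HasThickenings.pointwiseErgodicTheorem (h : HasThickenings Γ m T A) (hΓ : IsLattice Γ)
    (hF : IsFundamentalDomain Γ.op F m) (hA : IsIncreasingBoundedFamily T A)
    {p : ℝ≥0∞} (hp : 1 ≤ p)
    (hβ : PointwiseErgodicTheorem T (haarUniform m A) p (inducedMeasure Γ X m F μ)) :
    PointwiseErgodicTheorem T (latticeUniform Γ A) p μ := by
  have := hΓ.countable
  have key : ∀ φ : X → ℝ, Measurable φ → 0 ≤ φ → MemLp φ p μ → ∀ᵐ x ∂μ, Tendsto
      (fun t => actionAverage (latticeUniform Γ A t) φ x) (atTop ⊓ 𝓟 T) (𝓝 (∫ w, φ w ∂μ)) := by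
    intro φ hφ hφ0 hφp
    have hJ0 : 0 ≤ ∫ x, φ x ∂μ := integral_nonneg hφ0
    -- Countably many accuracies, the first being 1/8, so that one null set works for all of them.
    choose U s t₁ hU hgrow using fun k : ℕ => h (1 / ((k : ℝ) + 8)) (by positivity)
    have h1 := ae_all_iff.2 fun k => (hU k).exists_tendsto hΓ hF hβ hφ hφ0 hφp
    have h2 := ae_all_iff.2 fun k => (hU k).exists_tendsto hΓ hF hβ (φ := fun _ : X => (1 : ℝ))
      measurable_const (fun _ => zero_le_one) (memLp_const _)
    filter_upwards [h1, h2] with x hx1 hx2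
    rw [Metric.tendsto_nhds]
    intro e he
    obtain ⟨k, hk⟩ := exists_nat_gt ((8 * (∫ x, φ x ∂μ) + 2) / e)
    obtain ⟨g, hg, hlim⟩ := hx1 k
    obtain ⟨g', hg', hlim'⟩ := hx2 k
    rw [integral_const, probReal_univ, smul_eq_mul, mul_one] at hlim'
    refine ((hU k).eventually_abs_sub_le hΓ hA (by positivity) ?_ (hgrow k) hφ hφ0 hJ0 hg hg'
      hlim hlim').mono fun t ht => ?_
    · exact one_div_le_one_div_of_le (by norm_num) (by linarith [(Nat.cast_nonneg k : (0:ℝ) ≤ k)])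
    · rw [Real.dist_eq]
      refine ht.trans_lt ?_
      rw [div_lt_iff₀ he] at hk
      rw [one_div, inv_mul_lt_iff₀ (by positivity)]
      linarith
  intro f hf
  obtain ⟨φ, ψ, hφ, hψ, hφ0, hψ0, hφp, hψp, -, -, hint, hdec⟩ :=
    exists_nonneg_decomposition (Λ := Γ) hp hf
  filter_upwards [key φ hφ hφ0 hφp, key ψ hψ hψ0 hψp, hdec] with x h1 h2 h3
  rw [hint]
  refine (h1.sub h2).congr' ?_
  rw [EventuallyEq, eventually_inf_principal]
  exact Eventually.of_forall fun t ht => (h3 _ (hΓ.finite_inter (hA.bounded t ht))).symm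

end Ergodic

/-! ### The exponential mean ergodic theorem -/

section ExpMean

variable {G : Type*} [Group G] [TopologicalSpace G] [IsTopologicalGroup G] [T2Space G]
  [LocallyCompactSpace G] [SecondCountableTopology G] [MeasurableSpace G] [BorelSpace G]
  {Γ : Subgroup G} {m : Measure G} [m.IsHaarMeasure] {T : Set ℝ} {A : ℝ → Set G}
  {X : Type*} [MulAction Γ X] [MeasurableSpace X] [MeasurableConstSMul Γ X]
  {μ : Measure X} [IsProbabilityMeasure μ] [SMulInvariantMeasure Γ X μ] {F : Set G}
  [m.IsMulRightInvariant]

/-- The periodization of 1_U is at most 1 and integrates to m(U), while ν has total mass 1. -/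
lemma InjectsModulo.measure_le_one (hΓ : IsLattice Γ) (hF : IsFundamentalDomain Γ.op F m)
    (hmF : m F = 1) {U : Set G} (hUm : MeasurableSet U) (hU : InjectsModulo Γ U)
    (hU0 : m U ≠ 0) (μ : Measure X) [IsProbabilityMeasure μ] [SMulInvariantMeasure Γ X μ] :
    m U ≤ 1 := by
  have := hΓ.countable
  have h1 := lintegral_periodize (μ := μ) hF hUm hU hU0 (v := fun _ => 1) measurable_const
  have h2 : inducedMeasure Γ X m F μ univ = 1 := by
    rw [inducedMeasure, Measure.map_apply measurable_inducedMk MeasurableSet.univ, preimage_univ,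
      ← univ_prod_univ, Measure.prod_prod, Measure.restrict_apply_univ, hmF, measure_univ, one_mul]
  calc m U = ∫⁻ y, periodize Γ U (fun _ : X => 1) y ∂(inducedMeasure Γ X m F μ) := by
        rw [h1]; simp
    _ ≤ ∫⁻ _, 1 ∂(inducedMeasure Γ X m F μ) :=
        lintegral_mono (periodize_le hU (v := fun _ => 1) (W := fun _ => 1) fun _ _ _ => le_rfl)
    _ = 1 := by simp [h2]

/-- One factor κ⁻¹ bounds the m(U)⁻¹ in the norm of the induced function. The other comes from
extracting m(U)^(1/r) on the right, since m(U)^(-1/r) ≤ m(U)⁻¹ when m(U) ≤ 1. -/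
lemma Thickens.inducedError_le (hΓ : IsLattice Γ) (hF : IsFundamentalDomain Γ.op F m)
    (hmF : m F = 1) {U : Set G} {s t₁ : ℝ} (hU : Thickens Γ m T A U s t₁) {κ : ℝ} (hκ : 0 < κ)
    (hκU : κ ≤ (m U).toReal) {p r : ℝ≥0∞} (hr : 1 ≤ r) {φ : X → ℝ} (hφ : Measurable φ)
    (hφ0 : 0 ≤ φ) {t D : ℝ} (hD : 0 ≤ D)
    (hβ : eLpNorm (fun y => actionAverage (haarUniform m A t) (inducedFun Γ m U φ) y -
      ∫ y, inducedFun Γ m U φ y ∂(inducedMeasure Γ X m F μ)) r (inducedMeasure Γ X m F μ) ≤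
      ENNReal.ofReal D * eLpNorm (inducedFun Γ m U φ) p (inducedMeasure Γ X m F μ)) :
    inducedError Γ m F A U μ r φ t ≤
      m U ^ (1 / r).toReal * (ENNReal.ofReal (D / κ ^ 2) * eLpNorm φ p μ) := by
  have := hΓ.countable
  have hU0 := hU.measure_ne_zero
  have hUt := hU.measure_ne_top
  have hU1 : m U ≤ 1 := hU.injects.measure_le_one hΓ hF hmF hU.measurableSet hU0 μ
  rw [integral_inducedFun hF hU.measurableSet hU.injects hU0 hUt hφ hφ0,
    eLpNorm_inducedFun hF hU.measurableSet hU.injects hU0 hUt hφ hφ0] at hβ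
  have hκU' : ENNReal.ofReal κ ≤ m U := ENNReal.ofReal_le_of_le_toReal hκU
  have hinv : (m U)⁻¹ ≤ ENNReal.ofReal κ⁻¹ := by
    rw [ENNReal.ofReal_inv_of_pos hκ]
    exact ENNReal.inv_le_inv.2 hκU'
  have hp1 : m U ^ (1 / p).toReal ≤ 1 := ENNReal.rpow_le_one hU1 ENNReal.toReal_nonneg
  have hr1 : m U ≤ m U ^ (1 / r).toReal := by
    have h1 : (1 / r).toReal ≤ 1 := by
      rw [← ENNReal.toReal_one]
      refine ENNReal.toReal_mono ENNReal.one_ne_top ?_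
      rw [one_div, ENNReal.inv_le_one]; exact hr
    calc m U = m U ^ (1 : ℝ) := (ENNReal.rpow_one _).symm
      _ ≤ _ := ENNReal.rpow_le_rpow_of_exponent_ge hU1 h1
  have hone : 1 ≤ m U ^ (1 / r).toReal * ENNReal.ofReal κ⁻¹ := by
    calc (1 : ℝ≥0∞) = ENNReal.ofReal κ * ENNReal.ofReal κ⁻¹ := by
          rw [← ENNReal.ofReal_mul hκ.le, mul_inv_cancel₀ hκ.ne', ENNReal.ofReal_one]
      _ ≤ _ := by gcongr; exact hκU'.trans hr1
  refine hβ.trans ?_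
  calc ENNReal.ofReal D * ((m U)⁻¹ * (m U ^ (1 / p).toReal * eLpNorm φ p μ))
      ≤ ENNReal.ofReal D * (ENNReal.ofReal κ⁻¹ * (1 * eLpNorm φ p μ)) := by gcongr
    _ = 1 * (ENNReal.ofReal D * ENNReal.ofReal κ⁻¹ * eLpNorm φ p μ) := by ring
    _ ≤ (m U ^ (1 / r).toReal * ENNReal.ofReal κ⁻¹) *
        (ENNReal.ofReal D * ENNReal.ofReal κ⁻¹ * eLpNorm φ p μ) := by gcongr
    _ = m U ^ (1 / r).toReal * ((ENNReal.ofReal D * ENNReal.ofReal κ⁻¹ * ENNReal.ofReal κ⁻¹) *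
        eLpNorm φ p μ) := by ring
    _ = _ := by
      rw [← ENNReal.ofReal_mul hD, ← ENNReal.ofReal_mul (by positivity)]
      congr 3
      field_simp

variable [m.IsInvInvariant]

lemma ofReal_integral_le_eLpNorm {p : ℝ≥0∞} (hp : 1 ≤ p) {φ : X → ℝ} (hφ : Measurable φ) :
    ENNReal.ofReal (∫ x, φ x ∂μ) ≤ eLpNorm φ p μ := by
  calc ENNReal.ofReal (∫ x, φ x ∂μ) ≤ ‖∫ x, φ x ∂μ‖ₑ := by
        rw [Real.enorm_eq_ofReal_abs]; exact ENNReal.ofReal_le_ofReal (le_abs_self _)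
    _ ≤ ∫⁻ x, ‖φ x‖ₑ ∂μ := enorm_integral_le_lintegral_enorm _
    _ = eLpNorm φ 1 μ := eLpNorm_one_eq_lintegral_enorm.symm
    _ ≤ _ := eLpNorm_le_eLpNorm_of_exponent_le hp hφ.aestronglyMeasurable

/-- A crude bound for the deviation of the lattice averages. -/
lemma eLpNorm_sub_le_two_mul (hΓ : IsLattice Γ) (hA : IsIncreasingBoundedFamily T A)
    {t : ℝ} (ht : t ∈ T) {p r : ℝ≥0∞} (hr : 1 ≤ r) (hrp : r ≤ p) {φ : X → ℝ}
    (hφ : Measurable φ) (hφ0 : 0 ≤ φ) :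
    eLpNorm (fun x => actionAverage (latticeUniform Γ A t) φ x - ∫ x, φ x ∂μ) r μ ≤
      2 * eLpNorm φ p μ := by
  have := hΓ.countable
  have hfin := hΓ.finite_inter (hA.bounded t ht)
  have hr0 : r ≠ 0 := (zero_lt_one.trans_le hr).ne'
  have hle : eLpNorm φ r μ ≤ eLpNorm φ p μ :=
    eLpNorm_le_eLpNorm_of_exponent_le hrp hφ.aestronglyMeasurable
  refine (eLpNorm_sub_le (f := actionAverage (latticeUniform Γ A t) φ)
    (g := fun _ => ∫ x, φ x ∂μ)
    (measurable_actionAverage_uniformOn hfin hφ).aestronglyMeasurable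
    aestronglyMeasurable_const hr).trans ?_
  rw [two_mul]
  refine add_le_add ((eLpNorm_actionAverage_le hfin hr hφ.aestronglyMeasurable).trans hle) ?_
  rw [eLpNorm_const _ hr0 (IsProbabilityMeasure.ne_zero μ), measure_univ, ENNReal.one_rpow,
    mul_one, Real.enorm_of_nonneg (integral_nonneg hφ0)]
  exact ofReal_integral_le_eLpNorm (hr.trans hrp) hφ

/-- The exponential mean ergodic theorem for the lattice averages. -/
theorem HasFineThickenings.expMeanErgodicTheorem (h : HasFineThickenings Γ m T A)
    (hΓ : IsLattice Γ) (hF : IsFundamentalDomain Γ.op F m) (hmF : m F = 1)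
    (hT : T = realTimes ∨ T = natTimes) (hA : IsIncreasingBoundedFamily T A)
    {p r : ℝ≥0∞} (hr : 1 ≤ r) (hrp : r ≤ p)
    (hβ : ExpMeanErgodicTheorem T (haarUniform m A) p r (inducedMeasure Γ X m F μ)) :
    ExpMeanErgodicTheorem T (latticeUniform Γ A) p r μ := by
  have := hΓ.countable
  obtain ⟨C, hC, θ, hθ, hβ⟩ := hβ
  obtain ⟨c, ρ, κ, t₁, hc, hρ, hκ, h⟩ := h
  have hp := hr.trans hrp
  -- At scale ε = e^(-ηt) one has m(U)² ≥ κ² e^(-2ηρt) = κ² e^(-θt/2), so the transfer consumes half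
  -- of the rate θ, while the growth error cε decays at rate η.
  set η : ℝ := θ / (4 * ρ) with hη
  have hη0 : 0 < η := by positivity
  set θ' : ℝ := min (θ / 2) η with hθ'
  have hθ'0 : 0 < θ' := lt_min (by positivity) hη0
  -- The factor e^θ pays for evaluating the Haar averages as early as t − s ≥ t − 1.
  set C₁ : ℝ := C * Real.exp θ / κ ^ 2 with hC₁
  have hC₁0 : 0 < C₁ := by positivity
  obtain ⟨t₂, ht₂⟩ : ∃ t₂ : ℝ, ∀ t, t₂ ≤ t → (C₁ + c) * Real.exp (-(t * θ')) ≤ 1 / 8 := by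
    have h1 : Tendsto (fun t : ℝ => (C₁ + c) * Real.exp (-(t * θ'))) atTop (𝓝 ((C₁ + c) * 0)) :=
      (Real.tendsto_exp_neg_atTop_nhds_zero.comp
        (tendsto_id.atTop_mul_const hθ'0)).const_mul _
    rw [mul_zero] at h1
    obtain ⟨t₂, h2⟩ := eventually_atTop.1 (h1.eventually_le_const (show (0 : ℝ) < 1 / 8 by norm_num))
    exact ⟨t₂, h2⟩
  -- From t₃ on, both relative errors are at most 1/8 and t − s stays past the thresholds. Earlier
  -- times are absorbed into K by the crude bound with constant 2.
  set t₃ : ℝ := max (max t₂ (t₁ + 1)) 2 with ht₃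
  set K : ℝ := 8 * (C₁ + c) + 2 * Real.exp (t₃ * θ') with hK
  have key : ∀ φ : X → ℝ, Measurable φ → 0 ≤ φ → MemLp φ p μ → ∀ t ∈ T, eLpNorm
      (fun x => actionAverage (latticeUniform Γ A t) φ x - ∫ w, φ w ∂μ) r μ ≤
      ENNReal.ofReal (K * Real.exp (-(t * θ'))) * eLpNorm φ p μ := by
    intro φ hφ hφ0 hφp t ht
    have ht0 := times_pos hT ht
    rcases le_or_gt t₃ t with htt | htt
    · have g1 : t₂ ≤ t := ((le_max_left _ _).trans (le_max_left _ _)).trans htt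
      have g2 : t₁ + 1 ≤ t := ((le_max_right _ _).trans (le_max_left _ _)).trans htt
      have g3 : 2 ≤ t := (le_max_right _ _).trans htt
      set ε : ℝ := Real.exp (-(t * η)) with hε
      have hε0 : 0 < ε := Real.exp_pos _
      have hε1 : ε ≤ 1 := Real.exp_le_one_iff.2 (by nlinarith)
      obtain ⟨U, s, hs1, hU, hmU, hgrow⟩ := h ε ⟨hε0, hε1⟩
      have hκε : 0 < κ * ε ^ ρ := by positivity
      have hx := Real.exp_pos (-(t * θ'))
      have hsmall := ht₂ t g1
      have hεle : ε ≤ Real.exp (-(t * θ')) := by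
        refine Real.exp_le_exp.2 ?_
        have : θ' ≤ η := min_le_right _ _
        nlinarith
      have hst : s < t := by linarith
      have hscale : ∀ τ, t - 1 ≤ τ → C * Real.exp (-(τ * θ)) / (κ * ε ^ ρ) ^ 2 ≤
          C₁ * Real.exp (-(t * θ')) := by
        intro τ hτ
        have h1 : (κ * ε ^ ρ) ^ 2 = κ ^ 2 * Real.exp (-(t * (θ / 2))) := by
          rw [mul_pow, hε, ← Real.exp_mul, ← Real.exp_nat_mul]
          congr 2
          rw [hη]; field_simp; norm_num
        rw [h1, div_le_iff₀ (by positivity), hC₁]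
        calc C * Real.exp (-(τ * θ)) ≤ C * Real.exp (θ + -(t * θ') + -(t * (θ / 2))) := by
              gcongr
              have : θ' ≤ θ / 2 := min_le_left _ _
              nlinarith
          _ = _ := by
              rw [Real.exp_add, Real.exp_add]; field_simp
      have hE : ∀ ξ : X → ℝ, Measurable ξ → 0 ≤ ξ → MemLp ξ p μ → ∀ τ ∈ T, t - 1 ≤ τ →
          inducedError Γ m F A U μ r ξ τ ≤ m U ^ (1 / r).toReal *
            (ENNReal.ofReal (C₁ * Real.exp (-(t * θ'))) * eLpNorm ξ p μ) := by
        intro ξ hξ hξ0 hξp τ hτ htτ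
        have h1 := hβ _ (memLp_inducedFun hF hU.measurableSet hU.injects hU.measure_ne_zero
          hU.measure_ne_top hξ hξ0 hξp) τ hτ
        refine (hU.inducedError_le hΓ hF hmF hκε hmU hr hξ hξ0 (by positivity) h1).trans ?_
        gcongr
        exact hscale τ htτ
      have hone : eLpNorm (fun _ : X => (1 : ℝ)) p μ = 1 := by
        rw [eLpNorm_const _ (zero_lt_one.trans_le hp).ne' (IsProbabilityMeasure.ne_zero μ),
          measure_univ, ENNReal.one_rpow, mul_one, enorm_one]
      have hE1 := hE (fun _ => 1) measurable_const (fun _ => zero_le_one) (memLp_const _)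
      simp only [hone, mul_one] at hE1
      have hs0 := hU.nonneg
      have hadd := hU.add_mem t ht
      have hsub := hU.sub_mem t ht hst
      refine (hU.eLpNorm_sub_le_of_inducedError hΓ hF hA (δ := c * Real.exp (-(t * θ')))
        (by positivity) (by nlinarith) (fun τ hτ hττ => (hgrow τ hτ hττ).trans (by gcongr))
        ht hst (by linarith) hr (ζ := C₁ * Real.exp (-(t * θ'))) (by positivity) (by nlinarith)
        (hE1 _ hadd (by linarith)) (hE1 _ hsub (by linarith)) hφ hφ0
        (hE φ hφ hφ0 hφp _ hadd (by linarith)) (hE φ hφ hφ0 hφp _ hsub (by linarith))).trans ?_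
      rw [ENNReal.ofReal_mul (p := 4 * (c * Real.exp (-(t * θ')) + C₁ * Real.exp (-(t * θ'))))
        (by positivity), show (4 : ℝ≥0∞) = ENNReal.ofReal 4 by norm_num,
        ← mul_assoc, ← ENNReal.ofReal_mul (by norm_num)]
      refine (add_le_add_right (mul_le_mul_right (ofReal_integral_le_eLpNorm hp hφ) _) _).trans ?_
      rw [← add_mul, ← ENNReal.ofReal_add (by positivity) (by positivity)]
      gcongr
      have := Real.exp_pos (t₃ * θ')
      rw [hK]
      nlinarith
    · refine (eLpNorm_sub_le_two_mul hΓ hA ht hr hrp hφ hφ0).trans ?_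
      rw [show (2 : ℝ≥0∞) = ENNReal.ofReal 2 by norm_num]
      gcongr
      have h1 : 1 ≤ Real.exp (t₃ * θ') * Real.exp (-(t * θ')) := by
        rw [← Real.exp_add]
        exact Real.one_le_exp (by nlinarith)
      have := Real.exp_pos (-(t * θ'))
      rw [hK]
      nlinarith [mul_pos (add_pos hC₁0 hc) this]
  refine ⟨2 * K, by positivity, θ', hθ'0, fun f hf t ht => ?_⟩
  obtain ⟨φ, ψ, hφ, hψ, hφ0, hψ0, hφp, hψp, hφf, hψf, hint, hdec⟩ :=
    exists_nonneg_decomposition (Λ := Γ) hp hf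
  have hK0 : 0 ≤ K := by positivity
  calc _ ≤ _ := eLpNorm_actionAverage_sub_le hΓ hA ht hφ hψ hint hdec hr
    _ ≤ ENNReal.ofReal (K * Real.exp (-(t * θ'))) * eLpNorm f p μ +
        ENNReal.ofReal (K * Real.exp (-(t * θ'))) * eLpNorm f p μ := by
      refine add_le_add ((key φ hφ hφ0 hφp t ht).trans ?_) ((key ψ hψ hψ0 hψp t ht).trans ?_)
      · gcongr
      · gcongr
    _ = _ := by
      rw [← add_mul, ← ENNReal.ofReal_add (by positivity) (by positivity)]
      congr 2
      ring

end ExpMean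

/-! ### Averages over nested finite sets -/

section FiniteSets

variable {Λ Z : Type*} [Group Λ] [MeasurableSpace Λ] [MeasurableSingletonClass Λ] [Countable Λ]
  [MulAction Λ Z]

lemma actionAverage_uniformOn_mono {S : Set Λ} (hS : S.Finite) {f g : Z → ℝ} (h : f ≤ g) (z : Z) :
    actionAverage (uniformOn S) f z ≤ actionAverage (uniformOn S) g z := by
  rw [actionAverage_uniformOn hS, actionAverage_uniformOn hS]
  gcongr
  exact h _

lemma actionAverage_uniformOn_const_mul {S : Set Λ} (hS : S.Finite) (c : ℝ) (f : Z → ℝ) (z : Z) :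
    actionAverage (uniformOn S) (fun w => c * f w) z = c * actionAverage (uniformOn S) f z := by
  rw [actionAverage_uniformOn hS, actionAverage_uniformOn hS, ← Finset.mul_sum]
  ring

lemma actionAverage_uniformOn_add {S : Set Λ} (hS : S.Finite) (f g : Z → ℝ) (z : Z) :
    actionAverage (uniformOn S) (fun w => f w + g w) z =
      actionAverage (uniformOn S) f z + actionAverage (uniformOn S) g z := by
  rw [actionAverage_uniformOn hS, actionAverage_uniformOn hS, actionAverage_uniformOn hS,
    ← mul_add, ← Finset.sum_add_distrib]

lemma abs_actionAverage_uniformOn_le {S : Set Λ} (hS : S.Finite) {f : Z → ℝ} {M : ℝ}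
    (hM : 0 ≤ M) (hf : ∀ w, |f w| ≤ M) (z : Z) : |actionAverage (uniformOn S) f z| ≤ M := by
  refine (abs_actionAverage_le _ f z).trans ((actionAverage_uniformOn_mono hS hf z).trans ?_)
  rw [actionAverage_uniformOn hS, Finset.sum_const, nsmul_eq_mul,
    ← Set.ncard_eq_toFinset_card _ hS]
  rcases Nat.eq_zero_or_pos S.ncard with h | h
  · simp [h, hM]
  · have : (0 : ℝ) < S.ncard := by exact_mod_cast h
    rw [inv_mul_cancel_left₀ this.ne']

/-- The points of S' outside S contribute at most M each, and the change of normalization costs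
another M for each of them. -/
lemma abs_actionAverage_sub_le {S S' : Set Λ} (hS' : S'.Finite) (hsub : S ⊆ S') {f : Z → ℝ}
    {M : ℝ} (hM : 0 ≤ M) (hf : ∀ w, |f w| ≤ M) (z : Z) :
    S'.ncard * |actionAverage (uniformOn S) f z - actionAverage (uniformOn S') f z| ≤
      2 * M * (S'.ncard - S.ncard) := by
  classical
  have hS := hS'.subset hsub
  have hcard : S.ncard ≤ S'.ncard := Set.ncard_le_ncard hsub hS'
  have hfs : hS.toFinset ⊆ hS'.toFinset := Set.Finite.toFinset_subset_toFinset.2 hsub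
  have h1 := ncard_mul_actionAverage_uniformOn hS f z
  have h2 := ncard_mul_actionAverage_uniformOn hS' f z
  rw [← Finset.sum_sdiff hfs, ← h1] at h2
  set R := ∑ γ ∈ hS'.toFinset \ hS.toFinset, f (γ⁻¹ • z) with hR
  have hRle : |R| ≤ M * (S'.ncard - S.ncard) := by
    refine (Finset.abs_sum_le_sum_abs _ _).trans ((Finset.sum_le_card_nsmul _ _ M
      fun γ _ => hf _).trans (le_of_eq ?_))
    rw [Finset.card_sdiff_of_subset hfs, nsmul_eq_mul, ← Set.ncard_eq_toFinset_card _ hS,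
      ← Set.ncard_eq_toFinset_card _ hS', Nat.cast_sub hcard, mul_comm]
  have hb := abs_actionAverage_uniformOn_le hS hM hf z
  set b := actionAverage (uniformOn S) f z
  set b' := actionAverage (uniformOn S') f z
  have hd : (0 : ℝ) ≤ S'.ncard - S.ncard := sub_nonneg.2 (by exact_mod_cast hcard)
  calc (S'.ncard : ℝ) * |b - b'| = |S'.ncard * (b - b')| := by
        rw [abs_mul, Nat.abs_cast]
    _ = |(S'.ncard - S.ncard) * b - R| := by congr 1; linarith
    _ ≤ |(S'.ncard - S.ncard) * b| + |R| := abs_sub _ _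
    _ ≤ (S'.ncard - S.ncard) * M + M * (S'.ncard - S.ncard) := by
        rw [abs_mul, abs_of_nonneg hd]
        gcongr
    _ = _ := by ring

/-- Jensen's inequality for concave powers. -/
lemma actionAverage_rpow_le {S : Set Λ} (hS : S.Finite) {h : Z → ℝ} (hh : 0 ≤ h) {c : ℝ}
    (hc0 : 0 < c) (hc1 : c ≤ 1) (z : Z) :
    actionAverage (uniformOn S) (fun w => h w ^ c) z ≤ actionAverage (uniformOn S) h z ^ c := by
  rcases Nat.eq_zero_or_pos S.ncard with h0 | h0
  · rw [actionAverage_uniformOn hS, actionAverage_uniformOn hS, h0]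
    simp [Real.zero_rpow hc0.ne']
  have hN : (0 : ℝ) < S.ncard := by exact_mod_cast h0
  have h1 := Real.arith_mean_le_rpow_mean hS.toFinset (fun _ => (S.ncard : ℝ)⁻¹)
    (fun γ => h (γ⁻¹ • z) ^ c) (fun _ _ => by positivity)
    (by rw [Finset.sum_const, nsmul_eq_mul, ← Set.ncard_eq_toFinset_card _ hS,
      mul_inv_cancel₀ hN.ne']) (fun γ _ => Real.rpow_nonneg (hh _) _)
    (p := 1 / c) ((one_le_div hc0).2 hc1)
  rw [one_div_one_div] at h1
  rw [actionAverage_uniformOn hS, actionAverage_uniformOn hS, Finset.mul_sum, Finset.mul_sum]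
  refine h1.trans (le_of_eq ?_)
  congr 1
  refine Finset.sum_congr rfl fun γ _ => ?_
  rw [← Real.rpow_mul (hh _), mul_one_div_cancel hc0.ne', Real.rpow_one]

end FiniteSets

/-- An increasing family of finite sets, nonempty for large times, whose cardinality is at most
multiplied by `D` over a unit of time. -/
structure IsDoubling {Λ : Type*} (T : Set ℝ) (S : ℝ → Set Λ) (D : ℝ) (n₀ : ℕ) : Prop where
  finite : ∀ t ∈ T, (S t).Finite
  mono : MonotoneOn S T
  nonneg : ∀ t ∈ T, 0 ≤ t
  cast_mem : ∀ n : ℕ, n₀ ≤ n → (n : ℝ) ∈ T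
  ncard_pos : ∀ n : ℕ, n₀ ≤ n → 0 < (S n).ncard
  ncard_le : ∀ n : ℕ, n₀ ≤ n → ∀ t ∈ T ∩ Ico (n : ℝ) (n + 1),
    ((S t).ncard : ℝ) ≤ D * ((S n).ncard : ℝ)

/-- The largest deviation from the mean of the averages over `S t` for `n ≤ t < n + 1`. -/
def windowSup {Λ Z : Type*} [Group Λ] [MeasurableSpace Λ] [MulAction Λ Z] [MeasurableSpace Z]
    (T : Set ℝ) (S : ℝ → Set Λ) (η : Measure Z) (n : ℕ) (f : Z → ℝ) (z : Z) : ℝ≥0∞ :=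
  ⨆ t ∈ T ∩ Ico (n : ℝ) (n + 1), ‖actionAverage (uniformOn (S t)) f z - ∫ w, f w ∂η‖ₑ

/-! ### Deviations over a unit of time -/

section Window

variable {Λ Z : Type*} [Group Λ] [MeasurableSpace Λ] [MeasurableSingletonClass Λ] [Countable Λ]
  [MulAction Λ Z] [MeasurableSpace Z] [MeasurableConstSMul Λ Z] {η : Measure Z}
  [IsProbabilityMeasure η] [SMulInvariantMeasure Λ Z η] {T : Set ℝ} {S : ℝ → Set Λ} {D : ℝ}
  {n₀ : ℕ}

lemma IsDoubling.measurable_windowSup (h : IsDoubling T S D n₀) (n : ℕ) {f : Z → ℝ}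
    (hf : Measurable f) : Measurable (windowSup T S η n f) :=
  measurable_iSup_finite (fun t ht => h.finite t ht.1)
    (g := fun R z => ‖actionAverage (uniformOn R) f z - ∫ w, f w ∂η‖ₑ)
    fun _ hR => ((measurable_actionAverage_uniformOn hR hf).sub_const _).enorm

/-- Within a unit of time, boundedly many averages approximate all of them. -/
lemma IsDoubling.exists_finset (h : IsDoubling T S D n₀) {n : ℕ} (hn : n₀ ≤ n) {δ : ℝ}
    (hδ : 0 < δ) : ∃ R : Finset ℝ, (R : Set ℝ) ⊆ T ∩ Ico (n : ℝ) (n + 1) ∧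
      (R.card : ℝ) ≤ D / δ + 1 ∧ ∀ t ∈ T ∩ Ico (n : ℝ) (n + 1), ∃ t' ∈ R,
        ∀ (f : Z → ℝ) (M : ℝ), 0 ≤ M → (∀ w, |f w| ≤ M) → ∀ z,
          |actionAverage (uniformOn (S t)) f z - actionAverage (uniformOn (S t')) f z| ≤
            2 * M * δ := by
  classical
  set W : Set ℝ := T ∩ Ico (n : ℝ) (n + 1) with hW
  have hN : (0 : ℝ) < (S n).ncard := by exact_mod_cast h.ncard_pos n hn
  have hnW : (n : ℝ) ∈ W := ⟨h.cast_mem n hn, le_rfl, by linarith⟩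
  have hle : ∀ t ∈ W, ((S n).ncard : ℝ) ≤ (S t).ncard := fun t ht => by
    exact_mod_cast Set.ncard_le_ncard (h.mono hnW.1 ht.1 ht.2.1) (h.finite t ht.1)
  have hD : 0 ≤ D := by
    have := h.ncard_le n hn n hnW
    nlinarith
  -- Times are classified by |S t| measured in units of δ|S n|, which gives at most D/δ + 1 classes.
  -- Within a class the nested sets differ by at most δ|S n| points, so one time per class suffices,
  -- however irregularly |S t| grows.
  set k : ℝ → ℕ := fun t => ⌊((S t).ncard : ℝ) / (δ * (S n).ncard)⌋₊ with hk
  have hkle : ∀ t ∈ W, k t < ⌊D / δ⌋₊ + 1 := fun t ht => by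
    refine Nat.lt_succ_of_le (Nat.floor_le_floor ?_)
    rw [div_le_div_iff₀ (by positivity) hδ]
    nlinarith [h.ncard_le n hn t ht]
  have hdiff : ∀ t ∈ W, ∀ t' ∈ W, k t = k t' →
      ((S t').ncard : ℝ) - (S t).ncard ≤ δ * (S n).ncard := fun t _ t' _ hkk => by
    have hpos : (0 : ℝ) < δ * (S n).ncard := by positivity
    have h1 := Nat.floor_le (show 0 ≤ ((S t).ncard : ℝ) / (δ * (S n).ncard) by positivity)
    have h2 := Nat.lt_floor_add_one (((S t').ncard : ℝ) / (δ * (S n).ncard))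
    rw [show ⌊((S t).ncard : ℝ) / (δ * (S n).ncard)⌋₊ = k t from rfl, le_div_iff₀ hpos] at h1
    rw [show ⌊((S t').ncard : ℝ) / (δ * (S n).ncard)⌋₊ = k t' from rfl, div_lt_iff₀ hpos,
      ← hkk] at h2
    linarith
  have key : ∀ t ∈ W, ∀ t' ∈ W, t ≤ t' → k t = k t' →
      ∀ (f : Z → ℝ) (M : ℝ), 0 ≤ M → (∀ w, |f w| ≤ M) → ∀ z,
          |actionAverage (uniformOn (S t)) f z - actionAverage (uniformOn (S t')) f z| ≤
            2 * M * δ := by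
    intro t ht t' ht' htt hkk f M hM hf z
    have h1 := abs_actionAverage_sub_le (h.finite t' ht'.1) (h.mono ht.1 ht'.1 htt) hM hf z
    have h2 := hdiff t ht t' ht' hkk
    have h3 := hle t' ht'
    have h4 : (0 : ℝ) < (S t').ncard := hN.trans_le h3
    refine le_of_mul_le_mul_left (h1.trans ?_) h4
    calc 2 * M * (((S t').ncard : ℝ) - (S t).ncard) ≤ 2 * M * (δ * (S t').ncard) := by
          gcongr; exact h2.trans (by gcongr)
      _ = _ := by ring
  -- An empty class receives the time n, a harmless default inside the window.
  set g : ℕ → ℝ := fun j => if hj : ∃ t ∈ W, k t = j then hj.choose else n with hg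
  have hgW : ∀ j, g j ∈ W := fun j => by
    by_cases hj : ∃ t ∈ W, k t = j
    · simp only [hg, dif_pos hj]; exact hj.choose_spec.1
    · simp only [hg, dif_neg hj]; exact hnW
  refine ⟨(Finset.range (⌊D / δ⌋₊ + 1)).image g, ?_, ?_, fun t ht => ⟨g (k t), ?_, ?_⟩⟩
  · intro t ht
    obtain ⟨j, -, rfl⟩ := Finset.mem_image.1 (Finset.mem_coe.1 ht)
    exact hgW j
  · refine (Nat.cast_le.2 Finset.card_image_le).trans ?_
    rw [Finset.card_range, Nat.cast_add, Nat.cast_one]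
    gcongr
    exact Nat.floor_le (by positivity)
  · exact Finset.mem_image_of_mem _ (Finset.mem_range.2 (hkle t ht))
  · have hex : ∃ t' ∈ W, k t' = k t := ⟨t, ht, rfl⟩
    have hkg : k (g (k t)) = k t := by
      simp only [hg, dif_pos hex]; exact hex.choose_spec.2
    intro f M hM hf z
    rcases le_total t (g (k t)) with htt | htt
    · exact key t ht _ (hgW _) htt hkg.symm f M hM hf z
    · rw [abs_sub_comm]
      exact key _ (hgW _) t ht htt hkg f M hM hf z

lemma abs_integral_le_of_bound {f : Z → ℝ} {M : ℝ} (hf : ∀ w, |f w| ≤ M) :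
    |∫ w, f w ∂η| ≤ M := by
  have := norm_integral_le_of_norm_le_const (f := f) (C := M) (μ := η) (ae_of_all _ hf)
  simpa using this

lemma IsDoubling.windowSup_le (h : IsDoubling T S D n₀) (n : ℕ) {f : Z → ℝ} {M : ℝ}
    (hM : 0 ≤ M) (hf : ∀ w, |f w| ≤ M) (z : Z) :
    windowSup T S η n f z ≤ ENNReal.ofReal (2 * M) := by
  refine iSup₂_le fun t ht => ?_
  rw [Real.enorm_eq_ofReal_abs]
  refine ENNReal.ofReal_le_ofReal ((abs_sub _ _).trans ?_)
  rw [two_mul]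
  exact add_le_add (abs_actionAverage_uniformOn_le (h.finite t ht.1) hM hf z)
    (abs_integral_le_of_bound hf)

lemma eLpNorm_rpow_eq {W : Z → ℝ≥0∞} {c : ℝ} (hc : 0 < c) (b : ℝ≥0∞) :
    eLpNorm (fun z => W z ^ c) b η = eLpNorm W (b * ENNReal.ofReal c) η ^ c := by
  simpa using eLpNorm_enorm_rpow (p := b) (μ := η) W hc

lemma eLpNorm_le_ofReal_of_bound {f : Z → ℝ} {M : ℝ} (hf : ∀ w, |f w| ≤ M) (p : ℝ≥0∞) :
    eLpNorm f p η ≤ ENNReal.ofReal M := by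
  have := eLpNorm_le_of_ae_bound (f := f) (C := M) (p := p) (μ := η) (ae_of_all _ hf)
  simpa using this

/-- Over a unit of time, the largest deviation of a bounded function decays exponentially in
`L^r`. -/
lemma IsDoubling.eLpNorm_windowSup_le (h : IsDoubling T S D n₀) {p r : ℝ≥0∞} (hr : 1 ≤ r)
    (hexp : ExpMeanErgodicTheorem T (fun t => uniformOn (S t)) p r η) :
    ∃ K κ : ℝ, 0 < K ∧ 0 < κ ∧ ∀ n : ℕ, n₀ ≤ n → ∀ (f : Z → ℝ) (M : ℝ), Measurable f → 0 ≤ M →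
      (∀ w, |f w| ≤ M) →
      eLpNorm (windowSup T S η n f) r η ≤ ENNReal.ofReal (K * M * Real.exp (-(n * κ))) := by
  obtain ⟨C, hC, θ, hθ, hexp⟩ := hexp
  have hr0 : r ≠ 0 := (zero_lt_one.trans_le hr).ne'
  have hD : 0 ≤ D := by
    have h1 := h.ncard_le n₀ le_rfl n₀ ⟨h.cast_mem _ le_rfl, le_rfl, by linarith⟩
    have hN : (0 : ℝ) < (S n₀).ncard := by exact_mod_cast h.ncard_pos n₀ le_rfl
    nlinarith
  refine ⟨2 + (D + 1) * C, θ / 2, by positivity, by positivity, fun n hn f M hf hM hfM => ?_⟩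
  -- This choice balances the errors: discretization costs 2Mδ, and at most D/δ + 1 representatives,
  -- each deviating by at most Cδ²M, add up to O(δM).
  set δ : ℝ := Real.exp (-(n * (θ / 2))) with hδ
  have hδ0 : 0 < δ := Real.exp_pos _
  have hδ1 : δ ≤ 1 := Real.exp_le_one_iff.2 (by
    have : (0 : ℝ) ≤ n := Nat.cast_nonneg n
    have : 0 ≤ n * (θ / 2) := by positivity
    linarith)
  obtain ⟨R, hRW, hRc, hR⟩ := h.exists_finset (Z := Z) hn hδ0
  set E : ℝ → Z → ℝ≥0∞ := fun t z => ‖actionAverage (uniformOn (S t)) f z - ∫ w, f w ∂η‖ₑ with hE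
  have hEm : ∀ t ∈ R, AEStronglyMeasurable (E t) η := fun t ht =>
    ((measurable_actionAverage_uniformOn (h.finite t (hRW ht).1) hf).sub_const
      _).enorm.aestronglyMeasurable
  have hEn : ∀ t ∈ R, eLpNorm (E t) r η ≤ ENNReal.ofReal (C * (δ * δ) * M) := fun t ht => by
    have hfp : MemLp f p η := ⟨hf.aestronglyMeasurable,
      (eLpNorm_le_ofReal_of_bound hfM p).trans_lt ENNReal.ofReal_lt_top⟩
    have h1 := hexp f hfp t (hRW ht).1
    rw [hE]
    simp only [eLpNorm_enorm]
    refine h1.trans ?_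
    rw [ENNReal.ofReal_mul (p := C * (δ * δ)) (by positivity)]
    refine mul_le_mul' (ENNReal.ofReal_le_ofReal (mul_le_mul_of_nonneg_left ?_ hC.le))
      (eLpNorm_le_ofReal_of_bound (η := η) hfM p)
    rw [hδ, ← Real.exp_add]
    have := (hRW ht).2.1
    exact Real.exp_le_exp.2 (by nlinarith)
  have hpt : ∀ z, windowSup T S η n f z ≤
      ((fun _ => ENNReal.ofReal (2 * M * δ)) + ∑ t ∈ R, E t : Z → ℝ≥0∞) z := by
    intro z
    refine iSup₂_le fun t ht => ?_
    obtain ⟨t', ht', hclose⟩ := hR t ht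
    have h1 := hclose f M hM hfM z
    simp only [Pi.add_apply, Finset.sum_apply]
    calc ‖actionAverage (uniformOn (S t)) f z - ∫ w, f w ∂η‖ₑ
        = ‖(actionAverage (uniformOn (S t)) f z - actionAverage (uniformOn (S t')) f z) +
            (actionAverage (uniformOn (S t')) f z - ∫ w, f w ∂η)‖ₑ := by congr 1; ring
      _ ≤ _ := enorm_add_le _ _
      _ ≤ _ := by
        refine add_le_add ?_ (Finset.single_le_sum (f := fun t => E t z)
          (fun _ _ => zero_le) ht')
        rw [Real.enorm_eq_ofReal_abs]
        exact ENNReal.ofReal_le_ofReal h1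
  calc eLpNorm (windowSup T S η n f) r η
      ≤ eLpNorm ((fun _ => ENNReal.ofReal (2 * M * δ)) + ∑ t ∈ R, E t : Z → ℝ≥0∞) r η :=
        eLpNorm_mono_enorm hpt
    _ ≤ ENNReal.ofReal (2 * M * δ) + ∑ t ∈ R, eLpNorm (E t) r η := by
        refine (eLpNorm_add_le aestronglyMeasurable_const
          (Finset.aestronglyMeasurable_sum R hEm) hr).trans ?_
        refine add_le_add (le_of_eq ?_) (eLpNorm_sum_le hEm hr)
        rw [eLpNorm_const _ hr0 (IsProbabilityMeasure.ne_zero η), measure_univ,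
          ENNReal.one_rpow, mul_one, enorm_eq_self]
    _ ≤ ENNReal.ofReal (2 * M * δ) + ENNReal.ofReal ((D / δ + 1) * (C * (δ * δ) * M)) := by
        refine add_le_add le_rfl ((Finset.sum_le_card_nsmul _ _ _ hEn).trans ?_)
        rw [nsmul_eq_mul, ENNReal.ofReal_mul (p := D / δ + 1) (by positivity),
          ← ENNReal.ofReal_natCast]
        exact mul_le_mul' (ENNReal.ofReal_le_ofReal hRc) le_rfl
    _ ≤ _ := by
        rw [← ENNReal.ofReal_add (by positivity) (by positivity)]
        refine ENNReal.ofReal_le_ofReal ?_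
        have h1 : (D / δ + 1) * (C * (δ * δ) * M) = (D + δ) * C * δ * M := by field_simp
        rw [h1]
        have h2 : (D + δ) * C * δ * M ≤ (D + 1) * C * δ * M := by gcongr
        nlinarith

/-- Interpolation with L^∞ in its elementary form W ≤ M^(1-ρ) W^ρ. -/
lemma eLpNorm_le_rpow_mul_of_bound {W : Z → ℝ≥0∞} {M : ℝ} (hW : ∀ z, W z ≤ ENNReal.ofReal M)
    {ρ : ℝ} (hρ0 : 0 < ρ) (hρ1 : ρ ≤ 1) (s : ℝ≥0∞) :
    eLpNorm W s η ≤
      ENNReal.ofReal M ^ (1 - ρ) * eLpNorm W (s * ENNReal.ofReal ρ) η ^ ρ := by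
  rw [← eLpNorm_rpow_eq hρ0]
  have hc : ENNReal.ofReal M ^ (1 - ρ) ≠ ∞ :=
    ENNReal.rpow_ne_top_of_nonneg (by linarith) ENNReal.ofReal_ne_top
  have hc' := ENNReal.coe_toNNReal hc
  rw [← hc']
  refine eLpNorm_le_mul_eLpNorm_of_ae_le_mul' (ae_of_all _ fun z => ?_) s
  rw [hc', enorm_eq_self, enorm_eq_self]
  rcases eq_or_ne (W z) 0 with h0 | h0
  · rw [h0]; exact zero_le
  have ht : W z ≠ ∞ := ((hW z).trans_lt ENNReal.ofReal_lt_top).ne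
  calc W z = W z ^ (1 - ρ) * W z ^ ρ := by
        rw [← ENNReal.rpow_add _ _ h0 ht, sub_add_cancel, ENNReal.rpow_one]
    _ ≤ _ := mul_le_mul' (ENNReal.rpow_le_rpow (hW z) (by linarith)) le_rfl

/-- Exponential decay in `L^s` for bounded functions, for every admissible exponent `s`. -/
lemma IsDoubling.eLpNorm_windowSup_le_of_top (h : IsDoubling T S D n₀) {p r s : ℝ≥0∞}
    (hr : 1 ≤ r) (hs : s = ∞ → r = ∞)
    (hexp : ExpMeanErgodicTheorem T (fun t => uniformOn (S t)) p r η) :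
    ∃ K κ : ℝ, 0 < K ∧ 0 < κ ∧ ∀ n : ℕ, n₀ ≤ n → ∀ (f : Z → ℝ) (M : ℝ), Measurable f → 0 ≤ M →
      (∀ w, |f w| ≤ M) →
      eLpNorm (windowSup T S η n f) s η ≤ ENNReal.ofReal (K * M * Real.exp (-(n * κ))) := by
  obtain ⟨K, κ, hK, hκ, hbase⟩ := h.eLpNorm_windowSup_le hr hexp
  rcases le_or_gt s r with hsr | hrs
  · exact ⟨K, κ, hK, hκ, fun n hn f M hf hM hfM =>
      (eLpNorm_le_eLpNorm_of_exponent_le hsr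
        (h.measurable_windowSup n hf).aestronglyMeasurable).trans (hbase n hn f M hf hM hfM)⟩
  have hrt : r ≠ ∞ := (hrs.trans_le le_top).ne
  have hst : s ≠ ∞ := fun h => hrt (hs h)
  have hr0 : 0 < r.toReal := ENNReal.toReal_pos (zero_lt_one.trans_le hr).ne' hrt
  have hrs' : r.toReal < s.toReal := (ENNReal.toReal_lt_toReal hrt hst).2 hrs
  -- For s > r, interpolation with the trivial bound 2M keeps the fraction r/s of the rate. The
  -- value s = ∞, for which this fraction would vanish, is excluded by `hs`.
  set ρ : ℝ := r.toReal / s.toReal with hρ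
  have hs0 : 0 < s.toReal := hr0.trans hrs'
  have hρ0 : 0 < ρ := by positivity
  have hρ1 : ρ ≤ 1 := (div_le_one hs0).2 hrs'.le
  have hsρ : s * ENNReal.ofReal ρ = r := by
    rw [← ENNReal.ofReal_toReal hst, ← ENNReal.ofReal_mul hs0.le, hρ,
      mul_div_cancel₀ _ hs0.ne', ENNReal.ofReal_toReal hrt]
  refine ⟨2 ^ (1 - ρ) * K ^ ρ, κ * ρ, by positivity, by positivity,
    fun n hn f M hf hM hfM => ?_⟩
  refine (eLpNorm_le_rpow_mul_of_bound (h.windowSup_le n hM hfM) hρ0 hρ1 s).trans ?_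
  rw [hsρ]
  calc _ ≤ ENNReal.ofReal (2 * M) ^ (1 - ρ) *
        ENNReal.ofReal (K * M * Real.exp (-(n * κ))) ^ ρ := by
        gcongr
        exact hbase n hn f M hf hM hfM
    _ = _ := by
      rw [ENNReal.ofReal_rpow_of_nonneg (by positivity) (by linarith),
        ENNReal.ofReal_rpow_of_nonneg (by positivity) hρ0.le, ← ENNReal.ofReal_mul (by positivity)]
      congr 1
      rw [Real.mul_rpow (by norm_num) hM, Real.mul_rpow (by positivity) (by positivity),
        Real.mul_rpow hK.le hM, ← Real.exp_mul,
        show -(↑n * κ) * ρ = -(↑n * (κ * ρ)) by ring]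
      have : M ^ (1 - ρ) * M ^ ρ = M := by
        rcases hM.eq_or_lt with h0 | h0
        · rw [← h0, Real.zero_rpow hρ0.ne', mul_zero]
        · rw [← Real.rpow_add h0, sub_add_cancel, Real.rpow_one]
      calc _ = 2 ^ (1 - ρ) * K ^ ρ * (M ^ (1 - ρ) * M ^ ρ) * Real.exp (-(n * (κ * ρ))) := by ring
        _ = _ := by rw [this]

end Window

/-! ### Countable suprema and normalization -/

section Summation

variable {Z : Type*} [MeasurableSpace Z] {η : Measure Z}

/-- The norm of a countable supremum is at most the sum of the norms. -/
lemma eLpNorm_iSup_le_tsum {g : ℕ → Z → ℝ≥0∞} (hg : ∀ k, Measurable (g k)) {r : ℝ≥0∞}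
    (hr : 1 ≤ r) : eLpNorm (fun z => ⨆ k, g k z) r η ≤ ∑' k, eLpNorm (g k) r η := by
  rcases eq_or_ne r ∞ with rfl | hrt
  · rw [eLpNorm_exponent_top]
    refine essSup_le_of_ae_le _ ?_
    have h1 : ∀ᵐ z ∂η, ∀ k, ‖g k z‖ₑ ≤ eLpNormEssSup (g k) η :=
      ae_all_iff.2 fun k => enorm_ae_le_eLpNormEssSup _ _
    filter_upwards [h1] with z hz
    rw [enorm_eq_self]
    refine iSup_le fun k => ?_
    have := hz k
    rw [enorm_eq_self] at this
    exact this.trans (ENNReal.le_tsum (f := fun k => eLpNorm (g k) ∞ η) k)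
  · have hr0 : r ≠ 0 := (zero_lt_one.trans_le hr).ne'
    have hR1 : 1 ≤ r.toReal := by
      rw [← ENNReal.toReal_one]
      exact ENNReal.toReal_mono hrt hr
    have hR0 : 0 < r.toReal := by linarith
    have hpow : ∀ f : Z → ℝ≥0∞, eLpNorm f r η ^ r.toReal = ∫⁻ z, f z ^ r.toReal ∂η := by
      intro f
      rw [eLpNorm_eq_lintegral_rpow_enorm_toReal hr0 hrt, ← ENNReal.rpow_mul,
        one_div_mul_cancel hR0.ne', ENNReal.rpow_one]
      simp
    rw [← ENNReal.rpow_le_rpow_iff hR0, hpow]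
    set x : ℕ → ℝ≥0∞ := fun k => eLpNorm (g k) r η with hx
    have hsplit : ∀ y : ℝ≥0∞, y ^ r.toReal = y * y ^ (r.toReal - 1) := fun y => by
      nth_rewrite 2 [← ENNReal.rpow_one y]
      rw [← ENNReal.rpow_add_of_nonneg _ _ zero_le_one (by linarith)]
      congr 1; ring
    -- The supremum is at most the ℓ^r sum, and Σ x_k^r ≤ Σ x_k (Σ x_j)^(r-1).
    calc ∫⁻ z, (⨆ k, g k z) ^ r.toReal ∂η
        ≤ ∫⁻ z, ∑' k, g k z ^ r.toReal ∂η := by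
          refine lintegral_mono fun z => ?_
          rw [← ENNReal.le_rpow_inv_iff hR0]
          refine iSup_le fun k => ?_
          rw [ENNReal.le_rpow_inv_iff hR0]
          exact ENNReal.le_tsum (f := fun k => g k z ^ r.toReal) k
      _ = ∑' k, x k ^ r.toReal := by
          rw [lintegral_tsum fun k => ((hg k).pow_const _).aemeasurable]
          exact tsum_congr fun k => (hpow _).symm
      _ ≤ ∑' k, x k * (∑' k, x k) ^ (r.toReal - 1) := by
          refine ENNReal.tsum_le_tsum fun k => ?_
          rw [hsplit]
          exact mul_le_mul' le_rfl (ENNReal.rpow_le_rpow (ENNReal.le_tsum k) (by linarith))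
      _ = (∑' k, x k) ^ r.toReal := by
          rw [ENNReal.tsum_mul_right, ← hsplit]

/-- For p = ∞ the normalized function is clipped to [-1, 1], turning the essential bound into a
bound at every point, as the window estimates require. -/
lemma exists_normalized [IsProbabilityMeasure η] {p : ℝ≥0∞} (hp : 1 ≤ p) {f : Z → ℝ}
    (hf : MemLp f p η) : ∃ g : Z → ℝ, Measurable g ∧ eLpNorm g p η ≤ 1 ∧
      (p = ∞ → ∀ z, |g z| ≤ 1) ∧ ∀ᵐ z ∂η, f z = (eLpNorm f p η).toReal * g z := by
  have hp0 : p ≠ 0 := (zero_lt_one.trans_le hp).ne'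
  set L := (eLpNorm f p η).toReal with hL
  rcases (ENNReal.toReal_nonneg : 0 ≤ L).eq_or_lt with h0 | h0
  · have h1 : eLpNorm f p η = 0 := by
      rcases (ENNReal.toReal_eq_zero_iff _).1 h0.symm with h | h
      · exact h
      · exact absurd h hf.2.ne
    refine ⟨0, measurable_zero, by simp, by simp, ?_⟩
    filter_upwards [(eLpNorm_eq_zero_iff hf.1 hp0).1 h1] with z hz
    simpa using hz
  set g₀ : Z → ℝ := L⁻¹ • hf.1.mk f with hg₀
  have hg₀m : Measurable g₀ := hf.1.stronglyMeasurable_mk.measurable.const_smul _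
  have hg₀f : ∀ᵐ z ∂η, f z = L * g₀ z := by
    filter_upwards [hf.1.ae_eq_mk] with z hz
    rw [hg₀, Pi.smul_apply, smul_eq_mul, mul_inv_cancel_left₀ h0.ne', hz]
  have hg₀n : eLpNorm g₀ p η ≤ 1 := by
    rw [hg₀, eLpNorm_const_smul, ← eLpNorm_congr_ae hf.1.ae_eq_mk, Real.enorm_of_nonneg
      (by positivity), ENNReal.ofReal_inv_of_pos h0, ENNReal.ofReal_toReal hf.2.ne]
    exact ENNReal.inv_mul_le_one _
  by_cases hpt : p = ∞
  · refine ⟨fun z => max (min (g₀ z) 1) (-1), (hg₀m.min measurable_const).max measurable_const,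
      ?_, fun _ z => ?_, ?_⟩
    · refine (eLpNorm_le_of_ae_bound (C := 1) (ae_of_all _ fun z => ?_)).trans (by simp)
      rw [Real.norm_eq_abs, abs_le]
      exact ⟨le_max_right _ _, max_le (min_le_right _ _) (by norm_num)⟩
    · rw [abs_le]
      exact ⟨le_max_right _ _, max_le (min_le_right _ _) (by norm_num)⟩
    · rw [hpt, eLpNorm_exponent_top] at hg₀n
      filter_upwards [hg₀f, enorm_ae_le_eLpNormEssSup g₀ η] with z hz hz'
      have h2 : |g₀ z| ≤ 1 := by
        have := hz'.trans hg₀n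
        rw [Real.enorm_eq_ofReal_abs] at this
        simpa using this
      rw [abs_le] at h2
      rw [min_eq_left h2.2, max_eq_left h2.1]
      exact hz
  · exact ⟨g₀, hg₀m, hg₀n, fun h => absurd h hpt, hg₀f⟩

end Summation

/-! ### From windows to the exponential maximal inequality -/

section Window

variable {Λ Z : Type*} [Group Λ] [MeasurableSpace Λ] [MeasurableSingletonClass Λ] [Countable Λ]
  [MulAction Λ Z] [MeasurableSpace Z] [MeasurableConstSMul Λ Z] {η : Measure Z}
  [IsProbabilityMeasure η] [SMulInvariantMeasure Λ Z η] {T : Set ℝ} {S : ℝ → Set Λ} {D : ℝ}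
  {n₀ : ℕ}

lemma IsDoubling.windowSup_eq_mul (h : IsDoubling T S D n₀) {f g : Z → ℝ} {L : ℝ} (hL : 0 ≤ L)
    (hfg : ∀ᵐ z ∂η, f z = L * g z) :
    ∀ᵐ z ∂η, ∀ n, windowSup T S η n f z = ENNReal.ofReal L * windowSup T S η n g z := by
  have hint : ∫ w, f w ∂η = L * ∫ w, g w ∂η := by
    rw [integral_congr_ae hfg, integral_const_mul]
  filter_upwards [ae_forall_smul_eq (Λ := Λ) hfg] with z hz n
  unfold windowSup
  rw [ENNReal.mul_iSup]
  refine iSup_congr fun t => ?_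
  rw [ENNReal.mul_iSup]
  refine iSup_congr fun ht => ?_
  rw [actionAverage_congr (g := fun w => L * g w) hz,
    actionAverage_uniformOn_const_mul (h.finite t ht.1), hint, ← mul_sub, enorm_mul,
    Real.enorm_of_nonneg hL]

/-- Exponential decay over unit time windows gives the exponential maximal inequality. -/
lemma IsDoubling.expStrongMaximalInequality (h : IsDoubling T S D n₀) {p r : ℝ≥0∞}
    (hp : 1 ≤ p) (hr : 1 ≤ r) {K κ : ℝ} (hK : 0 < K) (hκ : 0 < κ) {n₁ : ℕ}
    (hdec : ∀ n : ℕ, n₁ ≤ n → ∀ g : Z → ℝ, Measurable g → eLpNorm g p η ≤ 1 →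
      (p = ∞ → ∀ z, |g z| ≤ 1) →
      eLpNorm (windowSup T S η n g) r η ≤ ENNReal.ofReal (K * Real.exp (-(n * κ)))) :
    ExpStrongMaximalInequality T (fun t => uniformOn (S t)) p r η := by
  -- On the window [n, n + 1) the weight is at most e^((n+1)θ); against the decay K e^(-2nθ) this
  -- leaves K e^θ ρ^n, a geometric series.
  set θ : ℝ := κ / 2 with hθ
  set ρ : ℝ := Real.exp (-θ) with hρ
  have hρ0 : 0 < ρ := Real.exp_pos _
  have hρ1 : ρ < 1 := Real.exp_lt_one_iff.2 (by rw [hθ]; linarith)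
  set C : ℝ := K * Real.exp θ * (1 - ρ)⁻¹ with hC
  have hC0 : 0 < C := by
    have : 0 < 1 - ρ := by linarith
    positivity
  refine ⟨n₁, Nat.cast_nonneg _, C, hC0, θ, by positivity, fun f hf => ?_⟩
  obtain ⟨g, hg, hgn, hgb, hfg⟩ := exists_normalized hp hf
  set L := (eLpNorm f p η).toReal with hL
  have hLf : ENNReal.ofReal L = eLpNorm f p η := ENNReal.ofReal_toReal hf.2.ne
  set G : ℕ → Z → ℝ≥0∞ := fun k z =>
    ENNReal.ofReal (Real.exp (((n₁ + k : ℕ) + 1) * θ)) * windowSup T S η (n₁ + k) g z with hG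
  have hGm : ∀ k, Measurable (G k) := fun k => (h.measurable_windowSup _ hg).const_mul _
  have hGn : ∀ k, eLpNorm (G k) r η ≤ ENNReal.ofReal (K * Real.exp θ) * ENNReal.ofReal ρ ^ k := by
    intro k
    have h1 : eLpNorm (G k) r η ≤ ENNReal.ofReal (Real.exp (((n₁ + k : ℕ) + 1) * θ)) *
        eLpNorm (windowSup T S η (n₁ + k) g) r η :=
      eLpNorm_le_mul_eLpNorm_of_ae_le_mul'
        (c := (Real.exp (((n₁ + k : ℕ) + 1) * θ)).toNNReal) (ae_of_all _ fun z => le_rfl) r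
    refine h1.trans ((mul_le_mul' le_rfl (hdec _ (Nat.le_add_right _ _) g hg hgn hgb)).trans ?_)
    rw [← ENNReal.ofReal_mul (by positivity), ← ENNReal.ofReal_pow hρ0.le,
      ← ENNReal.ofReal_mul (by positivity)]
    refine ENNReal.ofReal_le_ofReal ?_
    rw [hρ, ← Real.exp_nat_mul, mul_left_comm, mul_assoc, ← Real.exp_add, ← Real.exp_add]
    refine mul_le_mul_of_nonneg_left (Real.exp_le_exp.2 ?_) hK.le
    have : (0 : ℝ) ≤ n₁ := Nat.cast_nonneg _
    push_cast
    rw [show κ = 2 * θ by rw [hθ]; ring]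
    nlinarith [mul_nonneg this (show 0 ≤ θ by positivity)]
  have hpt : ∀ᵐ z ∂η, (⨆ t ∈ T, ⨆ _ : (n₁ : ℝ) ≤ t, ENNReal.ofReal (Real.exp (t * θ)) *
      ‖actionAverage (uniformOn (S t)) f z - ∫ w, f w ∂η‖ₑ) ≤
      ENNReal.ofReal L * ⨆ k, G k z := by
    filter_upwards [h.windowSup_eq_mul ENNReal.toReal_nonneg hfg] with z hz
    refine iSup₂_le fun t ht => iSup_le fun htn => ?_
    have ht0 : 0 ≤ t := h.nonneg t ht
    obtain ⟨k, hk⟩ := Nat.exists_eq_add_of_le (Nat.le_floor htn)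
    have hmem : t ∈ T ∩ Ico (((n₁ + k : ℕ) : ℝ)) ((n₁ + k : ℕ) + 1) := by
      rw [← hk]
      exact ⟨ht, Nat.floor_le ht0, Nat.lt_floor_add_one t⟩
    have h1 : ‖actionAverage (uniformOn (S t)) f z - ∫ w, f w ∂η‖ₑ ≤
        windowSup T S η (n₁ + k) f z :=
      le_iSup₂ (f := fun t (_ : t ∈ T ∩ Ico (((n₁ + k : ℕ) : ℝ)) ((n₁ + k : ℕ) + 1)) =>
        ‖actionAverage (uniformOn (S t)) f z - ∫ w, f w ∂η‖ₑ) t hmem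
    rw [hz] at h1
    calc _ ≤ ENNReal.ofReal (Real.exp (((n₁ + k : ℕ) + 1) * θ)) *
          (ENNReal.ofReal L * windowSup T S η (n₁ + k) g z) := by
          refine mul_le_mul' (ENNReal.ofReal_le_ofReal (Real.exp_le_exp.2 ?_)) h1
          exact mul_le_mul_of_nonneg_right hmem.2.2.le (by positivity)
      _ = ENNReal.ofReal L * G k z := by rw [hG]; ring
      _ ≤ _ := mul_le_mul' le_rfl (le_iSup (fun k => G k z) k)
  calc _ ≤ ENNReal.ofReal L * eLpNorm (fun z => ⨆ k, G k z) r η :=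
        eLpNorm_le_mul_eLpNorm_of_ae_le_mul' (c := L.toNNReal) hpt r
    _ ≤ ENNReal.ofReal L * ∑' k, ENNReal.ofReal (K * Real.exp θ) * ENNReal.ofReal ρ ^ k :=
        mul_le_mul' le_rfl ((eLpNorm_iSup_le_tsum hGm hr).trans (ENNReal.tsum_le_tsum hGn))
    _ = ENNReal.ofReal C * eLpNorm f p η := by
        rw [ENNReal.tsum_mul_left, ENNReal.tsum_geometric, hLf, mul_comm, hC,
          ENNReal.ofReal_mul (p := K * Real.exp θ) (by positivity), ENNReal.ofReal_inv_of_pos (by linarith),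
          ENNReal.ofReal_sub _ hρ0.le, ENNReal.ofReal_one]

end Window

/-- The maximal function of the averages over `S t`, `t > t₀`. -/
def maximalFun {Λ Z : Type*} [Group Λ] [MeasurableSpace Λ] [MulAction Λ Z]
    (T : Set ℝ) (S : ℝ → Set Λ) (t₀ : ℝ) (f : Z → ℝ) (z : Z) : ℝ≥0∞ :=
  ⨆ t ∈ T, ⨆ _ : t₀ < t, ‖actionAverage (uniformOn (S t)) f z‖ₑ

/-- Optimizing the truncation level. -/
lemma le_of_forall_truncation {W G : ℝ≥0∞} {a ε : ℝ} (ha : 1 < a) (hε : 0 < ε)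
    (h : ∀ x : ℚ, 0 < x → W ≤ ENNReal.ofReal (x * ε) + ENNReal.ofReal ((x : ℝ) ^ (1 - a)) * G) :
    W ≤ ENNReal.ofReal (3 * ε ^ (1 - 1 / a)) * G ^ (1 / a) := by
  have ha0 : 0 < a := by linarith
  have hεa : 0 < 3 * ε ^ (1 - 1 / a) := by positivity
  rcases eq_or_ne G ∞ with rfl | hGt
  · rw [ENNReal.top_rpow_of_pos (by positivity), ENNReal.mul_top (by simpa using hεa)]
    exact le_top
  have hG : G = ENNReal.ofReal G.toReal := (ENNReal.ofReal_toReal hGt).symm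
  set g := G.toReal with hg
  have hg0 : 0 ≤ g := ENNReal.toReal_nonneg
  clear_value g
  rcases hg0.eq_or_lt with h0 | h0
  · rw [← h0, ENNReal.ofReal_zero] at hG
    have hW : W ≤ 0 := by
      refine ENNReal.le_of_forall_pos_le_add fun δ hδ _ => ?_
      obtain ⟨x, hx0, hx⟩ := exists_rat_btwn (show (0 : ℝ) < δ / ε by positivity)
      refine (h x (by exact_mod_cast hx0)).trans ?_
      rw [hG, mul_zero, add_zero, zero_add, ← ENNReal.ofReal_coe_nnreal]
      refine ENNReal.ofReal_le_ofReal ?_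
      rw [lt_div_iff₀ hε] at hx
      exact hx.le
    exact hW.trans zero_le
  -- The level y makes both terms equal to ε^(1-1/a) g^(1/a). A rational x between y and 2y at most
  -- doubles the first term and does not increase the second, whence the factor 3.
  set y : ℝ := (g / ε) ^ (1 / a) with hy
  have hy0 : 0 < y := by positivity
  obtain ⟨x, hx1, hx2⟩ := exists_rat_btwn (show y < 2 * y by linarith)
  have hya : y ^ a = g / ε := by
    rw [hy, ← Real.rpow_mul (by positivity), one_div_mul_cancel ha0.ne', Real.rpow_one]
  have hval : y * ε = ε ^ (1 - 1 / a) * g ^ (1 / a) := by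
    rw [hy, Real.div_rpow h0.le hε.le, Real.rpow_sub hε, Real.rpow_one]
    field_simp
  have hval' : y ^ (1 - a) * g = y * ε := by
    rw [Real.rpow_sub hy0, Real.rpow_one, hya]
    field_simp
  refine (h x (by exact_mod_cast hy0.trans hx1)).trans ?_
  rw [hG, ENNReal.ofReal_rpow_of_pos h0, ← ENNReal.ofReal_mul hεa.le,
    ← ENNReal.ofReal_mul (Real.rpow_nonneg (hy0.trans hx1).le _),
    ← ENNReal.ofReal_add (mul_nonneg (hy0.trans hx1).le hε.le)
      (mul_nonneg (Real.rpow_nonneg (hy0.trans hx1).le _) h0.le)]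
  refine ENNReal.ofReal_le_ofReal ?_
  have h1 : (x : ℝ) ^ (1 - a) ≤ y ^ (1 - a) :=
    Real.rpow_le_rpow_of_nonpos hy0 hx1.le (by linarith)
  calc (x : ℝ) * ε + (x : ℝ) ^ (1 - a) * g ≤ 2 * y * ε + y ^ (1 - a) * g := by gcongr
    _ = 3 * (y * ε) := by rw [hval']; ring
    _ = _ := by rw [hval]; ring

/-! ### Truncation and unbounded functions -/

section Window

variable {Λ Z : Type*} [Group Λ] [MeasurableSpace Λ] [MeasurableSingletonClass Λ] [Countable Λ]
  [MulAction Λ Z] [MeasurableSpace Z] [MeasurableConstSMul Λ Z] {η : Measure Z}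
  [IsProbabilityMeasure η] [SMulInvariantMeasure Λ Z η] {T : Set ℝ} {S : ℝ → Set Λ} {D : ℝ}
  {n₀ : ℕ}

lemma IsDoubling.measurable_maximalFun (h : IsDoubling T S D n₀) (t₀ : ℝ) {f : Z → ℝ}
    (hf : Measurable f) : Measurable (maximalFun T S t₀ f) := by
  have h1 := measurable_iSup_finite (S := S) (T := T ∩ Ioi t₀) (fun t ht => h.finite t ht.1)
    (g := fun R (z : Z) => ‖actionAverage (uniformOn R) f z‖ₑ)
    fun _ hR => (measurable_actionAverage_uniformOn hR hf).enorm
  convert h1 using 2 with z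
  simp only [maximalFun, mem_inter_iff, mem_Ioi, iSup_and]

/-- Jensen's inequality at each time. With c = q/b it yields maximal bounds in L^b, for b ≥ q, from
the inequality in L^q, without interpolation. -/
lemma IsDoubling.maximalFun_rpow_le (h : IsDoubling T S D n₀) (t₀ : ℝ) {g : Z → ℝ} (hg : 0 ≤ g)
    {c : ℝ} (hc0 : 0 < c) (hc1 : c ≤ 1) (z : Z) :
    maximalFun T S t₀ (fun w => g w ^ c) z ≤ maximalFun T S t₀ g z ^ c := by
  refine iSup₂_le fun t ht => iSup_le fun htt => ?_
  have h1 : ‖actionAverage (uniformOn (S t)) g z‖ₑ ≤ maximalFun T S t₀ g z :=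
    le_iSup₂_of_le t ht (le_iSup_of_le htt le_rfl)
  have h2 := actionAverage_nonneg (uniformOn (S t)) hg z
  rw [Real.enorm_of_nonneg h2] at h1
  rw [Real.enorm_of_nonneg (actionAverage_nonneg _ (fun w => Real.rpow_nonneg (hg w) c) z)]
  calc _ ≤ ENNReal.ofReal (actionAverage (uniformOn (S t)) g z ^ c) :=
        ENNReal.ofReal_le_ofReal (actionAverage_rpow_le (h.finite t ht) hg hc0 hc1 z)
    _ = ENNReal.ofReal (actionAverage (uniformOn (S t)) g z) ^ c :=
        (ENNReal.ofReal_rpow_of_nonneg h2 hc0.le).symm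
    _ ≤ _ := ENNReal.rpow_le_rpow h1 hc0.le

/-- Truncation of `f` at height `x` changes the deviations by a multiple of the maximal function
of `|f| ^ a`. -/
lemma IsDoubling.windowSup_le_truncation (h : IsDoubling T S D n₀) {f : Z → ℝ}
    (hf : Measurable f) (hfi : Integrable f η) {a x t₀ : ℝ} (ha : 1 ≤ a) (hx : 0 < x)
    (hfa : Integrable (fun w => |f w| ^ a) η) {n : ℕ} (hn : t₀ < n) (z : Z) :
    windowSup T S η n f z ≤ windowSup T S η n ({w | |f w| ≤ x}.indicator f) z +
      ENNReal.ofReal (x ^ (1 - a)) *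
        (maximalFun T S t₀ (fun w => |f w| ^ a) z + ENNReal.ofReal (∫ w, |f w| ^ a ∂η)) := by
  set P : Set Z := {w | |f w| ≤ x} with hP
  have hPm : MeasurableSet P := measurableSet_le hf.abs measurable_const
  set g := P.indicator f with hg
  set k := Pᶜ.indicator f with hk
  have hfgk : f = fun w => g w + k w := (Set.indicator_self_add_compl P f).symm
  have hgi : Integrable g η := hfi.indicator hPm
  have hki : Integrable k η := hfi.indicator hPm.compl
  have hint : ∫ w, f w ∂η = ∫ w, g w ∂η + ∫ w, k w ∂η := by
    rw [← integral_add hgi hki, ← hfgk]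
  -- Where |f| > x, the factor (|f| / x)^(a-1) is at least 1.
  have hkle : ∀ w, |k w| ≤ x ^ (1 - a) * |f w| ^ a := by
    intro w
    by_cases hw : w ∈ P
    · rw [hk, Set.indicator_of_notMem (by simpa using hw), abs_zero]
      positivity
    · rw [hk, Set.indicator_of_mem (by simpa using hw)]
      have hxw : x < |f w| := not_le.1 hw
      have hpos : 0 < |f w| := hx.trans hxw
      calc |f w| = |f w| ^ (1 - a) * |f w| ^ a := by
            rw [← Real.rpow_add hpos, sub_add_cancel, Real.rpow_one]
        _ ≤ _ := by
            gcongr ?_ * _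
            exact Real.rpow_le_rpow_of_nonpos hx hxw.le (by linarith)
  have hx0 : 0 ≤ x ^ (1 - a) := by positivity
  refine iSup₂_le fun t ht => ?_
  have hfin := h.finite t ht.1
  have e1 : actionAverage (uniformOn (S t)) f z - ∫ w, f w ∂η =
      (actionAverage (uniformOn (S t)) g z - ∫ w, g w ∂η) +
        (actionAverage (uniformOn (S t)) k z - ∫ w, k w ∂η) := by
    rw [hint]
    conv_lhs => rw [hfgk]
    rw [actionAverage_uniformOn_add hfin]
    ring
  have e2 : ‖actionAverage (uniformOn (S t)) k z‖ₑ ≤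
      ENNReal.ofReal (x ^ (1 - a)) * maximalFun T S t₀ (fun w => |f w| ^ a) z := by
    have h1 : ‖actionAverage (uniformOn (S t)) (fun w => |f w| ^ a) z‖ₑ ≤
        maximalFun T S t₀ (fun w => |f w| ^ a) z :=
      le_iSup₂_of_le t ht.1 (le_iSup_of_le (hn.trans_le ht.2.1) le_rfl)
    refine le_trans ?_ (mul_le_mul' le_rfl h1)
    rw [Real.enorm_of_nonneg (actionAverage_nonneg _
        (f := fun w => |f w| ^ a) (fun w => by positivity) z),
      ← ENNReal.ofReal_mul hx0, Real.enorm_eq_ofReal_abs]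
    refine ENNReal.ofReal_le_ofReal ((abs_actionAverage_le _ k z).trans ?_)
    rw [← actionAverage_uniformOn_const_mul hfin]
    exact actionAverage_uniformOn_mono hfin hkle z
  have e3 : ‖∫ w, k w ∂η‖ₑ ≤
      ENNReal.ofReal (x ^ (1 - a)) * ENNReal.ofReal (∫ w, |f w| ^ a ∂η) := by
    rw [← ENNReal.ofReal_mul hx0, Real.enorm_eq_ofReal_abs, ← integral_const_mul]
    refine ENNReal.ofReal_le_ofReal ((abs_integral_le_integral_abs).trans ?_)
    exact integral_mono hki.abs (hfa.const_mul _) hkle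
  rw [e1, mul_add]
  refine (enorm_add_le _ _).trans (add_le_add ?_ ((enorm_sub_le).trans (add_le_add e2 e3)))
  exact le_iSup₂ (f := fun t (_ : t ∈ T ∩ Ico (n : ℝ) (n + 1)) =>
    ‖actionAverage (uniformOn (S t)) g z - ∫ w, g w ∂η‖ₑ) t ht

lemma eLpNorm_abs_rpow_le_one {f : Z → ℝ} {s p : ℝ≥0∞} (hs0 : s ≠ 0) (hs : s ≠ ∞) (hp : p ≠ ∞)
    (hp0 : p ≠ 0) (hf : eLpNorm f p η ≤ 1) :
    eLpNorm (fun w => |f w| ^ (p.toReal / s.toReal)) s η ≤ 1 := by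
  have hS := ENNReal.toReal_pos hs0 hs
  have hP := ENNReal.toReal_pos hp0 hp
  have h1 : s * ENNReal.ofReal (p.toReal / s.toReal) = p := by
    rw [← ENNReal.ofReal_toReal hs, ← ENNReal.ofReal_mul ENNReal.toReal_nonneg,
      ENNReal.toReal_ofReal hS.le, mul_div_cancel₀ _ hS.ne', ENNReal.ofReal_toReal hp]
  have h2 := eLpNorm_norm_rpow (p := s) (μ := η) f (q := p.toReal / s.toReal) (by positivity)
  rw [h1] at h2
  simp only [Real.norm_eq_abs] at h2
  rw [h2]
  exact ENNReal.rpow_le_one hf (by positivity)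

/-- The exponential maximal inequality from `L^∞`. -/
lemma IsDoubling.expStrongMaximalInequality_top (h : IsDoubling T S D n₀) {p r s : ℝ≥0∞}
    (hr : 1 ≤ r) (hs1 : 1 ≤ s) (hs : s = ∞ → r = ∞)
    (hexp : ExpMeanErgodicTheorem T (fun t => uniformOn (S t)) p r η) :
    ExpStrongMaximalInequality T (fun t => uniformOn (S t)) ∞ s η := by
  obtain ⟨K, κ, hK, hκ, hdec⟩ := h.eLpNorm_windowSup_le_of_top hr hs hexp
  refine h.expStrongMaximalInequality le_top hs1 hK hκ (n₁ := n₀) fun n hn g hg _ hgb => ?_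
  simpa using hdec n hn g 1 hg zero_le_one (hgb rfl)

lemma abs_indicator_le {f : Z → ℝ} {x : ℝ} (hx : 0 ≤ x) (w : Z) :
    |{w | |f w| ≤ x}.indicator f w| ≤ x := by
  by_cases hw : |f w| ≤ x
  · rwa [Set.indicator_of_mem (show w ∈ {w | |f w| ≤ x} from hw)]
  · rwa [Set.indicator_of_notMem (show w ∉ {w | |f w| ≤ x} from hw), abs_zero]

/-- The exponential maximal inequality in `(L^{p'}, L^s)` for `s < p'`. -/
lemma IsDoubling.expStrongMaximalInequality_of_lt (h : IsDoubling T S D n₀)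
    {p r q p' s : ℝ≥0∞} (hr : 1 ≤ r)
    (hexp : ExpMeanErgodicTheorem T (fun t => uniformOn (S t)) p r η) (hq : 1 ≤ q)
    (hmax : StrongMaximalInequality T (fun t => uniformOn (S t)) q q η)
    (hqp : q < p') (hpt : p' ≠ ∞) (hs1 : 1 ≤ s) (hsp : s < p') :
    ExpStrongMaximalInequality T (fun t => uniformOn (S t)) p' s η := by
  obtain ⟨K, κ, hK, hκ, hdec⟩ := h.eLpNorm_windowSup_le_of_top hr
    (fun hs => absurd hs (hsp.trans_le le_top).ne) hexp
  obtain ⟨t₀, -, C, hC, hmax⟩ := hmax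
  -- Since q ≤ b < p', the exponents a = p'/b > 1 and c = q/b ≤ 1 are available. Writing |f|^a as
  -- the power c of |f|^(p'/q) bounds its maximal function in L^b, hence in L^s.
  set b : ℝ≥0∞ := max s q with hb
  have hbp : b < p' := max_lt hsp hqp
  have hbt : b ≠ ∞ := (hbp.trans_le le_top).ne
  have hb1 : 1 ≤ b := hs1.trans (le_max_left _ _)
  have hb0 : b ≠ 0 := (zero_lt_one.trans_le hb1).ne'
  have hqt : q ≠ ∞ := (hqp.trans_le le_top).ne
  have hq0 : q ≠ 0 := (zero_lt_one.trans_le hq).ne'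
  have hp1 : 1 ≤ p' := hq.trans hqp.le
  have hp0 : p' ≠ 0 := (zero_lt_one.trans_le hp1).ne'
  have hQ := ENNReal.toReal_pos hq0 hqt
  have hB := ENNReal.toReal_pos hb0 hbt
  have hP := ENNReal.toReal_pos hp0 hpt
  set a : ℝ := p'.toReal / b.toReal with ha
  set c : ℝ := q.toReal / b.toReal with hc
  have ha1 : 1 < a := (one_lt_div hB).2 ((ENNReal.toReal_lt_toReal hbt hpt).2 hbp)
  have hc0 : 0 < c := by positivity
  have hc1 : c ≤ 1 := (div_le_one hB).2 (ENNReal.toReal_mono hbt (le_max_right _ _))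
  have hbc : b * ENNReal.ofReal c = q := by
    rw [← ENNReal.ofReal_toReal hbt, ← ENNReal.ofReal_mul ENNReal.toReal_nonneg,
      hc, mul_div_cancel₀ _ hB.ne', ENNReal.ofReal_toReal hqt]
  obtain ⟨n₂, hn₂⟩ := exists_nat_gt t₀
  set κ' : ℝ := min (κ / 2) (κ / 2 * (a - 1)) with hκ'
  have hκ'0 : 0 < κ' := lt_min (by positivity) (mul_pos (by positivity) (by linarith))
  refine h.expStrongMaximalInequality hp1 hs1 (K := K + (C ^ c + 1)) (by positivity) hκ'0
    (n₁ := max n₀ n₂) fun n hn f hf hfn _ => ?_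
  have hnn₀ : n₀ ≤ n := (le_max_left _ _).trans hn
  have hnt : t₀ < n := hn₂.trans_le (by exact_mod_cast (le_max_right _ _).trans hn)
  set g : Z → ℝ := fun w => |f w| ^ (p'.toReal / q.toReal) with hg
  have hg0 : 0 ≤ g := fun w => by positivity
  have hgm : Measurable g := hf.abs.pow_const _
  have hgn : eLpNorm g q η ≤ 1 := eLpNorm_abs_rpow_le_one hq0 hqt hpt hp0 hfn
  have hgc : (fun w => |f w| ^ a) = fun w => g w ^ c := by
    funext w
    rw [hg, ← Real.rpow_mul (abs_nonneg _), ha, hc]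
    congr 1
    field_simp
  have hfam : Measurable fun w => |f w| ^ a := hf.abs.pow_const _
  have hfan : eLpNorm (fun w => |f w| ^ a) b η ≤ 1 :=
    eLpNorm_abs_rpow_le_one hb0 hbt hpt hp0 hfn
  have hfp : MemLp f p' η := ⟨hf.aestronglyMeasurable, hfn.trans_lt ENNReal.one_lt_top⟩
  have hfap : MemLp (fun w => |f w| ^ a) b η :=
    ⟨hfam.aestronglyMeasurable, hfan.trans_lt ENNReal.one_lt_top⟩
  have hMm := h.measurable_maximalFun t₀ hgm
  have hM : eLpNorm (maximalFun T S t₀ fun w => |f w| ^ a) s η ≤ ENNReal.ofReal (C ^ c) := by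
    calc _ ≤ eLpNorm (fun z => maximalFun T S t₀ g z ^ c) s η := by
          rw [hgc]
          exact eLpNorm_mono_enorm fun z => h.maximalFun_rpow_le t₀ hg0 hc0 hc1 z
      _ ≤ eLpNorm (fun z => maximalFun T S t₀ g z ^ c) b η :=
          eLpNorm_le_eLpNorm_of_exponent_le (le_max_left _ _)
            (hMm.pow_const _).aestronglyMeasurable
      _ = eLpNorm (maximalFun T S t₀ g) q η ^ c := by rw [eLpNorm_rpow_eq hc0, hbc]
      _ ≤ (ENNReal.ofReal C * 1) ^ c := by
          refine ENNReal.rpow_le_rpow ((hmax g ⟨hgm.aestronglyMeasurable,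
            hgn.trans_lt ENNReal.one_lt_top⟩).trans (mul_le_mul' le_rfl hgn)) hc0.le
      _ = _ := by rw [mul_one, ENNReal.ofReal_rpow_of_pos hC]
  have hI : ENNReal.ofReal (∫ w, |f w| ^ a ∂η) ≤ 1 :=
    (ofReal_integral_le_eLpNorm hb1 hfam).trans hfan
  -- Truncating at e^(nκ/2) spends half of the decay rate on the bounded part and makes the tail
  -- factor x^(1-a) = e^(-nκ(a-1)/2).
  set x : ℝ := Real.exp (n * (κ / 2)) with hx
  have hx0 : 0 < x := Real.exp_pos _
  set k := {w | |f w| ≤ x}.indicator f with hk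
  have hkm : Measurable k := hf.indicator (measurableSet_le hf.abs measurable_const)
  have h1 := hdec n hnn₀ k x hkm hx0.le (abs_indicator_le hx0.le)
  set R : Z → ℝ≥0∞ := fun z => ENNReal.ofReal (x ^ (1 - a)) *
    (maximalFun T S t₀ (fun w => |f w| ^ a) z + ENNReal.ofReal (∫ w, |f w| ^ a ∂η)) with hR
  have hMm' := h.measurable_maximalFun t₀ hfam
  have hRm : Measurable R := (hMm'.add_const _).const_mul _
  have h2 : eLpNorm R s η ≤ ENNReal.ofReal (x ^ (1 - a) * (C ^ c + 1)) := by
    have e1 : eLpNorm R s η ≤ ENNReal.ofReal (x ^ (1 - a)) * eLpNorm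
        (maximalFun T S t₀ (fun w => |f w| ^ a) +
          fun _ => ENNReal.ofReal (∫ w, |f w| ^ a ∂η)) s η :=
      eLpNorm_le_mul_eLpNorm_of_ae_le_mul' (c := (x ^ (1 - a)).toNNReal)
        (ae_of_all _ fun z => le_rfl) s
    rw [ENNReal.ofReal_mul (by positivity), ENNReal.ofReal_add (by positivity) zero_le_one,
      ENNReal.ofReal_one]
    refine e1.trans (mul_le_mul' le_rfl ((eLpNorm_add_le hMm'.aestronglyMeasurable
      aestronglyMeasurable_const hs1).trans (add_le_add hM ?_)))
    rw [eLpNorm_const _ (zero_lt_one.trans_le hs1).ne' (IsProbabilityMeasure.ne_zero η),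
      measure_univ, ENNReal.one_rpow, mul_one, enorm_eq_self]
    exact hI
  have hn0 : (0 : ℝ) ≤ n := Nat.cast_nonneg n
  calc eLpNorm (windowSup T S η n f) s η ≤ eLpNorm (windowSup T S η n k + R) s η :=
        eLpNorm_mono_enorm fun z => h.windowSup_le_truncation hf (hfp.integrable hp1) ha1.le hx0
          (hfap.integrable hb1) hnt z
    _ ≤ ENNReal.ofReal (K * x * Real.exp (-(n * κ))) +
        ENNReal.ofReal (x ^ (1 - a) * (C ^ c + 1)) :=
        (eLpNorm_add_le (h.measurable_windowSup n hkm).aestronglyMeasurable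
          hRm.aestronglyMeasurable hs1).trans (add_le_add h1 h2)
    _ ≤ _ := by
        rw [← ENNReal.ofReal_add (by positivity) (by positivity)]
        refine ENNReal.ofReal_le_ofReal ?_
        have e1 : x * Real.exp (-(n * κ)) ≤ Real.exp (-(n * κ')) := by
          rw [hx, ← Real.exp_add]
          have : κ' ≤ κ / 2 := min_le_left _ _
          exact Real.exp_le_exp.2 (by nlinarith)
        have e2 : x ^ (1 - a) ≤ Real.exp (-(n * κ')) := by
          rw [hx, ← Real.exp_mul]
          have : κ' ≤ κ / 2 * (a - 1) := min_le_right _ _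
          exact Real.exp_le_exp.2 (by nlinarith)
        calc K * x * Real.exp (-(n * κ)) + x ^ (1 - a) * (C ^ c + 1)
            = K * (x * Real.exp (-(n * κ))) + x ^ (1 - a) * (C ^ c + 1) := by ring
          _ ≤ K * Real.exp (-(n * κ')) + Real.exp (-(n * κ')) * (C ^ c + 1) := by gcongr
          _ = _ := by ring

/-- The exponential maximal inequality in `L^{p'}` when the mean ergodic theorem is exponential
with values in `L^∞`. -/
lemma IsDoubling.expStrongMaximalInequality_self (h : IsDoubling T S D n₀)
    {p q p' : ℝ≥0∞}
    (hexp : ExpMeanErgodicTheorem T (fun t => uniformOn (S t)) p ∞ η) (hq : 1 ≤ q)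
    (hmax : StrongMaximalInequality T (fun t => uniformOn (S t)) q q η)
    (hqp : q < p') (hpt : p' ≠ ∞) :
    ExpStrongMaximalInequality T (fun t => uniformOn (S t)) p' p' η := by
  obtain ⟨K, κ, hK, hκ, hdec⟩ := h.eLpNorm_windowSup_le le_top hexp
  obtain ⟨t₀, -, C, hC, hmax⟩ := hmax
  have hqt : q ≠ ∞ := (hqp.trans_le le_top).ne
  have hq0 : q ≠ 0 := (zero_lt_one.trans_le hq).ne'
  have hp1 : 1 ≤ p' := hq.trans hqp.le
  have hp0 : p' ≠ 0 := (zero_lt_one.trans_le hp1).ne'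
  have hQ := ENNReal.toReal_pos hq0 hqt
  have hP := ENNReal.toReal_pos hp0 hpt
  -- The target exponent is now p' itself, which leaves no room for an intermediate b < p'. As
  -- bounded functions decay in L^∞, the truncation level can be optimized at each point instead;
  -- with a = p'/q, R ∈ L^q gives R^(1/a) ∈ L^{p'}.
  set a : ℝ := p'.toReal / q.toReal with ha
  have ha1 : 1 < a := (one_lt_div hQ).2 ((ENNReal.toReal_lt_toReal hqt hpt).2 hqp)
  have hpa : p' * ENNReal.ofReal (1 / a) = q := by
    rw [← ENNReal.ofReal_toReal hpt, ← ENNReal.ofReal_mul ENNReal.toReal_nonneg,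
      ha, one_div_div, mul_div_cancel₀ _ hP.ne', ENNReal.ofReal_toReal hqt]
  have ha2 : 0 < 1 - 1 / a := by
    rw [sub_pos, div_lt_one (by linarith)]; exact ha1
  obtain ⟨n₂, hn₂⟩ := exists_nat_gt t₀
  refine h.expStrongMaximalInequality hp1 hp1
    (K := 3 * K ^ (1 - 1 / a) * (C + 1) ^ (1 / a)) (by positivity)
    (κ := κ * (1 - 1 / a)) (by positivity)
    (n₁ := max n₀ n₂) fun n hn f hf hfn _ => ?_
  have hnn₀ : n₀ ≤ n := (le_max_left _ _).trans hn
  have hnt : t₀ < n := hn₂.trans_le (by exact_mod_cast (le_max_right _ _).trans hn)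
  have hfam : Measurable fun w => |f w| ^ a := hf.abs.pow_const _
  have hfan : eLpNorm (fun w => |f w| ^ a) q η ≤ 1 :=
    eLpNorm_abs_rpow_le_one hq0 hqt hpt hp0 hfn
  have hfp : MemLp f p' η := ⟨hf.aestronglyMeasurable, hfn.trans_lt ENNReal.one_lt_top⟩
  have hfap : MemLp (fun w => |f w| ^ a) q η :=
    ⟨hfam.aestronglyMeasurable, hfan.trans_lt ENNReal.one_lt_top⟩
  have hI : ENNReal.ofReal (∫ w, |f w| ^ a ∂η) ≤ 1 :=
    (ofReal_integral_le_eLpNorm hq hfam).trans hfan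
  have hMm' := h.measurable_maximalFun t₀ hfam
  set R : Z → ℝ≥0∞ := maximalFun T S t₀ (fun w => |f w| ^ a) +
    fun _ => ENNReal.ofReal (∫ w, |f w| ^ a ∂η) with hR
  have hRn : eLpNorm R q η ≤ ENNReal.ofReal (C + 1) := by
    rw [ENNReal.ofReal_add hC.le zero_le_one, ENNReal.ofReal_one]
    refine (eLpNorm_add_le hMm'.aestronglyMeasurable
      aestronglyMeasurable_const hq).trans (add_le_add ?_ ?_)
    · exact ((hmax _ hfap).trans (mul_le_mul' le_rfl hfan)).trans (by rw [mul_one])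
    · rw [eLpNorm_const _ hq0 (IsProbabilityMeasure.ne_zero η),
        measure_univ, ENNReal.one_rpow, mul_one, enorm_eq_self]
      exact hI
  set ε : ℝ := K * Real.exp (-(n * κ)) with hε
  have hε0 : 0 < ε := by positivity
  have hpt : ∀ᵐ z ∂η, windowSup T S η n f z ≤
      ENNReal.ofReal (3 * ε ^ (1 - 1 / a)) * R z ^ (1 / a) := by
    -- Only rational levels are used, so that one null set serves all of them and the level may
    -- depend on z.
    have h1 : ∀ᵐ z ∂η, ∀ x : ℚ, 0 < x →
        windowSup T S η n ({w | |f w| ≤ (x : ℝ)}.indicator f) z ≤ ENNReal.ofReal (x * ε) := by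
      rw [ae_all_iff]
      intro x
      by_cases hx : 0 < x
      · have hx0 : (0 : ℝ) < x := by exact_mod_cast hx
        have h2 := hdec n hnn₀ _ x (hf.indicator (measurableSet_le hf.abs
          measurable_const)) hx0.le (abs_indicator_le hx0.le)
        rw [eLpNorm_exponent_top] at h2
        filter_upwards [enorm_ae_le_eLpNormEssSup
          (windowSup T S η n ({w | |f w| ≤ (x : ℝ)}.indicator f)) η] with z hz _
        rw [enorm_eq_self] at hz
        refine hz.trans (h2.trans (le_of_eq ?_))
        congr 1
        rw [hε]; ring
      · exact ae_of_all _ fun z h => absurd h hx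
    filter_upwards [h1] with z hz
    refine le_of_forall_truncation ha1 hε0 fun x hx => ?_
    have hx0 : (0 : ℝ) < x := by exact_mod_cast hx
    exact (h.windowSup_le_truncation hf (hfp.integrable hp1) ha1.le hx0
      (hfap.integrable hq) hnt z).trans (add_le_add (hz x hx) le_rfl)
  calc eLpNorm (windowSup T S η n f) p' η
      ≤ ENNReal.ofReal (3 * ε ^ (1 - 1 / a)) * eLpNorm (fun z => R z ^ (1 / a)) p' η :=
        eLpNorm_le_mul_eLpNorm_of_ae_le_mul' (c := (3 * ε ^ (1 - 1 / a)).toNNReal) hpt p'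
    _ = ENNReal.ofReal (3 * ε ^ (1 - 1 / a)) * eLpNorm R q η ^ (1 / a) := by
        rw [eLpNorm_rpow_eq (by positivity), hpa]
    _ ≤ ENNReal.ofReal (3 * ε ^ (1 - 1 / a)) * ENNReal.ofReal (C + 1) ^ (1 / a) :=
        mul_le_mul' le_rfl (ENNReal.rpow_le_rpow hRn (by positivity))
    _ = _ := by
        rw [ENNReal.ofReal_rpow_of_pos (by positivity), ← ENNReal.ofReal_mul (by positivity)]
        congr 1
        rw [hε, Real.mul_rpow hK.le (Real.exp_pos _).le, ← Real.exp_mul]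
        rw [show -(↑n * κ) * (1 - 1 / a) = -(↑n * (κ * (1 - 1 / a))) by ring]
        ring

/-- The exponential maximal inequality with interpolated exponents. -/
theorem IsDoubling.expStrongMaximalInequality_interpolated (h : IsDoubling T S D n₀)
    {p r q : ℝ≥0∞} (hr : 1 ≤ r)
    (hexp : ExpMeanErgodicTheorem T (fun t => uniformOn (S t)) p r η) (hq : 1 < q)
    (hmax : StrongMaximalInequality T (fun t => uniformOn (S t)) q q η) {u : ℝ}
    (hu : u ∈ Ioo (0 : ℝ) 1) {p' r' : ℝ≥0∞} (hp' : p'⁻¹ = ENNReal.ofReal (1 - u) / q)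
    (hr' : r'⁻¹ = ENNReal.ofReal (1 - u) / q + ENNReal.ofReal u / r) :
    ExpStrongMaximalInequality T (fun t => uniformOn (S t)) p' r' η := by
  have hu0 : ENNReal.ofReal u ≠ 0 := by simpa using hu.1
  have hu1 : ENNReal.ofReal (1 - u) ≠ 0 := by simpa using hu.2
  have hr'1 : 1 ≤ r' := by
    rw [← ENNReal.inv_le_one, hr']
    calc _ ≤ ENNReal.ofReal (1 - u) + ENNReal.ofReal u := by
          refine add_le_add ?_ ?_
          · exact ENNReal.div_le_of_le_mul (le_mul_of_one_le_right' hq.le)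
          · exact ENNReal.div_le_of_le_mul (le_mul_of_one_le_right' hr)
      _ = 1 := by
          rw [← ENNReal.ofReal_add (by linarith [hu.2]) hu.1.le]; simp
  -- If q = ∞, then p' = ∞ and r' = r/u, which is infinite only when r is. If q is finite, u > 0
  -- gives q < p' < ∞; then r' = p' when r = ∞, and r' < p' otherwise.
  rcases eq_or_ne q ∞ with rfl | hqt
  · rw [ENNReal.div_top] at hp' hr'
    rw [ENNReal.inv_eq_zero] at hp'
    subst hp'
    refine h.expStrongMaximalInequality_top hr hr'1 (fun hs => ?_) hexp
    rw [hs, ENNReal.inv_top, zero_add, eq_comm, ENNReal.div_eq_zero_iff] at hr'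
    exact hr'.resolve_left hu0
  have hq0 : q ≠ 0 := (zero_lt_one.trans hq).ne'
  have hpt : p' ≠ ∞ := by
    rintro rfl
    rw [ENNReal.inv_top, eq_comm, ENNReal.div_eq_zero_iff] at hp'
    exact hp'.elim hu1 hqt
  have hqp : q < p' := by
    rw [← ENNReal.inv_lt_inv, hp', ENNReal.div_eq_inv_mul]
    calc q⁻¹ * ENNReal.ofReal (1 - u) < q⁻¹ * 1 := by
          refine ENNReal.mul_lt_mul_right (ENNReal.inv_ne_zero.2 hqt)
            (ENNReal.inv_ne_top.2 hq0) ?_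
          rw [← ENNReal.ofReal_one]
          exact (ENNReal.ofReal_lt_ofReal_iff one_pos).2 (by linarith [hu.1])
      _ = q⁻¹ := mul_one _
  rcases eq_or_ne r ∞ with rfl | hrt
  · rw [ENNReal.div_top, add_zero, ← hp', inv_inj] at hr'
    subst hr'
    exact h.expStrongMaximalInequality_self hexp hq.le hmax hqp hpt
  · refine h.expStrongMaximalInequality_of_lt hr hexp hq.le hmax hqp hpt hr'1 ?_
    rw [← ENNReal.inv_lt_inv, hr', ← hp']
    refine ENNReal.lt_add_right (ENNReal.inv_ne_top.2 fun h0 => ?_) (ENNReal.div_ne_zero.2 ⟨hu0, hrt⟩)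
    rw [h0] at hqp
    exact absurd hqp not_lt_zero

end Window

/-! ### Doubling of lattice counts -/

section Lattice

variable {G : Type*} [Group G] [TopologicalSpace G] [IsTopologicalGroup G] [T2Space G]
  [LocallyCompactSpace G] [SecondCountableTopology G] [MeasurableSpace G] [BorelSpace G]
  {Γ : Subgroup G} {m : Measure G} [m.IsHaarMeasure] {T : Set ℝ} {A : ℝ → Set G}
  {X : Type*} [MulAction Γ X] [MeasurableSpace X] [MeasurableConstSMul Γ X]
  {μ : Measure X} [IsProbabilityMeasure μ] [SMulInvariantMeasure Γ X μ] {F : Set G}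
  [m.IsMulRightInvariant] [m.IsInvInvariant]

/-- Lattice points in a coarsely admissible family form a doubling family. -/
lemma IsCoarselyAdmissible.exists_isDoubling (h : IsCoarselyAdmissible m T A) (hΓ : IsLattice Γ)
    (hF : IsFundamentalDomain Γ.op F m) (hmF : m F = 1) (hT : T = realTimes ∨ T = natTimes)
    (hA : IsIncreasingBoundedFamily T A) {p r : ℝ≥0∞} (hr : 1 ≤ r)
    (hexp : ExpMeanErgodicTheorem T (latticeUniform Γ A) p r μ) :
    ∃ (D : ℝ) (n₀ : ℕ), IsDoubling T (fun t => {γ : Γ | (γ : G) ∈ A t}) D n₀ := by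
  have := hΓ.countable
  obtain ⟨K, hK, t₂, hcount⟩ := h.exists_latticeCount_bounds hΓ hF hmF hT hA
  obtain ⟨d, hd, t₁, hgrow⟩ := h.exists_growth hA (one_mem_times hT)
  obtain ⟨C, hC, θ, hθ, hexp⟩ := hexp
  have hfin := fun t ht => hΓ.finite_inter (hA.bounded t ht)
  have hmono : MonotoneOn (fun t => {γ : Γ | (γ : G) ∈ A t}) T :=
    fun s hs t ht hst γ hγ => hA.mono hs ht hst hγ
  have hmem : ∀ n : ℕ, 1 ≤ n → (n : ℝ) ∈ T := fun n hn => by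
    rcases hT with rfl | rfl
    · exact mem_Ioi.2 (by exact_mod_cast hn)
    · exact ⟨n, hn, rfl⟩
  obtain ⟨t₃, ht₃⟩ : ∃ t₃ : ℝ, ∀ t, t₃ ≤ t → C * Real.exp (-(t * θ)) < 1 := by
    have h1 : Tendsto (fun t : ℝ => C * Real.exp (-(t * θ))) atTop (𝓝 (C * 0)) :=
      (Real.tendsto_exp_neg_atTop_nhds_zero.comp
        (tendsto_id.atTop_mul_const hθ)).const_mul _
    rw [mul_zero] at h1
    exact eventually_atTop.1 (h1.eventually_lt_const one_pos)
  obtain ⟨n₀, hn₀⟩ := exists_nat_ge (max (max 1 t₃) (max t₁ t₂))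
  have e1 := ((le_max_left _ _).trans (le_max_left (max 1 t₃) (max t₁ t₂))).trans hn₀
  have e2 := ((le_max_right _ _).trans (le_max_left (max 1 t₃) (max t₁ t₂))).trans hn₀
  have e3 := ((le_max_left _ _).trans (le_max_right (max 1 t₃) (max t₁ t₂))).trans hn₀
  have e4 := ((le_max_right _ _).trans (le_max_right (max 1 t₃) (max t₁ t₂))).trans hn₀
  have hn₀1 : 1 ≤ n₀ := by exact_mod_cast e1
  -- Writing N_n for the count at n, one has N_{n+1} ≤ K m(A_{n+1}) ≤ Kd m(A_n) ≤ KdK N_n.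
  refine ⟨K * d * K, n₀, hfin, hmono, fun t ht => (times_pos hT ht).le,
    fun n hn => hmem n (hn₀1.trans hn), fun n hn => ?_, fun n hn t ht => ?_⟩
  · have hnT := hmem n (hn₀1.trans hn)
    have hnn : (n₀ : ℝ) ≤ n := by exact_mod_cast hn
    -- If Γ ∩ A_n were empty, the averages of the constant 1 would vanish and deviate from its mean
    -- by 1, against C e^(-nθ) < 1.
    refine Nat.pos_of_ne_zero fun h0 => ?_
    have h1 := hexp (fun _ => 1) (memLp_const _) n hnT
    have h2 : ∀ x : X, actionAverage (latticeUniform Γ A n) (fun _ : X => (1 : ℝ)) x = 0 :=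
      fun x => by rw [latticeUniform, actionAverage_uniformOn (hfin n hnT), h0]; simp
    have hr0 : r ≠ 0 := (zero_lt_one.trans_le hr).ne'
    have h3 : eLpNorm (fun _ : X => (1 : ℝ)) p μ ≤ 1 := by
      simpa using eLpNorm_le_ofReal_of_bound (η := μ) (f := fun _ : X => (1 : ℝ)) (M := 1)
        (fun _ => by simp) p
    simp only [h2, integral_const, probReal_univ, smul_eq_mul, mul_one, zero_sub] at h1
    rw [eLpNorm_const _ hr0 (IsProbabilityMeasure.ne_zero μ), measure_univ, ENNReal.one_rpow,
      mul_one, enorm_neg, enorm_one] at h1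
    have h4 := h1.trans (mul_le_mul' le_rfl h3)
    rw [mul_one, ← ENNReal.ofReal_one, ENNReal.ofReal_le_ofReal_iff (by positivity)] at h4
    linarith [ht₃ n (e2.trans hnn)]
  · have hnT := hmem n (hn₀1.trans hn)
    have hnn : (n₀ : ℝ) ≤ n := by exact_mod_cast hn
    have hn1T := times_add_mem hT hnT (one_mem_times hT)
    have h1 := (hcount (n + 1) hn1T (by linarith)).2
    have h2 := (hcount n hnT (by linarith)).1
    have h3 := hgrow n hnT (by linarith)
    calc _ ≤ latticeCount Γ (A (n + 1)) := by
          rw [latticeCount, Nat.cast_le]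
          exact Set.ncard_le_ncard (hmono ht.1 hn1T ht.2.2.le) (hfin _ hn1T)
      _ ≤ K * (d * (K * latticeCount Γ (A n))) := h1.trans (by gcongr; exact h3.trans (by gcongr))
      _ = _ := by rw [latticeCount]; ring

end Lattice

end LatticeErgodic

end

/-! ### The five implications -/

theorem mainTheorem5 {G X : Type*}
    [Group G] [TopologicalSpace G] [IsTopologicalGroup G] [T2Space G]
    [LocallyCompactSpace G] [SecondCountableTopology G] [MeasurableSpace G] [BorelSpace G]
    (Γ : Subgroup G) (hΓ : IsLattice Γ)
    (m : Measure G) [m.IsHaarMeasure]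
    (F : Set G) (hF : IsFundamentalDomain Γ.op F m) (hmF : m F = 1)
    [MeasurableSpace X] [StandardBorelSpace X] [MulAction Γ X] [MeasurableConstSMul Γ X]
    (μ : Measure X) [IsProbabilityMeasure μ] [SMulInvariantMeasure Γ X μ]
    (O : ℝ → Set G) (hO : IsNhdFamily O)
    (hdim : upperLocalDimension m O < ⊤)
    (T : Set ℝ) (hT : T = realTimes ∨ T = natTimes)
    (A : ℝ → Set G) (hA : IsIncreasingBoundedFamily T A)
    (p r : ℝ≥0∞) (hr : 1 ≤ r) (hrp : r ≤ p)
    (ν : Measure (InducedSpace Γ X))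
    (hν : ν = inducedMeasure Γ X m F μ)
    (β : ℝ → Measure G) (hβ : β = haarUniform m A)
    (lam : ℝ → Measure Γ) (hlam : lam = latticeUniform Γ A) :
    -- (1) strong maximal inequality
    (IsCoarselyAdmissible m T A →
      StrongMaximalInequality T β p r ν →
      StrongMaximalInequality T lam p r μ) ∧
    -- (2) mean ergodic theorem
    ((T = realTimes ∧ IsAdmissibleFamily m O A ∨
        T = natTimes ∧ IsAdmissibleSequence m A) →
      MeanErgodicTheorem T β p ν →
      MeanErgodicTheorem T lam p μ) ∧
    -- (3) pointwise ergodic theorem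
    (T = realTimes → IsQuasiUniform m A →
      PointwiseErgodicTheorem T β p ν →
      PointwiseErgodicTheorem T lam p μ) ∧
    -- (4) exponential mean ergodic theorem
    ((T = realTimes ∧ IsAdmissibleFamily m O A ∧
          upperLocalDimension m O < (r : EReal) ∨
        T = natTimes ∧ IsAdmissibleSequence m A) →
      ExpMeanErgodicTheorem T β p r ν →
      ExpMeanErgodicTheorem T lam p r μ) ∧
    -- (5) exponential strong maximal inequality
    ((T = realTimes ∧ IsAdmissibleFamily m O A ∧
          upperLocalDimension m O < (r : EReal) ∨
        T = natTimes ∧ IsAdmissibleSequence m A) →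
      ExpMeanErgodicTheorem T β p r ν →
      ∀ q : ℝ≥0∞, 1 < q → StrongMaximalInequality T β q q ν →
      ∀ u ∈ Ioo (0 : ℝ) 1, ∀ p' r' : ℝ≥0∞,
        p'⁻¹ = ENNReal.ofReal (1 - u) / q →
        r'⁻¹ = ENNReal.ofReal (1 - u) / q + ENNReal.ofReal u / r →
        ExpStrongMaximalInequality T lam p' r' μ) := by
  have := hΓ.isMulRightInvariant m
  have := isInvInvariant_of_isMulRightInvariant m
  subst hν hβ hlam
  have hfine : (T = realTimes ∧ IsAdmissibleFamily m O A ∨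
      T = natTimes ∧ IsAdmissibleSequence m A) →
      HasFineThickenings Γ m T A ∧ IsCoarselyAdmissible m T A := by
    rintro (⟨rfl, h⟩ | ⟨rfl, h⟩)
    · exact ⟨h.hasFineThickenings hΓ hA hO hdim, h.coarse⟩
    · exact ⟨h.hasFineThickenings hΓ, h.coarse⟩
  have hadm : (T = realTimes ∧ IsAdmissibleFamily m O A ∧
      upperLocalDimension m O < (r : EReal) ∨ T = natTimes ∧ IsAdmissibleSequence m A) →
      HasFineThickenings Γ m T A ∧ IsCoarselyAdmissible m T A := fun h =>
    hfine (h.imp_left fun h => ⟨h.1, h.2.1⟩)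
  refine ⟨fun h => strongMaximalInequality_latticeUniform hΓ hF hmF hT hA h,
    fun h => (hfine h).1.hasThickenings.meanErgodicTheorem hΓ hF hA (hr.trans hrp), ?_,
    fun h => (hadm h).1.expMeanErgodicTheorem hΓ hF hmF hT hA hr hrp, ?_⟩
  · rintro rfl h
    exact (h.hasThickenings hΓ hA).pointwiseErgodicTheorem hΓ hF hA (hr.trans hrp)
  · intro h hexp q hq hmax u hu p' r' hp' hr'
    obtain ⟨hfine, hcoarse⟩ := hadm h
    have := hΓ.countable
    -- From here on the argument takes place on X: the exponential mean theorem and the maximal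
    -- inequality for the lattice averages are both transferred and then combined.
    have hexp' := hfine.expMeanErgodicTheorem hΓ hF hmF hT hA hr hrp hexp
    obtain ⟨D, n₀, hD⟩ := hcoarse.exists_isDoubling hΓ hF hmF hT hA hr hexp'
    exact hD.expStrongMaximalInequality_interpolated hr hexp' hq
      (strongMaximalInequality_latticeUniform hΓ hF hmF hT hA hcoarse hmax) hu hp' hr'
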